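/- **Setting.** All algebras are unital and over $\mathbb{C}$. $H$ is the Hopf $*$-algebra of polynomial functions on a compact quantum group: the coproduct $\Delta$ is a $*$-map and $H$ is spanned by the matrix coefficients of its finite-dimensional unitary corepresentations. A *quantum principal bundle* is a triple $(P,B,\Delta_P)$, where $P$ is a $*$-algebra, $\Delta_P:P\to P\otimes H$ is a $*$-homomorphism and a (coassociative, counital) right coaction, $B=\{x\in P\mid \Delta_P(x)=x\otimes 1\}$, and $P\otimes P\to P\otimes H$, $x\otimes y\mapsto (x\otimes 1)\Delta_P(y)$, is surjective. Let $(\Gamma,d)$ be a bicovariant first order $*$-differential calculus over $H$ and let $\Gamma^\wedge=\bigoplus_k\Gamma^{\wedge k}$ be its universal differential envelope, i.e. the quotient of the tensor algebra of the $H$-bimodule $\Gamma$ by the ideal generated by all $\sum_i dg_i\otimes_H dh_i$ with $\sum_i g_i\,dh_i=0$. It is a graded differential Hopf algebra: $\Delta:\Gamma^\wedge\to\Gamma^\wedge\otimes\Gamma^\wedge$ is the extension of the coproduct of $H$ to a morphism of graded differential algebras, $\epsilon$ is the counit of $H$ in degree $0$ and zero in positive degrees, and $S$ is the graded-antimultiplicative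 extension of the antipode of $H$ commuting with $d$. (Tensor products of graded algebras carry the graded product $(a\otimes b)(a'\otimes b')=(-1)^{\partial b\,\partial a'}aa'\otimes bb'$, where $\partial$ denotes the degree.) In Sweedler notation, put $$\mathrm{Ad}:\Gamma^\wedge\to\Gamma^\wedge\otimes\Gamma^\wedge,\qquad \mathrm{Ad}(t)=(-1)^{\partial t^{(1)}\partial t^{(2)}}\,t^{(2)}\otimes S(t^{(1)})t^{(3)}.$$ A *differential calculus* on the bundle consists of such a $\Gamma$, a graded differential $*$-algebra $\Omega(P)=\bigoplus_k\Omega^k(P)$ that is generated, as a differential algebra, by $\Omega^0(P)=P$ (with its given $*$-structure), and an extension of $\Delta_P$ to a morphism of graded differential $*$-algebras $\Delta_\Omega:\Omega(P)\to\Omega(P)\otimes\Gamma^\wedge$. Let $\Omega(B)=\{\mu\in\Omega(P)\mid\Delta_\Omega(\mu)=\mu\otimes 1\}$. **Proposition.** Fix a quantum principal bundle with a differential calculus. 1. The map $\widetilde\beta:\Omega(P)\otimes_{\Omega(B)}\Omega(P)\to\Omega(P)\otimes\Gamma^\wedge$, $\widetilde\beta(w_1\otimes w_2)=(w_1\otimes1)\Delta_\Omega(w_2)$,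 is bijective; let $\mathrm{qtrs}(\vartheta)=\widetilde\beta^{-1}(1\otimes\vartheta)$ for $\vartheta\in\Gamma^\wedge$. 2. The set of all graded (degree-preserving) linear maps $f:\Gamma^\wedge\to\Omega(P)$ such that $f(1)=1$, $(f\otimes\mathrm{id})\circ\mathrm{Ad}=\Delta_\Omega\circ f$, and $f*f'=f'*f=1\epsilon$ for some graded linear map $f':\Gamma^\wedge\to\Omega(P)$, is a group under the convolution product $f*g=m\circ(f\otimes g)\circ\Delta$ ($m$ the product of $\Omega(P)$), with unit $1\epsilon:\vartheta\mapsto\epsilon(\vartheta)1$. 3. The set of all bijective graded (degree-preserving) left $\Omega(B)$-module maps $F:\Omega(P)\to\Omega(P)$ such that $F(1)=1$ and $(F\otimes\mathrm{id})\circ\Delta_\Omega=\Delta_\Omega\circ F$ is a group under the product $(F_1\cdot F_2)(w)=F_2(F_1(w))$. 4. The maps $$F\mapsto m\circ(\mathrm{id}\otimes_{\Omega(B)}F)\circ\mathrm{qtrs},\qquad f\mapsto m\circ(\mathrm{id}\otimes f)\circ\Delta_\Omega$$ are well defined between these two groups, mutually inverse, and group isomorphisms. -/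

import Mathlib

open scoped TensorProduct DirectSum
open MulOpposite

noncomputable section

namespace QuantumBundle

/-! ### Graded differential algebras -/

section Graded

variable {A B : Type*} [Ring A] [Algebra ℂ A] [Ring B] [Algebra ℂ B]

/-- The parity operator `a ↦ (-1)^k a` for `a` of degree `k`. -/
def parity (𝒜 : ℕ → Submodule ℂ A) [GradedAlgebra 𝒜] : A →ₗ[ℂ] A :=
  DirectSum.toModule ℂ ℕ A (fun n => ((-1 : ℂ) ^ n) • (𝒜 n).subtype) ∘ₗ
    (DirectSum.decomposeLinearEquiv 𝒜).toLinearMap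

/-- `d` makes the graded algebra `A = ⨁ 𝒜 n` a graded differential algebra. -/
structure IsDifferential (𝒜 : ℕ → Submodule ℂ A) (d : A →ₗ[ℂ] A) : Prop where
  degree : ∀ n, ∀ a ∈ 𝒜 n, d a ∈ 𝒜 (n + 1)
  leibniz : ∀ n, ∀ a ∈ 𝒜 n, ∀ b, d (a * b) = d a * b + (-1 : ℂ) ^ n • (a * d b)
  sq_zero : ∀ a, d (d a) = 0

/-- `s` is the involution of a graded `*`-algebra commuting with the differential, with the
convention `(a b)^* = (-1)^{kl} b^* a^*` for `a`, `b` of degrees `k`, `l`. -/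
structure IsGradedStar (𝒜 : ℕ → Submodule ℂ A) (d : A →ₗ[ℂ] A)
    (s : A →ₛₗ[starRingEnd ℂ] A) : Prop where
  degree : ∀ n, ∀ a ∈ 𝒜 n, s a ∈ 𝒜 n
  invol : ∀ a, s (s a) = a
  mul : ∀ k l, ∀ a ∈ 𝒜 k, ∀ b ∈ 𝒜 l, s (a * b) = (-1 : ℂ) ^ (k * l) • (s b * s a)
  comm_d : ∀ a, s (d a) = d (s a)

variable (𝒜 : ℕ → Submodule ℂ A) (ℬ : ℕ → Submodule ℂ B) [GradedAlgebra 𝒜] [GradedAlgebra ℬ]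

/-- The differential `d (a ⊗ b) = d a ⊗ b + (-1)^{deg a} a ⊗ d b` of the tensor product. -/
def tensorD (dA : A →ₗ[ℂ] A) (dB : B →ₗ[ℂ] B) : 𝒜 ᵍ⊗[ℂ] ℬ →ₗ[ℂ] 𝒜 ᵍ⊗[ℂ] ℬ :=
  (GradedTensorProduct.of ℂ 𝒜 ℬ).toLinearMap ∘ₗ
    (TensorProduct.map dA LinearMap.id + TensorProduct.map (parity 𝒜) dB) ∘ₗ
      (GradedTensorProduct.of ℂ 𝒜 ℬ).symm.toLinearMap

/-- The elements of total degree `n` in the tensor product. -/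
def totalDegree (n : ℕ) : Submodule ℂ (𝒜 ᵍ⊗[ℂ] ℬ) :=
  Submodule.span ℂ {z | ∃ i j, i + j = n ∧ ∃ a ∈ 𝒜 i, ∃ b ∈ ℬ j, z = a ᵍ⊗ₜ[ℂ] b}

lemma parity_of_mem {n : ℕ} {a : A} (ha : a ∈ 𝒜 n) : parity 𝒜 a = (-1 : ℂ) ^ n • a := by
  lift a to 𝒜 n using ha
  simp [parity]

lemma parity_one : parity 𝒜 1 = 1 := by
  simpa using parity_of_mem 𝒜 (SetLike.GradedOne.one_mem (A := 𝒜))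

lemma parity_mul (a b : A) : parity 𝒜 (a * b) = parity 𝒜 a * parity 𝒜 b := by
  induction a using DirectSum.Decomposition.inductionOn 𝒜 with
  | zero => simp
  | add x y hx hy => simp only [add_mul, map_add, hx, hy]
  | homogeneous x =>
    induction b using DirectSum.Decomposition.inductionOn 𝒜 with
    | zero => simp
    | add x y hx hy => simp only [mul_add, map_add, hx, hy]
    | homogeneous y =>
      rw [parity_of_mem 𝒜 x.2, parity_of_mem 𝒜 y.2,
        parity_of_mem 𝒜 (SetLike.mul_mem_graded x.2 y.2), pow_add, smul_mul_smul_comm]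

lemma parity_parity (a : A) : parity 𝒜 (parity 𝒜 a) = a := by
  induction a using DirectSum.Decomposition.inductionOn 𝒜 with
  | zero => simp
  | add x y hx hy => simp only [map_add, hx, hy]
  | homogeneous x =>
    rw [parity_of_mem 𝒜 x.2, map_smul, parity_of_mem 𝒜 x.2, smul_smul, ← mul_pow]
    simp

@[simp] lemma tensorD_tmul (dA : A →ₗ[ℂ] A) (dB : B →ₗ[ℂ] B) (a : A) (b : B) :
    tensorD 𝒜 ℬ dA dB (a ᵍ⊗ₜ[ℂ] b) = dA a ᵍ⊗ₜ[ℂ] b + parity 𝒜 a ᵍ⊗ₜ[ℂ] dB b := by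
  simp [tensorD]

lemma gadd_tmul (a a' : A) (b : B) :
    ((a + a') ᵍ⊗ₜ[ℂ] b : 𝒜 ᵍ⊗[ℂ] ℬ) = a ᵍ⊗ₜ[ℂ] b + a' ᵍ⊗ₜ[ℂ] b := by
  simp [GradedTensorProduct.tmul, TensorProduct.add_tmul]

lemma gtmul_add (a : A) (b b' : B) :
    (a ᵍ⊗ₜ[ℂ] (b + b') : 𝒜 ᵍ⊗[ℂ] ℬ) = a ᵍ⊗ₜ[ℂ] b + a ᵍ⊗ₜ[ℂ] b' := by
  simp [GradedTensorProduct.tmul, TensorProduct.tmul_add]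

lemma gzero_tmul (b : B) : ((0 : A) ᵍ⊗ₜ[ℂ] b : 𝒜 ᵍ⊗[ℂ] ℬ) = 0 := by
  simp [GradedTensorProduct.tmul]

lemma gtmul_zero (a : A) : (a ᵍ⊗ₜ[ℂ] (0 : B) : 𝒜 ᵍ⊗[ℂ] ℬ) = 0 := by
  simp [GradedTensorProduct.tmul]

lemma gneg_tmul (a : A) (b : B) : ((-a) ᵍ⊗ₜ[ℂ] b : 𝒜 ᵍ⊗[ℂ] ℬ) = -(a ᵍ⊗ₜ[ℂ] b) := by
  simp [GradedTensorProduct.tmul, TensorProduct.neg_tmul]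

lemma tmul_mul_tmul_zero {b : B} (hb : b ∈ ℬ 0) (a u : A) (v : B) :
    (a ᵍ⊗ₜ[ℂ] b * u ᵍ⊗ₜ[ℂ] v : 𝒜 ᵍ⊗[ℂ] ℬ) = (a * u) ᵍ⊗ₜ[ℂ] (b * v) := by
  induction u using DirectSum.Decomposition.inductionOn 𝒜 with
  | zero => rw [gzero_tmul, mul_zero, mul_zero, gzero_tmul]
  | add x y hx hy => rw [gadd_tmul, mul_add, hx, hy, mul_add, gadd_tmul]
  | homogeneous x => exact GradedTensorProduct.tmul_zero_coe_mul_coe_tmul 𝒜 ℬ a ⟨b, hb⟩ x v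

lemma tmul_mul_tmul_one {b : B} (hb : b ∈ ℬ 1) (a u : A) (v : B) :
    (a ᵍ⊗ₜ[ℂ] b * u ᵍ⊗ₜ[ℂ] v : 𝒜 ᵍ⊗[ℂ] ℬ) = (a * parity 𝒜 u) ᵍ⊗ₜ[ℂ] (b * v) := by
  induction u using DirectSum.Decomposition.inductionOn 𝒜 with
  | zero => rw [gzero_tmul, mul_zero, map_zero, mul_zero, gzero_tmul]
  | add x y hx hy => rw [gadd_tmul, mul_add, hx, hy, map_add, mul_add, gadd_tmul]
  | @homogeneous i x =>
    refine (GradedTensorProduct.tmul_coe_mul_coe_tmul 𝒜 ℬ a ⟨b, hb⟩ x v).trans ?_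
    rw [parity_of_mem 𝒜 x.2, mul_smul_comm]
    rcases Nat.even_or_odd i with h | h <;> simp [h.neg_one_pow, gneg_tmul]

end Graded

/-! ### Quantum groups -/

section Group

variable (H : Type*) [Ring H] [HopfAlgebra ℂ H] [StarRing H] [StarModule ℂ H]

/-- `u` is (the matrix of) a finite-dimensional unitary corepresentation of `H`. -/
structure IsUnitaryCorep {n : ℕ} (u : Matrix (Fin n) (Fin n) H) : Prop where
  comul : ∀ i j, Coalgebra.comul (R := ℂ) (u i j) = ∑ k, u i k ⊗ₜ[ℂ] u k j
  counit : ∀ i j, Coalgebra.counit (R := ℂ) (u i j) = if i = j then 1 else 0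
  mul_conjTranspose : u * u.conjTranspose = 1
  conjTranspose_mul : u.conjTranspose * u = 1

/-- `H` is the (dense) Hopf `*`-algebra of polynomial functions on a compact quantum group: the
coproduct is a `*`-map and `H` is spanned by the matrix coefficients of its finite-dimensional
unitary corepresentations. -/
structure IsQuantumGroup : Prop where
  comul_star : ∀ h : H, Coalgebra.comul (R := ℂ) (star h) = star (Coalgebra.comul (R := ℂ) h)
  span_coeff : Submodule.span ℂ
    {h : H | ∃ (n : ℕ) (u : Matrix (Fin n) (Fin n) H) (i j : Fin n),
      IsUnitaryCorep H u ∧ h = u i j} = ⊤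

end Group

/-! ### First order differential calculi and their universal differential envelopes -/

/-- A first order differential calculus `(Γ, d)` over an algebra `H`; the right action of `H` on
`Γ` is the action of `Hᵐᵒᵖ`. -/
structure FODC (H Γ : Type*) [Ring H] [Algebra ℂ H] [AddCommGroup Γ] [Module ℂ Γ]
    [Module H Γ] [Module Hᵐᵒᵖ Γ] [SMulCommClass H Hᵐᵒᵖ Γ]
    [IsScalarTower ℂ H Γ] [IsScalarTower ℂ Hᵐᵒᵖ Γ] where
  d : H →ₗ[ℂ] Γ
  leibniz : ∀ g h, d (g * h) = g • d h + op h • d g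
  span_eq_top : Submodule.span ℂ (Set.range fun p : H × H => p.1 • d p.2) = ⊤

namespace FODC

section Basic

variable {H Γ : Type*} [Ring H] [Algebra ℂ H] [AddCommGroup Γ] [Module ℂ Γ]
    [Module H Γ] [Module Hᵐᵒᵖ Γ] [SMulCommClass H Hᵐᵒᵖ Γ]
    [IsScalarTower ℂ H Γ] [IsScalarTower ℂ Hᵐᵒᵖ Γ]

instance smulCommOp : SMulCommClass ℂ Hᵐᵒᵖ Γ where
  smul_comm c h γ := by
    rw [← algebraMap_smul Hᵐᵒᵖ c (h • γ), ← algebraMap_smul Hᵐᵒᵖ c γ, smul_smul, smul_smul,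
      Algebra.commutes]

instance smulCommLeft : SMulCommClass ℂ H Γ where
  smul_comm c h γ := by
    rw [← algebraMap_smul H c (h • γ), ← algebraMap_smul H c γ, smul_smul, smul_smul,
      Algebra.commutes]

variable (X : FODC H Γ)

/-- `g ⊗ h ↦ g dh`. -/
def gdh : H ⊗[ℂ] H →ₗ[ℂ] Γ :=
  TensorProduct.lift (LinearMap.mk₂ ℂ (fun g h => g • X.d h)
    (fun _ _ _ => add_smul _ _ _) (fun _ _ _ => smul_assoc _ _ _)
    (fun _ _ _ => by rw [map_add, smul_add]) (fun c g h => by rw [map_smul, smul_comm]))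

/-- `g ⊗ h ↦ (dh) g`. -/
def dhg : H ⊗[ℂ] H →ₗ[ℂ] Γ :=
  TensorProduct.lift (LinearMap.mk₂ ℂ (fun g h => op g • X.d h)
    (fun _ _ _ => by rw [op_add, add_smul]) (fun _ _ _ => by rw [op_smul, smul_assoc])
    (fun _ _ _ => by rw [map_add, smul_add]) (fun c g h => by rw [map_smul, smul_comm]))

@[simp] lemma gdh_tmul (g h : H) : X.gdh (g ⊗ₜ h) = g • X.d h := rfl
@[simp] lemma dhg_tmul (g h : H) : X.dhg (g ⊗ₜ h) = op g • X.d h := rfl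

lemma gdh_surjective : Function.Surjective X.gdh := by
  rw [← LinearMap.range_eq_top, eq_top_iff, ← X.span_eq_top, Submodule.span_le]
  rintro _ ⟨p, rfl⟩
  exact ⟨p.1 ⊗ₜ p.2, rfl⟩

lemma d_one : X.d 1 = 0 := by
  have := X.leibniz 1 1
  simpa using this

/-- The relations defining `Γ^∧` as a quotient of the free algebra on `H ⊕ Γ`: those of the tensor
algebra `⨁ₖ Γ ⊗_H ⋯ ⊗_H Γ` of the bimodule `Γ` over `H`, together with
`∑ dgᵢ dhᵢ = 0` whenever `∑ gᵢ dhᵢ = 0`. -/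
inductive Rel : TensorAlgebra ℂ (H × Γ) → TensorAlgebra ℂ (H × Γ) → Prop
  | one : Rel (TensorAlgebra.ι ℂ (1, 0)) 1
  | mul (g h : H) : Rel (TensorAlgebra.ι ℂ (g, 0) * TensorAlgebra.ι ℂ (h, 0))
      (TensorAlgebra.ι ℂ (g * h, 0))
  | left (g : H) (γ : Γ) : Rel (TensorAlgebra.ι ℂ (g, 0) * TensorAlgebra.ι ℂ (0, γ))
      (TensorAlgebra.ι ℂ (0, g • γ))
  | right (g : H) (γ : Γ) : Rel (TensorAlgebra.ι ℂ (0, γ) * TensorAlgebra.ι ℂ (g, 0))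
      (TensorAlgebra.ι ℂ (0, op g • γ))
  | env (t : H ⊗[ℂ] H) (ht : X.gdh t = 0) :
      Rel (LinearMap.mul' ℂ _ (TensorProduct.map
        (TensorAlgebra.ι ℂ ∘ₗ LinearMap.inr ℂ H Γ ∘ₗ X.d)
        (TensorAlgebra.ι ℂ ∘ₗ LinearMap.inr ℂ H Γ ∘ₗ X.d) t)) 0

/-- The universal differential envelope `Γ^∧`. -/
def Env : Type _ := RingQuot X.Rel

instance : Ring X.Env := inferInstanceAs (Ring (RingQuot X.Rel))
instance : Algebra ℂ X.Env := inferInstanceAs (Algebra ℂ (RingQuot X.Rel))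

/-- The canonical map from the free algebra onto `Γ^∧`. -/
def Env.mk : TensorAlgebra ℂ (H × Γ) →ₐ[ℂ] X.Env := RingQuot.mkAlgHom ℂ X.Rel

lemma Env.mk_rel {x y : TensorAlgebra ℂ (H × Γ)} (h : X.Rel x y) : Env.mk X x = Env.mk X y :=
  RingQuot.mkAlgHom_rel ℂ h

lemma Env.mk_surjective : Function.Surjective (Env.mk X) := RingQuot.mkAlgHom_surjective ℂ X.Rel

/-- The inclusion `H → Γ^∧` in degree zero. -/
def ιH : H →ₐ[ℂ] X.Env :=
  AlgHom.ofLinearMap ((Env.mk X).toLinearMap ∘ₗ TensorAlgebra.ι ℂ ∘ₗ LinearMap.inl ℂ H Γ)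
    (by simpa using Env.mk_rel X Rel.one)
    (fun g h => by simpa using (Env.mk_rel X (Rel.mul g h)).symm)

/-- The inclusion `Γ → Γ^∧` in degree one. -/
def ιΓ : Γ →ₗ[ℂ] X.Env :=
  (Env.mk X).toLinearMap ∘ₗ TensorAlgebra.ι ℂ ∘ₗ LinearMap.inr ℂ H Γ

lemma ιH_mul_ιΓ (g : H) (γ : Γ) : X.ιH g * X.ιΓ γ = X.ιΓ (g • γ) := by
  simpa [ιH, ιΓ] using Env.mk_rel X (Rel.left g γ)

lemma ιΓ_mul_ιH (g : H) (γ : Γ) : X.ιΓ γ * X.ιH g = X.ιΓ (op g • γ) := by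
  simpa [ιH, ιΓ] using Env.mk_rel X (Rel.right g γ)

/-- `H → Γ^∧`, `h ↦ dh`. -/
def dH : H →ₗ[ℂ] X.Env := X.ιΓ ∘ₗ X.d

lemma dH_apply (h : H) : X.dH h = X.ιΓ (X.d h) := rfl

lemma dH_mul (g h : H) : X.dH (g * h) = X.ιH g * X.dH h + X.dH g * X.ιH h := by
  simp [dH, X.leibniz, ιH_mul_ιΓ, ιΓ_mul_ιH]

lemma env_rel (t : H ⊗[ℂ] H) (ht : X.gdh t = 0) :
    LinearMap.mul' ℂ X.Env (TensorProduct.map X.dH X.dH t) = 0 := by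
  rw [← map_zero (Env.mk X), ← Env.mk_rel X (Rel.env t ht)]
  clear ht
  induction t with
  | zero => simp
  | add x y hx hy => simp only [map_add, hx, hy]
  | tmul g h => simp [dH, ιΓ]

lemma ιΓ_gdh (t : H ⊗[ℂ] H) :
    X.ιΓ (X.gdh t) = LinearMap.mul' ℂ X.Env (TensorProduct.map X.ιH.toLinearMap X.dH t) := by
  induction t with
  | zero => simp
  | add x y hx hy => simp only [map_add, hx, hy]
  | tmul g h => simp [dH, ιH_mul_ιΓ]

/-- A linear map out of `Γ` is given by a linear map out of `H ⊗ H` vanishing on all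
`∑ gᵢ ⊗ hᵢ` with `∑ gᵢ dhᵢ = 0`. -/
def factor {M : Type*} [AddCommGroup M] [Module ℂ M] (L : H ⊗[ℂ] H →ₗ[ℂ] M)
    (hL : ∀ t, X.gdh t = 0 → L t = 0) : Γ →ₗ[ℂ] M :=
  (LinearMap.ker X.gdh).liftQ L hL ∘ₗ
    (X.gdh.quotKerEquivOfSurjective X.gdh_surjective).symm.toLinearMap

lemma factor_gdh {M : Type*} [AddCommGroup M] [Module ℂ M] (L : H ⊗[ℂ] H →ₗ[ℂ] M)
    (hL : ∀ t, X.gdh t = 0 → L t = 0) (t : H ⊗[ℂ] H) : X.factor L hL (X.gdh t) = L t := by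
  have : (X.gdh.quotKerEquivOfSurjective X.gdh_surjective).symm (X.gdh t) =
      Submodule.Quotient.mk t := by
    rw [LinearEquiv.symm_apply_eq]; rfl
  simp only [factor, LinearMap.comp_apply, LinearEquiv.coe_coe, this]
  rfl

lemma gdh_smul_left (g : H) (t : H ⊗[ℂ] H) :
    X.gdh ((g ⊗ₜ 1) * t) = g • X.gdh t := by
  induction t with
  | zero => simp
  | add x y hx hy => simp only [mul_add, map_add, hx, hy, smul_add]
  | tmul a b => simp [mul_smul]

section Lift

variable {T : Type*} [Ring T] [Algebra ℂ T]

/-- The algebra map `φ` on `H` together with the `φ`-derivation `δ` respects the relations of `Γ`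
and of `Γ^∧`. -/
structure Extends (φ : H →ₐ[ℂ] T) (δ : H →ₗ[ℂ] T) : Prop where
  leibniz : ∀ g h, δ (g * h) = φ g * δ h + δ g * φ h
  first : ∀ t, X.gdh t = 0 → (LinearMap.mul' ℂ T ∘ₗ TensorProduct.map φ.toLinearMap δ) t = 0
  second : ∀ t, X.gdh t = 0 → (LinearMap.mul' ℂ T ∘ₗ TensorProduct.map δ δ) t = 0

variable {X} {φ : H →ₐ[ℂ] T} {δ : H →ₗ[ℂ] T} (hE : X.Extends φ δ)

/-- The universal property of `Γ^∧`: such a pair extends to an algebra map with `dh ↦ δ h`. -/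
def Env.lift : X.Env →ₐ[ℂ] T :=
  RingQuot.liftAlgHom ℂ ⟨TensorAlgebra.lift ℂ (φ.toLinearMap.coprod (X.factor _ hE.first)), by
    have key : ∀ h, X.factor _ hE.first (X.d h) = δ h := fun h => by
      have := X.factor_gdh _ hE.first (1 ⊗ₜ h)
      simpa using this
    intro x y hxy
    induction hxy with
    | one => simp
    | mul g h => simp
    | left g γ =>
      obtain ⟨t, rfl⟩ := X.gdh_surjective γ
      simp only [map_mul, TensorAlgebra.lift_ι_apply, LinearMap.coprod_apply, map_zero, zero_add,
        add_zero, AlgHom.toLinearMap_apply, ← gdh_smul_left, factor_gdh]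
      induction t with
      | zero => simp
      | add x y hx hy => simp only [mul_add, map_add, hx, hy]
      | tmul a b => simp [mul_assoc]
    | right g γ =>
      obtain ⟨t, rfl⟩ := X.gdh_surjective γ
      induction t with
      | zero => simp [← Prod.zero_eq_mk]
      | add x y hx hy =>
        simp only [map_mul, TensorAlgebra.lift_ι_apply, LinearMap.coprod_apply, map_zero, zero_add,
          add_zero, AlgHom.toLinearMap_apply, map_add, smul_add, add_mul] at hx hy ⊢
        rw [hx, hy]
      | tmul a b =>
        have : op g • X.gdh (a ⊗ₜ b) = X.gdh (a ⊗ₜ (b * g) - (a * b) ⊗ₜ g) := by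
          simp [X.leibniz, mul_smul, smul_comm a (op g)]
        rw [this]
        simp only [map_mul, TensorAlgebra.lift_ι_apply, LinearMap.coprod_apply, map_zero, zero_add,
          add_zero, AlgHom.toLinearMap_apply, factor_gdh]
        simp [hE.leibniz, mul_add, mul_assoc]
    | env t ht =>
      rw [map_zero, ← hE.second t ht]
      clear ht
      induction t with
      | zero => simp
      | add x y hx hy => simp only [map_add, hx, hy]
      | tmul a b => simp [key]⟩

lemma Env.lift_ιH (h : H) : Env.lift hE (X.ιH h) = φ h := by
  simp only [Env.lift, ιH, Env.mk, AlgHom.ofLinearMap_apply, LinearMap.comp_apply]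
  erw [RingQuot.liftAlgHom_mkAlgHom_apply]
  simp

lemma Env.lift_ιΓ (t : H ⊗[ℂ] H) : Env.lift hE (X.ιΓ (X.gdh t)) =
    LinearMap.mul' ℂ T (TensorProduct.map φ.toLinearMap δ t) := by
  simp only [Env.lift, ιΓ, Env.mk, LinearMap.comp_apply]
  erw [RingQuot.liftAlgHom_mkAlgHom_apply]
  simp [factor_gdh]

lemma Env.lift_dH (h : H) : Env.lift hE (X.dH h) = δ h := by
  have := Env.lift_ιΓ hE (1 ⊗ₜ h)
  simpa [dH] using this

end Lift

lemma Env.algHom_ext {T : Type*} [Ring T] [Algebra ℂ T] {f g : X.Env →ₐ[ℂ] T}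
    (hH : ∀ h, f (X.ιH h) = g (X.ιH h)) (hd : ∀ h, f (X.dH h) = g (X.dH h)) : f = g := by
  refine RingQuot.ringQuot_ext' ℂ _ _ (TensorAlgebra.hom_ext (LinearMap.prod_ext ?_ ?_))
  · ext h
    exact hH h
  · ext γ
    obtain ⟨t, rfl⟩ := X.gdh_surjective γ
    change f (X.ιΓ (X.gdh t)) = g (X.ιΓ (X.gdh t))
    rw [ιΓ_gdh]
    induction t with
    | zero => simp
    | add x y hx hy => simp only [map_add, hx, hy]
    | tmul a b => simp [hH, hd]

/-! The grading of `Γ^∧`. -/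

/-- The degree `n` part `Γ^{∧ n}`, spanned by the products `h γ₁ ⋯ γₙ`. -/
def grading (n : ℕ) : Submodule ℂ X.Env :=
  LinearMap.range X.ιH.toLinearMap * LinearMap.range X.ιΓ ^ n

lemma ιH_mem (h : H) : X.ιH h ∈ X.grading 0 := by
  simp [grading]

lemma ιΓ_mem (γ : Γ) : X.ιΓ γ ∈ X.grading 1 := by
  rw [grading, pow_one, ← one_mul (X.ιΓ γ), ← map_one X.ιH]
  exact Submodule.mul_mem_mul ⟨1, rfl⟩ ⟨γ, rfl⟩

lemma range_ιΓ_pow_mul_range_ιH (n : ℕ) :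
    LinearMap.range X.ιΓ ^ n * LinearMap.range X.ιH.toLinearMap ≤ X.grading n := by
  induction n with
  | zero => simp [grading]
  | succ n ih =>
    have h1 : LinearMap.range X.ιΓ * LinearMap.range X.ιH.toLinearMap ≤ LinearMap.range X.ιΓ := by
      rw [Submodule.mul_le]
      rintro _ ⟨γ, rfl⟩ _ ⟨h, rfl⟩
      exact ⟨op h • γ, (X.ιΓ_mul_ιH h γ).symm⟩
    rw [pow_succ, mul_assoc, grading, pow_succ]
    refine (mul_le_mul_right h1 _).trans ?_
    intro x hx
    rw [← one_mul x, ← map_one X.ιH]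
    exact Submodule.mul_mem_mul ⟨1, rfl⟩ hx

instance : SetLike.GradedMonoid X.grading where
  one_mem := by rw [← map_one X.ιH]; exact X.ιH_mem 1
  mul_mem i j x y hx hy := by
    have h0 : LinearMap.range X.ιH.toLinearMap * LinearMap.range X.ιH.toLinearMap ≤
        LinearMap.range X.ιH.toLinearMap := by
      rw [Submodule.mul_le]
      rintro _ ⟨g, rfl⟩ _ ⟨h, rfl⟩
      exact ⟨g * h, map_mul X.ιH g h⟩
    have h1 : X.grading i * X.grading j ≤ X.grading (i + j) := by
      calc X.grading i * X.grading j
          = LinearMap.range X.ιH.toLinearMap * ((LinearMap.range X.ιΓ ^ i *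
              LinearMap.range X.ιH.toLinearMap) * LinearMap.range X.ιΓ ^ j) := by
            simp only [grading, mul_assoc]
        _ ≤ LinearMap.range X.ιH.toLinearMap * (X.grading i * LinearMap.range X.ιΓ ^ j) := by
            gcongr
            exact X.range_ιΓ_pow_mul_range_ιH i
        _ = (LinearMap.range X.ιH.toLinearMap * LinearMap.range X.ιH.toLinearMap) *
              LinearMap.range X.ιΓ ^ (i + j) := by
            simp only [grading, mul_assoc, pow_add]
        _ ≤ X.grading (i + j) := by
            rw [grading]
            gcongr
    exact h1 (Submodule.mul_mem_mul hx hy)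

lemma of_mul_of_eq {i j n : ℕ} (hn : i + j = n) (x : X.grading i) (y : X.grading j)
    (z : X.grading n) (hz : (x : X.Env) * y = z) :
    DirectSum.of (fun n => X.grading n) i x * DirectSum.of (fun n => X.grading n) j y =
      DirectSum.of (fun n => X.grading n) n z := by
  subst hn
  rw [DirectSum.of_mul_of]
  congr 1
  exact Subtype.ext hz

/-- Auxiliary: `H → ⨁ Γ^{∧ n}`. -/
def decompH : H →ₐ[ℂ] ⨁ n, X.grading n :=
  AlgHom.ofLinearMap (DirectSum.lof ℂ ℕ (fun n => X.grading n) 0 ∘ₗ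
        LinearMap.codRestrict (X.grading 0) X.ιH.toLinearMap X.ιH_mem)
      (congrArg (DirectSum.of (fun n => X.grading n) 0) (Subtype.ext (map_one X.ιH)))
      (fun g h => (X.of_mul_of_eq (zero_add 0) ⟨X.ιH g, X.ιH_mem g⟩ ⟨X.ιH h, X.ιH_mem h⟩
        ⟨X.ιH (g * h), X.ιH_mem _⟩ (map_mul X.ιH g h).symm).symm)

lemma decompH_apply (h : H) : X.decompH h =
    DirectSum.of (fun n => X.grading n) 0 ⟨X.ιH h, X.ιH_mem h⟩ := rfl

/-- Auxiliary: `Γ → ⨁ Γ^{∧ n}`. -/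
def decompΓ : Γ →ₗ[ℂ] ⨁ n, X.grading n :=
  DirectSum.lof ℂ ℕ (fun n => X.grading n) 1 ∘ₗ
    LinearMap.codRestrict (X.grading 1) X.ιΓ X.ιΓ_mem

lemma decompΓ_apply (γ : Γ) : X.decompΓ γ =
    DirectSum.of (fun n => X.grading n) 1 ⟨X.ιΓ γ, X.ιΓ_mem γ⟩ := rfl

lemma decompH_mul_decompΓ (h : H) (γ : Γ) :
    X.decompH h * X.decompΓ γ = X.decompΓ (h • γ) :=
  X.of_mul_of_eq (zero_add 1) _ _ _ (X.ιH_mul_ιΓ h γ)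

lemma decompΓ_mul_decompH (h : H) (γ : Γ) :
    X.decompΓ γ * X.decompH h = X.decompΓ (op h • γ) :=
  X.of_mul_of_eq (add_zero 1) _ _ _ (X.ιΓ_mul_ιH h γ)

/-- Auxiliary: `h ↦ dh` with values in `⨁ Γ^{∧ n}`. -/
def decompD : H →ₗ[ℂ] ⨁ n, X.grading n := X.decompΓ ∘ₗ X.d

lemma decompD_mul (g h : H) : X.decompD (g * h) =
    X.decompH g * X.decompD h + X.decompD g * X.decompH h := by
  simp only [decompD, LinearMap.comp_apply, X.leibniz, decompH_mul_decompΓ, decompΓ_mul_decompH,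
    map_add]

lemma decompH_mul_decompD (t : H ⊗[ℂ] H) : (LinearMap.mul' ℂ (⨁ n, X.grading n) ∘ₗ
    TensorProduct.map X.decompH.toLinearMap X.decompD) t = X.decompΓ (X.gdh t) := by
  induction t with
  | zero => simp
  | add x y hx hy => simp only [map_add, hx, hy]
  | tmul a b =>
    rw [gdh_tmul, ← decompH_mul_decompΓ]
    rfl

lemma mul_dH_mem (t : H ⊗[ℂ] H) :
    LinearMap.mul' ℂ X.Env (TensorProduct.map X.dH X.dH t) ∈ X.grading 2 := by
  induction t with
  | zero => rw [map_zero, map_zero]; exact zero_mem _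
  | add x y hx hy => rw [map_add, map_add]; exact add_mem hx hy
  | tmul a b =>
    rw [← one_add_one_eq_two]
    exact SetLike.mul_mem_graded (X.ιΓ_mem _) (X.ιΓ_mem _)

lemma decompD_mul_decompD (t : H ⊗[ℂ] H) :
    (LinearMap.mul' ℂ (⨁ n, X.grading n) ∘ₗ TensorProduct.map X.decompD X.decompD) t =
      DirectSum.of (fun n => X.grading n) 2
        ⟨LinearMap.mul' ℂ X.Env (TensorProduct.map X.dH X.dH t), X.mul_dH_mem t⟩ := by
  induction t with
  | zero =>
    simp only [map_zero]
    exact (map_zero (DirectSum.of (fun n => X.grading n) 2)).symm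
  | add x y hx hy =>
    simp only [map_add, hx, hy]
    rw [← map_add]
    rfl
  | tmul a b => exact X.of_mul_of_eq one_add_one_eq_two _ _ _ rfl

lemma decomp_extends : FODC.Extends (T := ⨁ n, X.grading n) X X.decompH X.decompD where
  leibniz := X.decompD_mul
  first t ht := by rw [decompH_mul_decompD, ht, map_zero]
  second t ht := by
    rw [decompD_mul_decompD]
    simp only [X.env_rel t ht]
    exact map_zero (DirectSum.of (fun n => X.grading n) 2)

/-- Auxiliary: the decomposition of elements of `Γ^∧` into homogeneous parts. -/
def decomp : X.Env →ₐ[ℂ] ⨁ n, X.grading n := Env.lift X.decomp_extends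

lemma decomp_ιH (h : H) : X.decomp (X.ιH h) =
    DirectSum.of (fun n => X.grading n) 0 ⟨X.ιH h, X.ιH_mem h⟩ :=
  Env.lift_ιH X.decomp_extends h

lemma decomp_ιΓ (γ : Γ) : X.decomp (X.ιΓ γ) =
    DirectSum.of (fun n => X.grading n) 1 ⟨X.ιΓ γ, X.ιΓ_mem γ⟩ := by
  obtain ⟨t, rfl⟩ := X.gdh_surjective γ
  exact (Env.lift_ιΓ X.decomp_extends t).trans (X.decompH_mul_decompD t)

instance : GradedAlgebra X.grading :=
  GradedAlgebra.ofAlgHom _ X.decomp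
    (by
      apply Env.algHom_ext
      · intro h
        simp [decomp_ιH]
      · intro h
        simp [decomp_ιΓ, dH])
    (by
      rintro n ⟨x, hx⟩
      induction n generalizing x with
      | zero =>
        have hx0 := hx
        rw [grading, pow_zero, mul_one] at hx0
        obtain ⟨h, rfl⟩ := hx0
        exact X.decomp_ιH h
      | succ n ih =>
        have hx' : x ∈ X.grading n * LinearMap.range X.ιΓ := by
          rwa [grading, pow_succ, ← mul_assoc] at hx
        induction hx' using Submodule.mul_induction_on' with
        | mem_mul_mem a ha b hb =>
          obtain ⟨γ, rfl⟩ := hb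
          rw [map_mul, decomp_ιΓ]
          have := ih a ha
          simp only at this
          rw [this]
          exact X.of_mul_of_eq rfl _ _ _ rfl
        | add a ha b hb iha ihb =>
          have ha' : a ∈ X.grading (n + 1) := by rwa [grading, pow_succ, ← mul_assoc]
          have hb' : b ∈ X.grading (n + 1) := by rwa [grading, pow_succ, ← mul_assoc]
          have h1 := iha ha'
          have h2 := ihb hb'
          simp only at h1 h2 ⊢
          rw [map_add, h1, h2, ← map_add]
          rfl)

/-! The differential of `Γ^∧`. -/

lemma Env.induction {p : X.Env → Prop} (hH : ∀ h, p (X.ιH h)) (hd : ∀ h, p (X.dH h))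
    (hadd : ∀ x y, p x → p y → p (x + y)) (hmul : ∀ x y, p x → p y → p (x * y)) (x : X.Env) :
    p x := by
  have hΓ : ∀ γ, p (X.ιΓ γ) := fun γ => by
    obtain ⟨t, rfl⟩ := X.gdh_surjective γ
    rw [ιΓ_gdh]
    induction t with
    | zero => simpa using hH 0
    | add x y hx hy => simpa using hadd _ _ hx hy
    | tmul a b => simpa using hmul _ _ (hH a) (hd b)
  obtain ⟨x, rfl⟩ := Env.mk_surjective X x
  induction x using TensorAlgebra.induction with
  | algebraMap r =>
    rw [AlgHom.commutes, ← AlgHom.commutes X.ιH]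
    exact hH _
  | ι m =>
    have : TensorAlgebra.ι ℂ m = TensorAlgebra.ι ℂ (m.1, 0) + TensorAlgebra.ι ℂ (0, m.2) := by
      rw [← map_add]; simp
    rw [this, map_add]
    exact hadd _ _ (hH m.1) (hΓ m.2)
  | mul a b ha hb => rw [map_mul]; exact hmul _ _ ha hb
  | add a b ha hb => rw [map_add]; exact hadd _ _ ha hb

lemma dH_mem (h : H) : X.dH h ∈ X.grading 1 := X.ιΓ_mem _

lemma parity_ιH (h : H) : parity X.grading (X.ιH h) = X.ιH h := by
  simpa using parity_of_mem X.grading (X.ιH_mem h)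

lemma parity_dH (h : H) : parity X.grading (X.dH h) = -X.dH h := by
  simpa using parity_of_mem X.grading (X.dH_mem h)

lemma dH_one : X.dH 1 = 0 := by rw [dH_apply, d_one, map_zero]

/-- Auxiliary: `g ↦ (g, dg; 0, g)`. -/
def matH : H →ₐ[ℂ] Matrix (Fin 2) (Fin 2) X.Env :=
  AlgHom.ofLinearMap
    { toFun := fun g => !![X.ιH g, X.dH g; 0, X.ιH g]
      map_add' := fun g h => by ext i j; fin_cases i <;> fin_cases j <;> simp
      map_smul' := fun c g => by ext i j; fin_cases i <;> fin_cases j <;> simp }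
    (by ext i j; fin_cases i <;> fin_cases j <;> simp [dH_one])
    (fun g h => by
      ext i j
      fin_cases i <;> fin_cases j <;> simp [dH_mul])

/-- Auxiliary: `g ↦ (-dg, 0; 0, dg)`. -/
def matD : H →ₗ[ℂ] Matrix (Fin 2) (Fin 2) X.Env where
  toFun := fun g => !![-X.dH g, 0; 0, X.dH g]
  map_add' := fun g h => by ext i j; fin_cases i <;> fin_cases j <;> simp [add_comm]
  map_smul' := fun c g => by ext i j; fin_cases i <;> fin_cases j <;> simp

lemma matH_apply (g : H) : X.matH g = !![X.ιH g, X.dH g; 0, X.ιH g] := rfl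
lemma matD_apply (g : H) : X.matD g = !![-X.dH g, 0; 0, X.dH g] := rfl

lemma mat_extends : X.Extends X.matH X.matD where
  leibniz g h := by
    ext i j
    fin_cases i <;> fin_cases j <;>
      simp [matH_apply, matD_apply, Matrix.mul_apply, dH_mul, add_comm]
  first t ht := by
    have key : ∀ t, (LinearMap.mul' ℂ _ ∘ₗ TensorProduct.map X.matH.toLinearMap X.matD) t =
        !![-X.ιΓ (X.gdh t), LinearMap.mul' ℂ X.Env (TensorProduct.map X.dH X.dH t);
          0, X.ιΓ (X.gdh t)] := fun t => by
      induction t with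
      | zero => ext i j; fin_cases i <;> fin_cases j <;> simp
      | add x y hx hy =>
        rw [map_add, hx, hy]
        ext i j; fin_cases i <;> fin_cases j <;> simp [add_comm]
      | tmul a b =>
        ext i j
        fin_cases i <;> fin_cases j <;>
          simp [matH_apply, matD_apply, Matrix.mul_apply, ← ιH_mul_ιΓ, dH_apply]
    rw [key, ht, X.env_rel t ht]
    ext i j; fin_cases i <;> fin_cases j <;> simp
  second t ht := by
    have key : ∀ t, (LinearMap.mul' ℂ _ ∘ₗ TensorProduct.map X.matD X.matD) t =
        !![LinearMap.mul' ℂ X.Env (TensorProduct.map X.dH X.dH t), 0;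
          0, LinearMap.mul' ℂ X.Env (TensorProduct.map X.dH X.dH t)] := fun t => by
      induction t with
      | zero => ext i j; fin_cases i <;> fin_cases j <;> simp
      | add x y hx hy =>
        rw [map_add, hx, hy]
        ext i j; fin_cases i <;> fin_cases j <;> simp
      | tmul a b =>
        ext i j
        fin_cases i <;> fin_cases j <;> simp [matD_apply]
    rw [key, X.env_rel t ht]
    ext i j; fin_cases i <;> fin_cases j <;> simp

/-- Auxiliary: `x ↦ ((-1)^{deg x} x, dx; 0, x)`. -/
def mat : X.Env →ₐ[ℂ] Matrix (Fin 2) (Fin 2) X.Env := Env.lift X.mat_extends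

/-- The differential of `Γ^∧`. -/
def dEnv : X.Env →ₗ[ℂ] X.Env := Matrix.entryLinearMap ℂ X.Env 0 1 ∘ₗ X.mat.toLinearMap

lemma mat_apply (x : X.Env) : X.mat x = !![parity X.grading x, X.dEnv x; 0, x] := by
  suffices h : X.mat x 0 0 = parity X.grading x ∧ X.mat x 1 0 = 0 ∧ X.mat x 1 1 = x by
    obtain ⟨h1, h2, h3⟩ := h
    ext i j
    fin_cases i <;> fin_cases j <;> simp [h1, h2, h3, dEnv]
  induction x using Env.induction with
  | hH h => simp [mat, Env.lift_ιH, matH_apply, parity_ιH]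
  | hd h => simp [mat, Env.lift_dH, matD_apply, parity_dH]
  | hadd x y hx hy => simp [hx, hy]
  | hmul x y hx hy => simp [Matrix.mul_apply, hx, hy, parity_mul]

lemma dEnv_ιH (h : H) : X.dEnv (X.ιH h) = X.dH h := by
  simp [dEnv, mat, Env.lift_ιH, matH_apply]

lemma dEnv_dH (h : H) : X.dEnv (X.dH h) = 0 := by
  simp [dEnv, mat, Env.lift_dH, matD_apply]

lemma dEnv_mul (x y : X.Env) :
    X.dEnv (x * y) = X.dEnv x * y + parity X.grading x * X.dEnv y := by
  have := congrArg (fun M => M 0 1) (map_mul X.mat x y)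
  rw [mat_apply, mat_apply, mat_apply] at this
  simpa [Matrix.mul_apply, add_comm] using this

end Basic

/-! The Hopf structure of `Γ^∧`. -/

section Hopf

variable {H Γ : Type*} [Ring H] [HopfAlgebra ℂ H] [AddCommGroup Γ] [Module ℂ Γ]
    [Module H Γ] [Module Hᵐᵒᵖ Γ] [SMulCommClass H Hᵐᵒᵖ Γ]
    [IsScalarTower ℂ H Γ] [IsScalarTower ℂ Hᵐᵒᵖ Γ] (X : FODC H Γ)

/-- `g ⊗ h ↦ Δ(g) Δ(h)` with the factors not yet multiplied:
`g₁ ⊗ h₁ ⊗ g₂ ⊗ h₂`. -/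
def comul₂ : H ⊗[ℂ] H →ₗ[ℂ] (H ⊗[ℂ] H) ⊗[ℂ] (H ⊗[ℂ] H) :=
  (TensorProduct.tensorTensorTensorComm ℂ H H H H).toLinearMap ∘ₗ
    TensorProduct.map Coalgebra.comul Coalgebra.comul

/-- `g ⊗ h ↦ Δ(g) (id ⊗ d) Δ(h)`. -/
def leftCov : H ⊗[ℂ] H →ₗ[ℂ] H ⊗[ℂ] Γ :=
  TensorProduct.map (LinearMap.mul' ℂ H) X.gdh ∘ₗ comul₂

/-- `g ⊗ h ↦ Δ(g) (d ⊗ id) Δ(h)`. -/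
def rightCov : H ⊗[ℂ] H →ₗ[ℂ] Γ ⊗[ℂ] H :=
  TensorProduct.map X.gdh (LinearMap.mul' ℂ H) ∘ₗ comul₂

/-- Bicovariance of a first order calculus: `∑ gᵢ dhᵢ = 0` implies
`∑ Δ(gᵢ) (id ⊗ d) Δ(hᵢ) = 0` and `∑ Δ(gᵢ) (d ⊗ id) Δ(hᵢ) = 0`, that is, the left and right
coactions of `H` on `Γ` are well defined. -/
structure IsBicovariant : Prop where
  left : ∀ t, X.gdh t = 0 → X.leftCov t = 0
  right : ∀ t, X.gdh t = 0 → X.rightCov t = 0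

/-- The inclusion of `H ⊗ H` into `Γ^∧ ⊗ Γ^∧`. -/
def ιHH : H ⊗[ℂ] H →ₐ[ℂ] X.grading ᵍ⊗[ℂ] X.grading :=
  AlgHom.ofLinearMap ((GradedTensorProduct.of ℂ X.grading X.grading).toLinearMap ∘ₗ
      TensorProduct.map X.ιH.toLinearMap X.ιH.toLinearMap)
    (by simp [Algebra.TensorProduct.one_def]; rfl)
    (fun p q => by
      induction p with
      | zero => simp
      | add x y hx hy => simp only [add_mul, map_add, hx, hy]
      | tmul a b =>
        induction q with
        | zero => simp
        | add x y hx hy => simp only [mul_add, map_add, hx, hy]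
        | tmul c e => simp [tmul_mul_tmul_zero X.grading X.grading (X.ιH_mem b)])

@[simp] lemma ιHH_tmul (a b : H) : X.ιHH (a ⊗ₜ b) = X.ιH a ᵍ⊗ₜ[ℂ] X.ιH b := rfl

/-- The differential of `Γ^∧ ⊗ Γ^∧`. -/
abbrev dEE : X.grading ᵍ⊗[ℂ] X.grading →ₗ[ℂ] X.grading ᵍ⊗[ℂ] X.grading :=
  tensorD X.grading X.grading X.dEnv X.dEnv

lemma dEE_ιHH (a b : H) :
    X.dEE (X.ιHH (a ⊗ₜ b)) = X.dH a ᵍ⊗ₜ[ℂ] X.ιH b + X.ιH a ᵍ⊗ₜ[ℂ] X.dH b := by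
  simp [dEnv_ιH, parity_ιH]

lemma dEE_dEE_ιHH (p : H ⊗[ℂ] H) : X.dEE (X.dEE (X.ιHH p)) = 0 := by
  induction p with
  | zero => simp
  | add x y hx hy => simp only [map_add, hx, hy, add_zero]
  | tmul a b =>
    rw [dEE_ιHH, map_add]
    simp [dEnv_ιH, dEnv_dH, parity_ιH, parity_dH, gneg_tmul, gzero_tmul, gtmul_zero]

lemma dEE_ιHH_mul (p : H ⊗[ℂ] H) (y : X.grading ᵍ⊗[ℂ] X.grading) :
    X.dEE (X.ιHH p * y) = X.dEE (X.ιHH p) * y + X.ιHH p * X.dEE y := by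
  induction p with
  | zero => simp
  | add x y hx hy => simp only [map_add, add_mul, hx, hy]; abel
  | tmul a b =>
    obtain ⟨y, rfl⟩ := (GradedTensorProduct.of ℂ X.grading X.grading).surjective y
    induction y with
    | zero => simp
    | add x y hx hy => simp only [map_add, mul_add, hx, hy]; abel
    | tmul u v =>
      rw [dEE_ιHH, tensorD_tmul, ιHH_tmul, add_mul, mul_add,
        tmul_mul_tmul_zero _ _ (X.ιH_mem b), tmul_mul_tmul_zero _ _ (X.ιH_mem b),
        tmul_mul_tmul_zero _ _ (X.ιH_mem b), tmul_mul_tmul_zero _ _ (X.ιH_mem b),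
        tmul_mul_tmul_one _ _ (X.dH_mem b), tensorD_tmul, dEnv_mul, dEnv_mul, parity_mul,
        dEnv_ιH, dEnv_ιH, parity_ιH, parity_ιH]
      simp only [gadd_tmul, gtmul_add]
      abel

/-- Auxiliary: the coproduct of `H` with values in `Γ^∧ ⊗ Γ^∧`. -/
def comulH : H →ₐ[ℂ] X.grading ᵍ⊗[ℂ] X.grading :=
  X.ιHH.comp (Bialgebra.comulAlgHom ℂ H)

lemma comulH_apply (h : H) : X.comulH h = X.ιHH (Coalgebra.comul h) := rfl

lemma ιHH_mul_dEE (p q : H ⊗[ℂ] H) : X.ιHH p * X.dEE (X.ιHH q) =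
    GradedTensorProduct.of ℂ X.grading X.grading
      (TensorProduct.map X.ιH.toLinearMap X.ιΓ (TensorProduct.map (LinearMap.mul' ℂ H) X.gdh
        (TensorProduct.tensorTensorTensorComm ℂ H H H H (p ⊗ₜ q))) +
      TensorProduct.map X.ιΓ X.ιH.toLinearMap (TensorProduct.map X.gdh (LinearMap.mul' ℂ H)
        (TensorProduct.tensorTensorTensorComm ℂ H H H H (p ⊗ₜ q)))) := by
  induction p with
  | zero => simp
  | add x y hx hy =>
    simp only [add_mul, map_add, hx, hy, TensorProduct.add_tmul]; abel
  | tmul a b =>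
    induction q with
    | zero => simp
    | add x y hx hy =>
      simp only [mul_add, map_add, hx, hy, TensorProduct.tmul_add]; abel
    | tmul c e =>
      rw [dEE_ιHH, ιHH_tmul, mul_add, tmul_mul_tmul_zero _ _ (X.ιH_mem b),
        tmul_mul_tmul_zero _ _ (X.ιH_mem b)]
      simp [dH_apply, ιH_mul_ιΓ, add_comm]

variable {X} in
lemma comul_extends (hX : X.IsBicovariant) :
    X.Extends X.comulH (X.dEE ∘ₗ X.comulH.toLinearMap) := by
  have first : ∀ t, X.gdh t = 0 → (LinearMap.mul' ℂ (X.grading ᵍ⊗[ℂ] X.grading) ∘ₗ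
      TensorProduct.map X.comulH.toLinearMap (X.dEE ∘ₗ X.comulH.toLinearMap)) t = 0 := by
    intro t ht
    have key : (LinearMap.mul' ℂ (X.grading ᵍ⊗[ℂ] X.grading) ∘ₗ
      TensorProduct.map X.comulH.toLinearMap (X.dEE ∘ₗ X.comulH.toLinearMap)) t =
      GradedTensorProduct.of ℂ X.grading X.grading
        (TensorProduct.map X.ιH.toLinearMap X.ιΓ (X.leftCov t) +
          TensorProduct.map X.ιΓ X.ιH.toLinearMap (X.rightCov t)) := by
      clear ht
      induction t with
      | zero => simp
      | add x y hx hy => simp only [map_add, hx, hy]; abel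
      | tmul g h => exact X.ιHH_mul_dEE (Coalgebra.comul g) (Coalgebra.comul h)
    rw [key, hX.left t ht, hX.right t ht]
    simp
  refine ⟨fun g h => ?_, first, fun t ht => ?_⟩
  · simp only [LinearMap.comp_apply, AlgHom.toLinearMap_apply, map_mul]
    rw [comulH_apply, dEE_ιHH_mul, add_comm]
  · have key : (LinearMap.mul' ℂ (X.grading ᵍ⊗[ℂ] X.grading) ∘ₗ
      TensorProduct.map (X.dEE ∘ₗ X.comulH.toLinearMap) (X.dEE ∘ₗ X.comulH.toLinearMap)) t =
      X.dEE ((LinearMap.mul' ℂ (X.grading ᵍ⊗[ℂ] X.grading) ∘ₗ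
      TensorProduct.map X.comulH.toLinearMap (X.dEE ∘ₗ X.comulH.toLinearMap)) t) := by
      clear ht
      induction t with
      | zero => simp
      | add x y hx hy => simp only [map_add, hx, hy]
      | tmul g h =>
        simp only [LinearMap.comp_apply, TensorProduct.map_tmul, LinearMap.mul'_apply,
          AlgHom.toLinearMap_apply, comulH_apply]
        rw [dEE_ιHH_mul, dEE_dEE_ιHH, mul_zero, add_zero]
    rw [key, first t ht, map_zero]

variable {X} in
/-- The coproduct of `Γ^∧`: the extension of the coproduct of `H` to a morphism of graded
differential algebras `Γ^∧ → Γ^∧ ⊗ Γ^∧`. -/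
def comul (hX : X.IsBicovariant) : X.Env →ₐ[ℂ] X.grading ᵍ⊗[ℂ] X.grading :=
  Env.lift (comul_extends hX)

/-- The counit of `Γ^∧`: the counit of `H` in degree zero, and zero in positive degrees. -/
def counit : X.Env →ₐ[ℂ] ℂ :=
  Env.lift (φ := Bialgebra.counitAlgHom ℂ H) (δ := 0) (X := X)
    ⟨by simp, fun t _ => by simp, fun t _ => by simp⟩

/-- Auxiliary: `γ ⊗ y ↦ γ y`. -/
def rmul : Γ ⊗[ℂ] H →ₗ[ℂ] Γ :=
  TensorProduct.lift (LinearMap.mk₂ ℂ (fun γ y => op y • γ)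
    (fun _ _ _ => smul_add _ _ _) (fun c γ y => smul_comm _ _ _)
    (fun _ _ _ => by rw [op_add, add_smul]) (fun _ _ _ => by rw [op_smul, smul_assoc]))

/-- Auxiliary: `x ⊗ γ ↦ S(x) γ`. -/
def lmulS : H ⊗[ℂ] Γ →ₗ[ℂ] Γ :=
  TensorProduct.lift (LinearMap.mk₂ ℂ (fun x γ => HopfAlgebra.antipode ℂ x • γ)
    (fun _ _ _ => by rw [map_add, add_smul]) (fun _ _ _ => by rw [map_smul, smul_assoc])
    (fun _ _ _ => smul_add _ _ _) (fun c γ y => smul_comm _ _ _))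

@[simp] lemma rmul_tmul (γ : Γ) (y : H) : rmul (γ ⊗ₜ[ℂ] y) = op y • γ := rfl
@[simp] lemma lmulS_tmul (x : H) (γ : Γ) :
    lmulS (x ⊗ₜ[ℂ] γ) = HopfAlgebra.antipode ℂ x • γ := rfl

/-- Auxiliary: the germs map `π(h) = S(h₁) dh₂`. -/
def germ : H →ₗ[ℂ] Γ := lmulS ∘ₗ X.d.lTensor H ∘ₗ Coalgebra.comul

lemma germ_eq (h : H) :
    X.germ h = -rmul ((X.d ∘ₗ HopfAlgebra.antipode ℂ).rTensor H (Coalgebra.comul h)) := by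
  have key : ∀ p : H ⊗[ℂ] H, lmulS (X.d.lTensor H p) =
      X.d (LinearMap.mul' ℂ H ((HopfAlgebra.antipode ℂ).rTensor H p)) -
        rmul ((X.d ∘ₗ HopfAlgebra.antipode ℂ).rTensor H p) := fun p => by
    induction p with
    | zero => simp
    | add x y hx hy => simp only [map_add, hx, hy]; abel
    | tmul a b => simp [X.leibniz]
  rw [germ, LinearMap.comp_apply, LinearMap.comp_apply, key,
    HopfAlgebra.mul_antipode_rTensor_comul_apply, Algebra.algebraMap_eq_smul_one, map_smul, d_one]
  simp

lemma rmul_germ (h : H) :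
    rmul (TensorProduct.map X.germ (HopfAlgebra.antipode ℂ) (Coalgebra.comul (R := ℂ) h)) =
      -X.d (HopfAlgebra.antipode ℂ h) := by
  set T : H ⊗[ℂ] (H ⊗[ℂ] H) →ₗ[ℂ] Γ := rmul ∘ₗ TensorProduct.map
    (X.d ∘ₗ HopfAlgebra.antipode ℂ) (LinearMap.mul' ℂ H ∘ₗ (HopfAlgebra.antipode ℂ).lTensor H)
    with hT
  have h1 : ∀ p : H ⊗[ℂ] H, rmul (TensorProduct.map X.germ (HopfAlgebra.antipode ℂ) p) =
      -T (TensorProduct.assoc ℂ H H H ((Coalgebra.comul (R := ℂ)).rTensor H p)) := fun p => by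
    induction p with
    | zero => simp
    | add x y hx hy => simp only [map_add, hx, hy]; abel
    | tmul a b =>
      rw [TensorProduct.map_tmul, germ_eq, LinearMap.rTensor_tmul]
      generalize Coalgebra.comul (R := ℂ) a = q
      induction q with
      | zero => simp
      | add x y hx hy =>
        simp only [map_add, neg_add, TensorProduct.add_tmul] at hx hy ⊢
        rw [hx, hy]
      | tmul u v => simp [hT, mul_smul]
  have h2 : ∀ p : H ⊗[ℂ] H, T ((Coalgebra.comul (R := ℂ)).lTensor H p) =
      rmul (TensorProduct.map (X.d ∘ₗ HopfAlgebra.antipode ℂ) (Algebra.linearMap ℂ H)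
        ((Coalgebra.counit (R := ℂ)).lTensor H p)) := fun p => by
    induction p with
    | zero => simp
    | add x y hx hy => simp only [map_add, hx, hy]
    | tmul a b =>
      simp only [hT, LinearMap.lTensor_tmul, LinearMap.comp_apply, TensorProduct.map_tmul,
        HopfAlgebra.mul_antipode_lTensor_comul_apply, Algebra.linearMap_apply]
  rw [h1, Coalgebra.coassoc_apply, h2, Coalgebra.lTensor_counit_comul]
  simp

lemma lmulS_leftCov (g h : H) :
    lmulS (X.leftCov (g ⊗ₜ h)) = Coalgebra.counit (R := ℂ) g • X.germ h := by
  have key : ∀ p q : H ⊗[ℂ] H, lmulS (TensorProduct.map (LinearMap.mul' ℂ H) X.gdh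
      (TensorProduct.tensorTensorTensorComm ℂ H H H H (p ⊗ₜ q))) =
      lmulS ((LinearMap.lTensor H
        (Module.toModuleEnd ℂ (S := H) Γ
          (LinearMap.mul' ℂ H ((HopfAlgebra.antipode ℂ).rTensor H p)))) (X.d.lTensor H q)) :=
    fun p q => by
      induction p with
      | zero => simp only [map_zero, TensorProduct.zero_tmul, LinearMap.lTensor_zero,
          LinearMap.zero_apply]
      | add x y hx hy =>
        simp only [map_add, TensorProduct.add_tmul, hx, hy, LinearMap.lTensor_add,
          LinearMap.add_apply]
      | tmul a b =>
        induction q with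
        | zero => simp
        | add x y hx hy => simp only [map_add, TensorProduct.tmul_add, hx, hy]
        | tmul c e => simp [HopfAlgebra.antipode_mul_antidistrib, mul_smul]
  refine (key (Coalgebra.comul g) (Coalgebra.comul h)).trans ?_
  rw [HopfAlgebra.mul_antipode_rTensor_comul_apply, germ, LinearMap.comp_apply,
    LinearMap.comp_apply]
  generalize X.d.lTensor H (Coalgebra.comul (R := ℂ) h) = q
  induction q with
  | zero => simp
  | add x y hx hy => simp only [map_add, smul_add, hx, hy]
  | tmul a γ =>
    simp only [LinearMap.lTensor_tmul, Module.toModuleEnd_apply,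
      DistribSMul.toLinearMap_apply, lmulS_tmul, algebraMap_smul]
    exact smul_comm _ _ _

variable {X} in
lemma dhg_antipode (hX : X.IsBicovariant) (t : H ⊗[ℂ] H) (ht : X.gdh t = 0) :
    X.dhg (TensorProduct.map (HopfAlgebra.antipode ℂ) (HopfAlgebra.antipode ℂ) t) = 0 := by
  set P : Γ →ₗ[ℂ] Γ := lmulS ∘ₗ X.factor X.leftCov hX.left with hP
  have hPgdh : ∀ a b, P (a • X.d b) = Coalgebra.counit (R := ℂ) a • X.germ b := fun a b => by
    rw [← gdh_tmul, hP, LinearMap.comp_apply, factor_gdh, lmulS_leftCov]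
  have key : ∀ t, X.dhg (TensorProduct.map (HopfAlgebra.antipode ℂ) (HopfAlgebra.antipode ℂ) t) =
      -rmul (TensorProduct.map P (HopfAlgebra.antipode ℂ) (X.rightCov t)) := fun t => by
    induction t with
    | zero => simp
    | add x y hx hy => simp only [map_add, hx, hy]; abel
    | tmul g h =>
      have h1 : ∀ p q : H ⊗[ℂ] H, rmul (TensorProduct.map P (HopfAlgebra.antipode ℂ)
          (TensorProduct.map X.gdh (LinearMap.mul' ℂ H)
            (TensorProduct.tensorTensorTensorComm ℂ H H H H (p ⊗ₜ q)))) =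
          op (HopfAlgebra.antipode ℂ
            (TensorProduct.lid ℂ H ((Coalgebra.counit (R := ℂ)).rTensor H p))) •
            rmul (TensorProduct.map X.germ (HopfAlgebra.antipode ℂ) q) := fun p q => by
        induction p with
        | zero => simp
        | add x y hx hy =>
          simp only [map_add, TensorProduct.add_tmul, hx, hy, op_add, add_smul]
        | tmul a b =>
          induction q with
          | zero => simp
          | add x y hx hy => simp only [map_add, TensorProduct.tmul_add, hx, hy, smul_add]
          | tmul c e =>
            simp only [TensorProduct.tensorTensorTensorComm_tmul, TensorProduct.map_tmul,
              gdh_tmul, hPgdh, LinearMap.mul'_apply, rmul_tmul, LinearMap.rTensor_tmul,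
              TensorProduct.lid_tmul, HopfAlgebra.antipode_mul_antidistrib, op_mul, mul_smul,
              map_smul, op_smul, smul_assoc]
            rw [smul_comm (op (HopfAlgebra.antipode ℂ e)) (Coalgebra.counit (R := ℂ) a),
              smul_comm (op (HopfAlgebra.antipode ℂ b)) (Coalgebra.counit (R := ℂ) a)]
      have h2 := h1 (Coalgebra.comul g) (Coalgebra.comul h)
      rw [Coalgebra.rTensor_counit_comul, rmul_germ] at h2
      refine Eq.trans ?_ (congrArg Neg.neg h2.symm)
      simp
  rw [key, hX.right t ht]
  simp

/-- Auxiliary: right multiplication by `S(g)` on `Γ^∧`. -/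
def antiH : H →ₐ[ℂ] Module.End ℂ X.Env :=
  AlgHom.ofLinearMap ((LinearMap.mul ℂ X.Env).flip ∘ₗ X.ιH.toLinearMap ∘ₗ HopfAlgebra.antipode ℂ)
    (by ext x; simp [HopfAlgebra.antipode_one])
    (fun g h => by ext x; simp [HopfAlgebra.antipode_mul_antidistrib, mul_assoc])

/-- Auxiliary: right multiplication by `dS(g)` on `Γ^∧` composed with the parity operator. -/
def antiD : H →ₗ[ℂ] Module.End ℂ X.Env :=
  LinearMap.lcomp ℂ X.Env (parity X.grading) ∘ₗ (LinearMap.mul ℂ X.Env).flip ∘ₗ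
    X.dH ∘ₗ HopfAlgebra.antipode ℂ

lemma antiH_apply (g : H) (x : X.Env) :
    X.antiH g x = x * X.ιH (HopfAlgebra.antipode ℂ g) := rfl

lemma antiD_apply (g : H) (x : X.Env) :
    X.antiD g x = parity X.grading x * X.dH (HopfAlgebra.antipode ℂ g) := rfl

variable {X} in
lemma anti_extends (hX : X.IsBicovariant) : X.Extends X.antiH X.antiD where
  leibniz g h := by
    ext x
    simp [antiH_apply, antiD_apply, HopfAlgebra.antipode_mul_antidistrib, dH_mul, mul_add,
      mul_assoc, parity_mul, parity_ιH, add_comm]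
  first t ht := by
    have key : ∀ t x, (LinearMap.mul' ℂ _ ∘ₗ TensorProduct.map X.antiH.toLinearMap X.antiD) t x =
        parity X.grading x * X.ιΓ (X.dhg
          (TensorProduct.map (HopfAlgebra.antipode ℂ) (HopfAlgebra.antipode ℂ) t)) := fun t x => by
      induction t with
      | zero => simp
      | add y z hy hz => simp only [map_add, LinearMap.add_apply, hy, hz, mul_add]
      | tmul a b =>
        simp [antiH_apply, antiD_apply, ← ιΓ_mul_ιH, dH_apply, mul_assoc]
    ext x
    rw [key, dhg_antipode hX t ht]
    simp
  second t ht := by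
    have key : ∀ t x, (LinearMap.mul' ℂ _ ∘ₗ TensorProduct.map X.antiD X.antiD) t x =
        x * X.dEnv (X.ιΓ (X.dhg
          (TensorProduct.map (HopfAlgebra.antipode ℂ) (HopfAlgebra.antipode ℂ) t))) :=
        fun t x => by
      induction t with
      | zero => simp
      | add y z hy hz => simp only [map_add, LinearMap.add_apply, hy, hz, mul_add]
      | tmul a b =>
        simp [antiD_apply, ← ιΓ_mul_ιH, ← dH_apply, mul_assoc, parity_mul, parity_parity,
          parity_dH, dEnv_mul, dEnv_dH, dEnv_ιH]
    ext x
    rw [key, dhg_antipode hX t ht]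
    simp

variable {X} in
/-- The antipode of `Γ^∧`: the graded antimultiplicative extension of the antipode of `H` that
commutes with the differential. -/
def antipode (hX : X.IsBicovariant) : X.Env →ₗ[ℂ] X.Env :=
  LinearMap.applyₗ (1 : X.Env) ∘ₗ (Env.lift (anti_extends hX)).toLinearMap

variable {X} in
/-- The right adjoint coaction `Ad(t) = (-1)^{deg t₁ deg t₂} t₂ ⊗ S(t₁) t₃` of `Γ^∧`. -/
def Ad (hX : X.IsBicovariant) : X.Env →ₗ[ℂ] X.Env ⊗[ℂ] X.Env :=
  let Δ : X.Env →ₗ[ℂ] X.Env ⊗[ℂ] X.Env :=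
    (GradedTensorProduct.of ℂ X.grading X.grading).symm.toLinearMap ∘ₗ (comul hX).toLinearMap
  let swap : X.Env ⊗[ℂ] X.Env →ₗ[ℂ] X.Env ⊗[ℂ] X.Env :=
    (GradedTensorProduct.of ℂ X.grading X.grading).symm.toLinearMap ∘ₗ
      (GradedTensorProduct.comm X.grading X.grading).toLinearMap ∘ₗ
        (GradedTensorProduct.of ℂ X.grading X.grading).toLinearMap
  (LinearMap.mul' ℂ X.Env ∘ₗ (antipode hX).rTensor X.Env).lTensor X.Env ∘ₗ
    (TensorProduct.assoc ℂ X.Env X.Env X.Env).toLinearMap ∘ₗ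
      swap.rTensor X.Env ∘ₗ Δ.rTensor X.Env ∘ₗ Δ

end Hopf

end FODC

/-- A bicovariant first order `*`-differential calculus. -/
structure FODC.IsBicovariantStar {H Γ : Type*} [Ring H] [HopfAlgebra ℂ H] [StarRing H]
    [StarModule ℂ H] [AddCommGroup Γ] [Module ℂ Γ] [Module H Γ] [Module Hᵐᵒᵖ Γ]
    [SMulCommClass H Hᵐᵒᵖ Γ] [IsScalarTower ℂ H Γ] [IsScalarTower ℂ Hᵐᵒᵖ Γ]
    (X : FODC H Γ) : Prop extends X.IsBicovariant where
  /-- `∑ gᵢ dhᵢ ↦ ∑ d(hᵢ^*) gᵢ^*` is well defined. -/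
  star : ∀ t : H ⊗[ℂ] H, X.gdh t = 0 → X.dhg (Star.star t) = 0

/-! ### Quantum principal bundles and their differential calculi -/

section Bundle

variable (H P : Type*) [Ring H] [HopfAlgebra ℂ H] [StarRing H] [StarModule ℂ H]
    [Ring P] [Algebra ℂ P] [StarRing P] [StarModule ℂ P]

/-- A quantum principal bundle with total space `P`, structure quantum group `H`, coaction `coact`
and base space `base`. -/
structure QPBundle where
  coact : P →⋆ₐ[ℂ] P ⊗[ℂ] H
  coassoc : ∀ x, TensorProduct.assoc ℂ P H H (coact.toAlgHom.toLinearMap.rTensor H (coact x)) =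
    (Coalgebra.comul (R := ℂ)).lTensor P (coact x)
  counit : ∀ x, TensorProduct.rid ℂ P ((Coalgebra.counit (R := ℂ)).lTensor P (coact x)) = x
  base : StarSubalgebra ℂ P
  mem_base : ∀ x, x ∈ base ↔ coact x = x ⊗ₜ 1
  /-- Freeness: `x ⊗ y ↦ (x ⊗ 1) Δ_P(y)` is surjective. -/
  surjective : Function.Surjective
    (TensorProduct.lift (LinearMap.mk₂ ℂ (fun x y : P => (x ⊗ₜ[ℂ] (1 : H)) * coact y)
      (fun _ _ _ => by rw [TensorProduct.add_tmul, add_mul])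
      (fun _ _ _ => by rw [← TensorProduct.smul_tmul', smul_mul_assoc])
      (fun _ _ _ => by rw [map_add, mul_add])
      (fun _ _ _ => by rw [map_smul, mul_smul_comm])))

end Bundle

section Calculus

variable {H P Γ Ω : Type*} [Ring H] [HopfAlgebra ℂ H] [StarRing H] [StarModule ℂ H]
    [Ring P] [Algebra ℂ P] [StarRing P] [StarModule ℂ P]
    [AddCommGroup Γ] [Module ℂ Γ] [Module H Γ] [Module Hᵐᵒᵖ Γ] [SMulCommClass H Hᵐᵒᵖ Γ]
    [IsScalarTower ℂ H Γ] [IsScalarTower ℂ Hᵐᵒᵖ Γ] [Ring Ω] [Algebra ℂ Ω]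

/-- A differential calculus on the bundle `ζ`: a graded differential `*`-algebra
`Ω = ⨁ 𝒜 n` generated by its degree zero part `P`, the universal differential envelope of a
bicovariant `*`-calculus `X` on the structure group, and an extension of the coaction to a morphism
`Ω → Ω ⊗ Γ^∧` of graded differential algebras (which automatically respects the involutions, as `Ω`
is generated by `P`). -/
structure Calculus (ζ : QPBundle H P) (X : FODC H Γ) (𝒜 : ℕ → Submodule ℂ Ω)
    [GradedAlgebra 𝒜] where
  /-- the identification of `P` with the degree zero part of `Ω` -/
  ι : P →ₐ[ℂ] Ω
  ι_injective : Function.Injective ι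
  range_ι : LinearMap.range ι.toLinearMap = 𝒜 0
  d : Ω →ₗ[ℂ] Ω
  isDifferential : IsDifferential 𝒜 d
  star : Ω →ₛₗ[starRingEnd ℂ] Ω
  isGradedStar : IsGradedStar 𝒜 d star
  star_ι : ∀ x, star (ι x) = ι (Star.star x)
  generated : Algebra.adjoin ℂ (Set.range ι ∪ Set.range (fun x => d (ι x))) = ⊤
  isBicovariantStar : X.IsBicovariantStar
  coact : Ω →ₐ[ℂ] 𝒜 ᵍ⊗[ℂ] X.grading
  coact_ι : ∀ x, coact (ι x) = GradedTensorProduct.of ℂ 𝒜 X.grading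
    (TensorProduct.map ι.toLinearMap X.ιH.toLinearMap (ζ.coact x))
  coact_degree : ∀ n, ∀ w ∈ 𝒜 n, coact w ∈ totalDegree 𝒜 X.grading n
  coact_d : ∀ w, coact (d w) = tensorD 𝒜 X.grading d X.dEnv (coact w)

namespace Calculus

variable {ζ : QPBundle H P} {X : FODC H Γ} {𝒜 : ℕ → Submodule ℂ Ω} [GradedAlgebra 𝒜]
    (C : Calculus ζ X 𝒜)

/-- The algebra `Ω(B)` of base forms. -/
def baseForms : Subalgebra ℂ Ω :=
  AlgHom.equalizer C.coact (GradedTensorProduct.includeLeft 𝒜 X.grading)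

lemma mem_baseForms (μ : Ω) : μ ∈ C.baseForms ↔ C.coact μ = μ ᵍ⊗ₜ[ℂ] 1 := Iff.rfl

/-- The kernel of `Ω ⊗ Ω → Ω ⊗_{Ω(B)} Ω`. -/
def balancing : Submodule ℂ (Ω ⊗[ℂ] Ω) :=
  Submodule.span ℂ {z | ∃ a b, ∃ μ ∈ C.baseForms, z = (a * μ) ⊗ₜ[ℂ] b - a ⊗ₜ[ℂ] (μ * b)}

/-- The tensor product `Ω ⊗_{Ω(B)} Ω`. -/
abbrev Balanced : Type _ := (Ω ⊗[ℂ] Ω) ⧸ C.balancing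

/-- Linear maps out of `Ω ⊗_{Ω(B)} Ω`. -/
def balancedLift {M : Type*} [AddCommGroup M] [Module ℂ M] (L : Ω ⊗[ℂ] Ω →ₗ[ℂ] M)
    (hL : ∀ a b, ∀ μ ∈ C.baseForms, L ((a * μ) ⊗ₜ b) = L (a ⊗ₜ (μ * b))) :
    C.Balanced →ₗ[ℂ] M :=
  C.balancing.liftQ L <| by
    rw [balancing, Submodule.span_le]
    rintro _ ⟨a, b, μ, hμ, rfl⟩
    simp [hL a b μ hμ]

/-- The canonical map `Ω ⊗_{Ω(B)} Ω → Ω ⊗ Γ^∧`, `a ⊗ b ↦ (a ⊗ 1) Δ_Ω(b)`. -/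
def canonicalMap : C.Balanced →ₗ[ℂ] 𝒜 ᵍ⊗[ℂ] X.grading :=
  C.balancedLift (LinearMap.mul' ℂ (𝒜 ᵍ⊗[ℂ] X.grading) ∘ₗ
    TensorProduct.map (GradedTensorProduct.includeLeft 𝒜 X.grading).toLinearMap
      C.coact.toLinearMap) fun a b μ hμ => by
    simp only [LinearMap.comp_apply, TensorProduct.map_tmul, LinearMap.mul'_apply,
      AlgHom.toLinearMap_apply, map_mul, mul_assoc]
    rw [show C.coact μ = _ from hμ]

/-- The quantum translation map `Γ^∧ → Ω ⊗_{Ω(B)} Ω`. -/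
def qtrs (hβ : Function.Bijective C.canonicalMap) : X.Env →ₗ[ℂ] C.Balanced :=
  (LinearEquiv.ofBijective C.canonicalMap hβ).symm.toLinearMap ∘ₗ
    (GradedTensorProduct.includeRight 𝒜 X.grading).toLinearMap

/-- The map `Ω ⊗_{Ω(B)} Ω → Ω`, `a ⊗ b ↦ a F(b)`, for a left `Ω(B)`-linear map `F`. -/
def mulId (F : Ω →ₗ[ℂ] Ω) (hF : ∀ μ ∈ C.baseForms, ∀ w, F (μ * w) = μ * F w) :
    C.Balanced →ₗ[ℂ] Ω :=
  C.balancedLift (LinearMap.mul' ℂ Ω ∘ₗ F.lTensor Ω) fun a b μ hμ => by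
    simp [hF μ hμ, mul_assoc]

/-- The coaction of `Γ^∧` on `Ω`, with values in the underlying space `Ω ⊗ Γ^∧`. -/
def coactₗ : Ω →ₗ[ℂ] Ω ⊗[ℂ] X.Env :=
  (GradedTensorProduct.of ℂ 𝒜 X.grading).symm.toLinearMap ∘ₗ C.coact.toLinearMap

/-- The right adjoint coaction of `Γ^∧`. -/
def Ad : X.Env →ₗ[ℂ] X.Env ⊗[ℂ] X.Env := FODC.Ad C.isBicovariantStar.toIsBicovariant

/-- The coproduct of `Γ^∧`, with values in the underlying space `Γ^∧ ⊗ Γ^∧`. -/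
def comulₗ : X.Env →ₗ[ℂ] X.Env ⊗[ℂ] X.Env :=
  (GradedTensorProduct.of ℂ X.grading X.grading).symm.toLinearMap ∘ₗ
    (FODC.comul C.isBicovariantStar.toIsBicovariant).toLinearMap

/-- The convolution product of linear maps `Γ^∧ → Ω`. -/
def conv (f g : X.Env →ₗ[ℂ] Ω) : X.Env →ₗ[ℂ] Ω :=
  LinearMap.mul' ℂ Ω ∘ₗ TensorProduct.map f g ∘ₗ C.comulₗ

variable (X 𝒜) in
/-- The unit `ϑ ↦ ε(ϑ) 1` of the convolution product. -/
def convOne : X.Env →ₗ[ℂ] Ω := Algebra.linearMap ℂ Ω ∘ₗ X.counit.toLinearMap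

variable (X 𝒜) in
/-- Graded (degree zero) linear maps `Γ^∧ → Ω`. -/
def IsGradedMap (f : X.Env →ₗ[ℂ] Ω) : Prop := ∀ n, ∀ ϑ ∈ X.grading n, f ϑ ∈ 𝒜 n

/-- The convolution invertible maps: graded linear maps `f : Γ^∧ → Ω` with `f(1) = 1` and
`(f ⊗ id) Ad = Δ_Ω f` that have a graded convolution inverse. -/
def GaugeMap : Type _ :=
  {f : X.Env →ₗ[ℂ] Ω // IsGradedMap X 𝒜 f ∧ f 1 = 1 ∧
    f.rTensor X.Env ∘ₗ C.Ad = C.coactₗ ∘ₗ f ∧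
    ∃ f', IsGradedMap X 𝒜 f' ∧ C.conv f f' = convOne X ∧ C.conv f' f = convOne X}

/-- The graded left `Ω(B)`-module automorphisms `F` of `Ω` with `F(1) = 1` and
`(F ⊗ id) Δ_Ω = Δ_Ω F`. -/
def VertAut : Type _ :=
  {F : Ω ≃ₗ[ℂ] Ω // (∀ n, ∀ w ∈ 𝒜 n, F w ∈ 𝒜 n) ∧
    (∀ μ ∈ C.baseForms, ∀ w, F (μ * w) = μ * F w) ∧ F 1 = 1 ∧
    F.toLinearMap.rTensor X.Env ∘ₗ C.coactₗ = C.coactₗ ∘ₗ F.toLinearMap}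

end Calculus

end Calculus

end QuantumBundle

end

/-! The whole statement follows from bijectivity of the canonical map `β(a ⊗ b) = (a ⊗ 1) Δ(b)`,
together with the observation that `F` and `f` determine each other through `F(w) = w₀ f(w₁)`.

Surjectivity. If `b` has degree `k`, the component of `Δ(b)` with `Γ`-degree `k` is its top one and
has `Ω`-degree `0`; these top components are multiplicative. Freeness of the bundle produces `1 ⊗ h`
and `1 ⊗ dh` as top components, hence `1 ⊗ ϑ` for every `ϑ` of degree `k`. The remaining components
have lower `Γ`-degree and are reached by induction (`one_tmul_mem_range`).

Injectivity. Filter `Ω` by the largest `Γ`-degree occurring in the coaction. If `b` has leading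
degree `k`, coassociativity shows that the coefficients of its leading component are horizontal,
i.e. have coaction in `Ω ⊗ H`. Choose any linear map `l : Γ^∧ → Ω ⊗ Ω` inverting `β` to leading
order and average it against the Haar functional of `H`. Averages of horizontal forms lie in `Ω(B)`,
so this gives `u ∈ Ω(B) ⊗ Ω^k` whose product has the same leading component as `b` (`average_mem`,
`smulLift_average`). Modulo the balancing relations, `a ⊗ b` equals `a u` plus a tensor of smaller
filtration. For an element killed by `β` the terms `a u` add up to zero, so it descends to
filtration `0`, where it vanishes (`mem_balancing_of_smulLift_eq_zero`).

The Haar functional is built algebraically. On the coefficients of one unitary corepresentation it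
comes from an orthogonal projection; convolution handles finitely many corepresentations, and a
linear functional vanishing on all the invariance relations but not at `1` handles all of them.

The correspondence. Write `F_f(w) = w₀ f(w₁)`. Surjectivity of `β` makes `f ↦ F_f` injective. In the
convolution algebra of maps into `Ω ⊗ Γ^∧`, the condition `(f ⊗ id) Ad = Δ f` says that `Δ f` is the
conjugate of `f ⊗ 1` by `ϑ ↦ 1 ⊗ ϑ`, whose inverse is given by the antipode; this is equivalent to
`F_f` being colinear. Colinearity gives `F_{f * g} = F_g ∘ F_f`, which is exactly the product of the
second group. Finally `β⁻¹(Δ(w)) = 1 ⊗ w` shows that `m (id ⊗ F) qtrs` is the `f` with `F_f = F`. -/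

noncomputable section

namespace QuantumBundle

/-! ### The Haar functional of a compact quantum group. -/

section Haar

variable {H : Type*} [Ring H] [HopfAlgebra ℂ H]

/-- The convolution product of two functionals on `H`. -/
def dualConv (φ ψ : H →ₗ[ℂ] ℂ) : H →ₗ[ℂ] ℂ :=
  LinearMap.mul' ℂ ℂ ∘ₗ TensorProduct.map φ ψ ∘ₗ Coalgebra.comul

lemma dualConv_one (φ ψ : H →ₗ[ℂ] ℂ) : dualConv φ ψ 1 = φ 1 * ψ 1 := by
  simp [dualConv, Algebra.TensorProduct.one_def]

/-- The functional `h` is left invariant on the coefficients of the corepresentation `u`. -/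
def IsInvariantOn (h : H →ₗ[ℂ] ℂ) {n : ℕ} (u : Matrix (Fin n) (Fin n) H) : Prop :=
  ∀ j k, ∑ l, h (u l k) • u j l = h (u j k) • 1

variable [StarRing H] [StarModule ℂ H] {n : ℕ} {u : Matrix (Fin n) (Fin n) H}

lemma IsUnitaryCorep.dualConv_apply (hu : IsUnitaryCorep H u) (φ ψ : H →ₗ[ℂ] ℂ) (i j : Fin n) :
    dualConv φ ψ (u i j) = ∑ k, φ (u i k) * ψ (u k j) := by
  simp [dualConv, hu.comul]

/-- The antipode axiom makes `S(u)` a left inverse of `u` and unitarity makes `u^*` a right inverse,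
so the two coincide. -/
lemma IsUnitaryCorep.antipode (hu : IsUnitaryCorep H u) (i j : Fin n) :
    HopfAlgebra.antipode ℂ (u i j) = star (u j i) := by
  have h1 : u.map (HopfAlgebra.antipode ℂ) * u = 1 := by
    ext i j
    have := HopfAlgebra.mul_antipode_rTensor_comul_apply (R := ℂ) (u i j)
    rw [hu.comul, hu.counit] at this
    simp only [map_sum, LinearMap.rTensor_tmul, LinearMap.mul'_apply] at this
    rw [Matrix.mul_apply, Matrix.one_apply]
    simp only [Matrix.map_apply, this]
    split_ifs <;> simp
  have h2 := left_inv_eq_right_inv h1 hu.mul_conjTranspose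
  simpa using congrFun (congrFun h2 i) j

/-- The functional `x ↦ conj φ(S(x)^*)`. -/
def dualStar (φ : H →ₗ[ℂ] ℂ) : H →ₗ[ℂ] ℂ where
  toFun x := starRingEnd ℂ (φ (star (HopfAlgebra.antipode ℂ x)))
  map_add' x y := by simp
  map_smul' c x := by simp

lemma IsUnitaryCorep.dualStar_apply (hu : IsUnitaryCorep H u) (φ : H →ₗ[ℂ] ℂ) (i j : Fin n) :
    dualStar φ (u i j) = starRingEnd ℂ (φ (u j i)) := by
  simp [dualStar, hu.antipode]

/-- The matrix of values of a functional on the coefficients of `u`, as a vector. -/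
def coeffVec (u : Matrix (Fin n) (Fin n) H) :
    (H →ₗ[ℂ] ℂ) →ₗ[ℂ] EuclideanSpace ℂ (Fin n × Fin n) where
  toFun φ := WithLp.toLp 2 fun p => φ (u p.1 p.2)
  map_add' φ ψ := by ext; simp
  map_smul' c φ := by ext; simp

lemma coeffVec_apply (u : Matrix (Fin n) (Fin n) H) (φ : H →ₗ[ℂ] ℂ) (p : Fin n × Fin n) :
    coeffVec u φ p = φ (u p.1 p.2) := rfl

/-- Every unitary corepresentation has a normalized functional that is invariant on its
coefficients: the orthogonal projection onto the invariant vectors. -/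
lemma IsUnitaryCorep.exists_invariant (hu : IsUnitaryCorep H u) :
    ∃ h : H →ₗ[ℂ] ℂ, h 1 = 1 ∧ IsInvariantOn h u := by
  -- `J` is an ideal of the convolution algebra, being the kernel of the character `φ ↦ φ(1)`. The
  -- functional sought is `ε` minus a `ψ ∈ J` whose values on the coefficients of `u` form the
  -- orthogonal projection of those of `ε` onto the image `K` of `J`.
  set J : Submodule ℂ (H →ₗ[ℂ] ℂ) := LinearMap.ker (LinearMap.applyₗ (1 : H)) with hJ
  have memJ : ∀ φ, φ ∈ J ↔ φ 1 = 0 := fun φ => Iff.rfl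
  set K := J.map (coeffVec u) with hK
  obtain ⟨e, he, p, hp, hep⟩ := K.exists_add_mem_mem_orthogonal
    (coeffVec u (Coalgebra.counit (R := ℂ)))
  obtain ⟨ψ, hψ, rfl⟩ := he
  set h : H →ₗ[ℂ] ℂ := Coalgebra.counit - ψ with hh
  have hp' : p = coeffVec u h := by rw [hh, map_sub, hep]; abel
  have h1 : h 1 = 1 := by
    rw [hh, LinearMap.sub_apply, (memJ ψ).1 hψ, Bialgebra.counit_one, sub_zero]
  have main : ∀ φ ∈ J, coeffVec u (dualConv φ h) = 0 := by
    intro φ hφ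
    have orth : ∀ η ∈ J, inner ℂ (coeffVec u η) (coeffVec u (dualConv φ h)) = 0 := by
      intro η hη
      -- On coefficient vectors, convolution by `dualStar φ` is the adjoint of convolution by `φ`.
      -- Since it maps `J` to `J`, orthogonality of `h` to `K` passes to `φ * h`, which itself lies
      -- in `J` and is therefore orthogonal to itself.
      have hw : dualConv (dualStar φ) η ∈ J := by
        rw [memJ, dualConv_one, (memJ η).1 hη, mul_zero]
      have := (Submodule.mem_orthogonal K p).1 hp _ (Submodule.mem_map_of_mem hw)
      rw [hp'] at this
      rw [← this]
      simp only [PiLp.inner_apply, RCLike.inner_apply, coeffVec_apply, hu.dualConv_apply,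
        hu.dualStar_apply, Fintype.sum_prod_type, map_sum, map_mul, Complex.conj_conj,
        Finset.mul_sum, Finset.sum_mul]
      calc ∑ i, ∑ j, ∑ l, φ (u i l) * h (u l j) * starRingEnd ℂ (η (u i j))
          = ∑ i, ∑ l, ∑ j, φ (u i l) * h (u l j) * starRingEnd ℂ (η (u i j)) :=
            Finset.sum_congr rfl fun i _ => Finset.sum_comm
        _ = ∑ l, ∑ i, ∑ j, φ (u i l) * h (u l j) * starRingEnd ℂ (η (u i j)) := Finset.sum_comm
        _ = ∑ l, ∑ j, ∑ i, φ (u i l) * h (u l j) * starRingEnd ℂ (η (u i j)) :=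
            Finset.sum_congr rfl fun i _ => Finset.sum_comm
        _ = _ := Finset.sum_congr rfl fun l _ => Finset.sum_congr rfl fun j _ =>
            Finset.sum_congr rfl fun i _ => by ring
    exact inner_self_eq_zero.1 (orth _ (by rw [memJ, dualConv_one, (memJ φ).1 hφ, zero_mul]))
  refine ⟨h, h1, fun j k => ?_⟩
  refine (Module.forall_dual_apply_eq_zero_iff ℂ _).1 (fun φ => ?_) |> sub_eq_zero.1
  -- Splitting off `φ(1) ε` turns the vanishing on `J` into `φ * h = φ(1) h` on coefficients, for
  -- every `φ`; functionals separate points of `H`.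
  have hφ : φ - φ 1 • Coalgebra.counit ∈ J := by
    rw [memJ]; simp
  have := congrArg (fun v => v (j, k)) (main _ hφ)
  simp only [coeffVec_apply, hu.dualConv_apply] at this
  simp only [LinearMap.sub_apply, LinearMap.smul_apply, hu.counit, smul_eq_mul, sub_mul, mul_ite,
    mul_one, mul_zero, ite_mul, zero_mul, Finset.sum_sub_distrib, Finset.sum_ite_eq,
    Finset.mem_univ, if_true, PiLp.zero_apply] at this
  simp only [map_sub, map_sum, map_smul, smul_eq_mul]
  rw [← this, mul_comm (h _) (φ 1)]
  simp only [mul_comm]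

/-- If `h` is invariant on `L` and `g` on `u`, then `g * h` works for both: on `L` it takes the same
values as `h`, because `g(1) = 1`, while on `u` the factor `g` already provides the invariance. -/
lemma exists_invariant_list (L : List (Σ n, {u : Matrix (Fin n) (Fin n) H // IsUnitaryCorep H u})) :
    ∃ h : H →ₗ[ℂ] ℂ, h 1 = 1 ∧ ∀ u ∈ L, IsInvariantOn h u.2.1 := by
  induction L with
  | nil => exact ⟨Coalgebra.counit, Bialgebra.counit_one, by simp⟩
  | cons u L ih =>
    obtain ⟨h, h1, hL⟩ := ih
    obtain ⟨g, g1, hg⟩ := u.2.2.exists_invariant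
    refine ⟨dualConv g h, by rw [dualConv_one, g1, h1, one_mul], fun v hv j k => ?_⟩
    simp only [v.2.2.dualConv_apply]
    rcases List.mem_cons.1 hv with rfl | hv
    · calc _ = ∑ l, ∑ m, (h (v.2.1 m k)) • g (v.2.1 l m) • v.2.1 j l :=
            Finset.sum_congr rfl fun l _ => by
              rw [Finset.sum_smul]
              exact Finset.sum_congr rfl fun m _ => by rw [smul_smul, mul_comm]
        _ = ∑ m, h (v.2.1 m k) • ∑ l, g (v.2.1 l m) • v.2.1 j l := by
            rw [Finset.sum_comm]; simp [Finset.smul_sum]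
        _ = _ := by
            rw [Finset.sum_smul]
            exact Finset.sum_congr rfl fun m _ => by rw [hg j m, smul_smul, mul_comm]
    · have key : ∀ l, ∑ m, g (v.2.1 l m) * h (v.2.1 m k) = h (v.2.1 l k) := fun l => by
        have := congrArg g (hL v hv l k)
        simpa [g1, mul_comm] using this
      simp only [key]
      exact hL v hv j k

/-- The Haar functional of a compact quantum group. -/
theorem IsQuantumGroup.exists_haar (hH : IsQuantumGroup H) : ∃ h : H →ₗ[ℂ] ℂ, h 1 = 1 ∧
    ∀ x, TensorProduct.rid ℂ H (h.lTensor H (Coalgebra.comul x)) = h x • 1 := by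
  -- A functional is invariant exactly when it kills all `φ(x₁) x₂ - φ(1) x`; `K` is the span of
  -- these relations for `x` a coefficient.
  set D : (H →ₗ[ℂ] ℂ) → H → H := fun φ x =>
    TensorProduct.lid ℂ H (φ.rTensor H (Coalgebra.comul x)) - φ 1 • x with hD
  have hDu : ∀ φ (n : ℕ) (u : Matrix (Fin n) (Fin n) H), IsUnitaryCorep H u → ∀ i j,
      D φ (u i j) = ∑ k, φ (u i k) • u k j - φ 1 • u i j := fun φ n u hu i j => by
    simp [hD, hu.comul]
  set K : Submodule ℂ H := Submodule.span ℂ {z | ∃ (n : ℕ) (u : Matrix (Fin n) (Fin n) H)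
    (_ : IsUnitaryCorep H u) (φ : H →ₗ[ℂ] ℂ) (i j : Fin n), z = D φ (u i j)} with hK
  have hL : ∀ z ∈ K, ∃ L : List (Σ n, {u : Matrix (Fin n) (Fin n) H // IsUnitaryCorep H u}),
      ∀ h : H →ₗ[ℂ] ℂ, (∀ u ∈ L, IsInvariantOn h u.2.1) → h z = 0 := by
    intro z hz
    induction hz using Submodule.span_induction with
    | mem z hz =>
      obtain ⟨n, u, hu, φ, i, j, rfl⟩ := hz
      refine ⟨[⟨n, u, hu⟩], fun h hh => ?_⟩
      have := congrArg φ (hh _ (List.mem_singleton.2 rfl) i j)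
      rw [hDu φ n u hu]
      simp only [map_sum, map_smul, smul_eq_mul, map_sub] at this ⊢
      rw [sub_eq_zero, mul_comm (φ 1), ← this]
      simp only [mul_comm]
    | zero => exact ⟨[], fun h _ => map_zero h⟩
    | add x y _ _ hx hy =>
      obtain ⟨L, hL⟩ := hx
      obtain ⟨L', hL'⟩ := hy
      refine ⟨L ++ L', fun h hh => ?_⟩
      rw [map_add, hL h fun u hu => hh u (List.mem_append_left _ hu),
        hL' h fun u hu => hh u (List.mem_append_right _ hu), add_zero]
    | smul c x _ hx =>
      obtain ⟨L, hL⟩ := hx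
      exact ⟨L, fun h hh => by rw [map_smul, hL h hh, smul_zero]⟩
  -- A relation expressing `1` would involve only finitely many corepresentations, and a normalized
  -- functional invariant on those would kill it.
  have h1K : (1 : H) ∉ K := fun h1 => by
    obtain ⟨L, hL⟩ := hL 1 h1
    obtain ⟨h, h1, hh⟩ := exists_invariant_list L
    exact one_ne_zero (h1.symm.trans (hL h hh))
  obtain ⟨f, hf1, hfK⟩ := Submodule.exists_le_ker_of_notMem h1K
  refine ⟨(f 1)⁻¹ • f, by simp [hf1], fun x => ?_⟩
  have hx : x ∈ Submodule.span ℂ {h : H | ∃ (n : ℕ) (u : Matrix (Fin n) (Fin n) H) (i j : Fin n),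
      IsUnitaryCorep H u ∧ h = u i j} := hH.span_coeff ▸ Submodule.mem_top
  induction hx using Submodule.span_induction with
  | mem x hx =>
    obtain ⟨n, u, i, j, hu, rfl⟩ := hx
    refine sub_eq_zero.1 ((Module.forall_dual_apply_eq_zero_iff ℂ _).1 fun φ => ?_)
    have : f (D φ (u i j)) = 0 := hfK (Submodule.subset_span ⟨n, u, hu, φ, i, j, rfl⟩)
    rw [hDu φ n u hu] at this
    simp only [map_sum, map_smul, smul_eq_mul, map_sub] at this
    simp only [hu.comul, map_sum, LinearMap.lTensor_tmul, TensorProduct.rid_tmul,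
      LinearMap.smul_apply, map_sub, map_smul, smul_eq_mul, mul_assoc, ← Finset.mul_sum]
    rw [← mul_sub, mul_comm (f (u i j)), ← mul_zero (f 1)⁻¹, ← this]
    simp only [mul_comm]
  | zero => simp
  | add x y _ _ hx hy => simp only [map_add, hx, hy, add_smul]
  | smul c x _ hx => simp only [map_smul, hx, smul_assoc]

end Haar

/-! ### Total degree in the graded tensor product. -/

section TotalDegree

variable {A B : Type*} [Ring A] [Algebra ℂ A] [Ring B] [Algebra ℂ B]
  (𝒜 : ℕ → Submodule ℂ A) (ℬ : ℕ → Submodule ℂ B) [GradedAlgebra 𝒜] [GradedAlgebra ℬ]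

lemma tmul_mem_totalDegree {i j n : ℕ} (h : i + j = n) {a : A} (ha : a ∈ 𝒜 i) {b : B}
    (hb : b ∈ ℬ j) : (a ᵍ⊗ₜ[ℂ] b : 𝒜 ᵍ⊗[ℂ] ℬ) ∈ totalDegree 𝒜 ℬ n :=
  Submodule.subset_span ⟨i, j, h, a, ha, b, hb, rfl⟩

lemma tmul_mul_tmul_of_mem {i j : ℕ} {b : B} (hb : b ∈ ℬ j) {a' : A} (ha' : a' ∈ 𝒜 i) (a : A)
    (b' : B) : (a ᵍ⊗ₜ[ℂ] b * a' ᵍ⊗ₜ[ℂ] b' : 𝒜 ᵍ⊗[ℂ] ℬ) =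
      (-1 : ℂ) ^ (j * i) • ((a * a') ᵍ⊗ₜ[ℂ] (b * b')) := by
  refine (GradedTensorProduct.tmul_coe_mul_coe_tmul 𝒜 ℬ a ⟨b, hb⟩ ⟨a', ha'⟩ b').trans ?_
  rcases Nat.even_or_odd (j * i) with h | h <;> simp [h.neg_one_pow]

lemma mul_mem_totalDegree {m n : ℕ} {x y : 𝒜 ᵍ⊗[ℂ] ℬ} (hx : x ∈ totalDegree 𝒜 ℬ m)
    (hy : y ∈ totalDegree 𝒜 ℬ n) : x * y ∈ totalDegree 𝒜 ℬ (m + n) := by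
  induction hx using Submodule.span_induction with
  | zero => rw [zero_mul]; exact zero_mem _
  | add x x' _ _ hx hx' => rw [add_mul]; exact add_mem hx hx'
  | smul c x _ hx => rw [smul_mul_assoc]; exact Submodule.smul_mem _ _ hx
  | mem x hx =>
    obtain ⟨i, j, rfl, a, ha, b, hb, rfl⟩ := hx
    induction hy using Submodule.span_induction with
    | zero => rw [mul_zero]; exact zero_mem _
    | add x x' _ _ hx hx' => rw [mul_add]; exact add_mem hx hx'
    | smul c x _ hx => rw [mul_smul_comm]; exact Submodule.smul_mem _ _ hx
    | mem y hy =>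
      obtain ⟨k, l, rfl, a', ha', b', hb', rfl⟩ := hy
      rw [tmul_mul_tmul_of_mem 𝒜 ℬ hb ha']
      exact Submodule.smul_mem _ _ (tmul_mem_totalDegree 𝒜 ℬ (by ring)
        (SetLike.mul_mem_graded ha ha') (SetLike.mul_mem_graded hb hb'))

lemma map_parity_of_mem_totalDegree {n : ℕ} {x : 𝒜 ᵍ⊗[ℂ] ℬ} (hx : x ∈ totalDegree 𝒜 ℬ n) :
    TensorProduct.map (parity 𝒜) (parity ℬ) ((GradedTensorProduct.of ℂ 𝒜 ℬ).symm x) =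
      (-1 : ℂ) ^ n • (GradedTensorProduct.of ℂ 𝒜 ℬ).symm x := by
  induction hx using Submodule.span_induction with
  | zero => simp
  | add x x' _ _ hx hx' => simp only [map_add, hx, hx', smul_add]
  | smul c x _ hx => simp only [map_smul, hx, smul_comm c]
  | mem x hx =>
    obtain ⟨i, j, rfl, a, ha, b, hb, rfl⟩ := hx
    simp [GradedTensorProduct.tmul, parity_of_mem 𝒜 ha, parity_of_mem ℬ hb,
      TensorProduct.tmul_smul, ← TensorProduct.smul_tmul', smul_smul, pow_add, mul_comm]

/-- Left multiplication by degree zero elements on the first factor needs no sign. -/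
lemma tmul_one_mul_of (a : A) (t : A ⊗[ℂ] B) :
    (a ᵍ⊗ₜ[ℂ] 1 : 𝒜 ᵍ⊗[ℂ] ℬ) * GradedTensorProduct.of ℂ 𝒜 ℬ t =
      GradedTensorProduct.of ℂ 𝒜 ℬ (a • t) := by
  induction t with
  | zero => simp
  | add x y hx hy => simp only [map_add, mul_add, hx, hy, smul_add]
  | tmul u v =>
    exact (tmul_mul_tmul_zero 𝒜 ℬ (SetLike.GradedOne.one_mem (A := ℬ)) a u v).trans
      (by rw [one_mul]; rfl)

end TotalDegree

/-! ### Coactions of `Γ^∧` described by multiplication by generators. -/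

section Act

variable {H Γ : Type*} [Ring H] [HopfAlgebra ℂ H] [AddCommGroup Γ] [Module ℂ Γ]
    [Module H Γ] [Module Hᵐᵒᵖ Γ] [SMulCommClass H Hᵐᵒᵖ Γ]
    [IsScalarTower ℂ H Γ] [IsScalarTower ℂ Hᵐᵒᵖ Γ] (X : FODC H Γ)
    {R Ω : Type*} [AddCommGroup R] [Module ℂ R] [Ring Ω] [Algebra ℂ Ω]
    (𝒜 : ℕ → Submodule ℂ Ω) [GradedAlgebra 𝒜] (ι dι : R →ₗ[ℂ] Ω)

/-- The left multiplication `a ⊗ b ↦ ι(p) a ⊗ h b`. -/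
def act₀ : R ⊗[ℂ] H →ₗ[ℂ] Module.End ℂ (Ω ⊗[ℂ] X.Env) :=
  TensorProduct.homTensorHomMap (RingHom.id ℂ) Ω X.Env Ω X.Env ∘ₗ
    TensorProduct.map (LinearMap.mul ℂ Ω ∘ₗ ι) (LinearMap.mul ℂ X.Env ∘ₗ X.ιH.toLinearMap)

/-- The graded left multiplication `a ⊗ b ↦ dι(p) a ⊗ h b + (-1)^{deg a} ι(p) a ⊗ (dh) b`. -/
def act₁ : R ⊗[ℂ] H →ₗ[ℂ] Module.End ℂ (Ω ⊗[ℂ] X.Env) :=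
  TensorProduct.homTensorHomMap (RingHom.id ℂ) Ω X.Env Ω X.Env ∘ₗ
    (TensorProduct.map (LinearMap.mul ℂ Ω ∘ₗ dι) (LinearMap.mul ℂ X.Env ∘ₗ X.ιH.toLinearMap) +
      TensorProduct.map (LinearMap.lcomp ℂ Ω (parity 𝒜) ∘ₗ LinearMap.mul ℂ Ω ∘ₗ ι)
        (LinearMap.mul ℂ X.Env ∘ₗ X.dH))

@[simp] lemma act₀_tmul (p : R) (h : H) (a : Ω) (b : X.Env) :
    act₀ X ι (p ⊗ₜ h) (a ⊗ₜ b) = (ι p * a) ⊗ₜ (X.ιH h * b) := rfl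

@[simp] lemma act₁_tmul (p : R) (h : H) (a : Ω) (b : X.Env) :
    act₁ X 𝒜 ι dι (p ⊗ₜ h) (a ⊗ₜ b) =
      (dι p * a) ⊗ₜ (X.ιH h * b) + (ι p * parity 𝒜 a) ⊗ₜ (X.dH h * b) := rfl

/-- A coaction of `Γ^∧` on a graded algebra generated by elements `ι x` and `dι x`, given on
these generators by a coaction `c` of `H`. -/
structure IsFormCoaction (c : R →ₗ[ℂ] R ⊗[ℂ] H) (δ : Ω →ₗ[ℂ] Ω ⊗[ℂ] X.Env) : Prop where
  one : δ 1 = 1 ⊗ₜ 1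
  zero_mul : ∀ x v, δ (ι x * v) = act₀ X ι (c x) (δ v)
  one_mul : ∀ x v, δ (dι x * v) = act₁ X 𝒜 ι dι (c x) (δ v)
  parity : ∀ v, δ (parity 𝒜 v) = TensorProduct.map (parity 𝒜) (QuantumBundle.parity X.grading) (δ v)
  induction : ∀ p : Ω → Prop, p 1 → (∀ v w, p v → p w → p (v + w)) →
    (∀ x v, p v → p (ι x * v)) → (∀ x v, p v → p (dι x * v)) → ∀ v, p v

/-- Elements of `H` have degree zero in `Γ^∧`, so no Koszul sign appears and graded left
multiplication is the plain operator `act₀`. -/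
lemma of_map_mul_of (z : R ⊗[ℂ] H) (t : Ω ⊗[ℂ] X.Env) :
    GradedTensorProduct.of ℂ 𝒜 X.grading (TensorProduct.map ι X.ιH.toLinearMap z) *
      GradedTensorProduct.of ℂ 𝒜 X.grading t =
        GradedTensorProduct.of ℂ 𝒜 X.grading (act₀ X ι z t) := by
  induction z with
  | zero => simp
  | add x y hx hy => simp only [map_add, add_mul, hx, hy, LinearMap.add_apply]
  | tmul p h =>
    induction t with
    | zero => simp
    | add x y hx hy => simp only [map_add, mul_add, hx, hy]
    | tmul a b => exact tmul_mul_tmul_zero 𝒜 X.grading (X.ιH_mem h) (ι p) a b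

/-- In the term containing `dh` the degree one element `dh` has to pass the factor `a`; this is the
source of the parity operator in `act₁`. -/
lemma tensorD_of_map_mul_of {d : Ω →ₗ[ℂ] Ω} (hι : ∀ x, ι x ∈ 𝒜 0) (z : R ⊗[ℂ] H)
    (t : Ω ⊗[ℂ] X.Env) :
    tensorD 𝒜 X.grading d X.dEnv
        (GradedTensorProduct.of ℂ 𝒜 X.grading (TensorProduct.map ι X.ιH.toLinearMap z)) *
      GradedTensorProduct.of ℂ 𝒜 X.grading t =
        GradedTensorProduct.of ℂ 𝒜 X.grading (act₁ X 𝒜 ι (d ∘ₗ ι) z t) := by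
  induction z with
  | zero => simp
  | add x y hx hy => simp only [map_add, add_mul, hx, hy, LinearMap.add_apply]
  | tmul p h =>
    induction t with
    | zero => simp
    | add x y hx hy => simp only [map_add, mul_add, hx, hy]
    | tmul a b =>
      refine (congrArg (· * _) (tensorD_tmul 𝒜 X.grading d X.dEnv (ι p) (X.ιH h))).trans ?_
      have hp : parity 𝒜 (ι p) = ι p := by simpa using parity_of_mem 𝒜 (hι p)
      rw [add_mul, act₁_tmul, map_add, hp, X.dEnv_ιH]
      exact congrArg₂ (· + ·) (tmul_mul_tmul_zero 𝒜 X.grading (X.ιH_mem h) _ a b)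
        (tmul_mul_tmul_one 𝒜 X.grading (X.dH_mem h) _ a b)

/-- The operators `act₀` on triple tensor products. -/
def act₀₃ : R ⊗[ℂ] (H ⊗[ℂ] H) →ₗ[ℂ] Module.End ℂ (Ω ⊗[ℂ] (X.Env ⊗[ℂ] X.Env)) :=
  TensorProduct.homTensorHomMap (RingHom.id ℂ) Ω (X.Env ⊗[ℂ] X.Env) Ω (X.Env ⊗[ℂ] X.Env) ∘ₗ
    TensorProduct.map (LinearMap.mul ℂ Ω ∘ₗ ι) (act₀ X X.ιH.toLinearMap)

/-- The operators `act₁` on triple tensor products. -/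
def act₁₃ : R ⊗[ℂ] (H ⊗[ℂ] H) →ₗ[ℂ] Module.End ℂ (Ω ⊗[ℂ] (X.Env ⊗[ℂ] X.Env)) :=
  TensorProduct.homTensorHomMap (RingHom.id ℂ) Ω (X.Env ⊗[ℂ] X.Env) Ω (X.Env ⊗[ℂ] X.Env) ∘ₗ
    (TensorProduct.map (LinearMap.mul ℂ Ω ∘ₗ dι) (act₀ X X.ιH.toLinearMap) +
      TensorProduct.map (LinearMap.lcomp ℂ Ω (parity 𝒜) ∘ₗ LinearMap.mul ℂ Ω ∘ₗ ι)
        (act₁ X X.grading X.ιH.toLinearMap X.dH))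

@[simp] lemma act₀₃_tmul (p : R) (z : H ⊗[ℂ] H) (a : Ω) (t : X.Env ⊗[ℂ] X.Env) :
    act₀₃ X ι (p ⊗ₜ z) (a ⊗ₜ t) = (ι p * a) ⊗ₜ (act₀ X X.ιH.toLinearMap z t) := rfl

@[simp] lemma act₁₃_tmul (p : R) (z : H ⊗[ℂ] H) (a : Ω) (t : X.Env ⊗[ℂ] X.Env) :
    act₁₃ X 𝒜 ι dι (p ⊗ₜ z) (a ⊗ₜ t) = (dι p * a) ⊗ₜ (act₀ X X.ιH.toLinearMap z t) +
      (ι p * parity 𝒜 a) ⊗ₜ (act₁ X X.grading X.ιH.toLinearMap X.dH z t) := rfl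

variable {X 𝒜 ι dι} {c : R →ₗ[ℂ] R ⊗[ℂ] H} {δ : Ω →ₗ[ℂ] Ω ⊗[ℂ] X.Env}
  {Δ : X.Env →ₗ[ℂ] X.Env ⊗[ℂ] X.Env}

/-- A coaction on a graded algebra is coassociative if it is so on generators. -/
lemma IsFormCoaction.coassoc (hδ : IsFormCoaction X 𝒜 ι dι c δ)
    (hΔ : IsFormCoaction X X.grading X.ιH.toLinearMap X.dH Coalgebra.comul Δ)
    (hc : ∀ x, TensorProduct.assoc ℂ R H H (c.rTensor H (c x)) =
      (Coalgebra.comul (R := ℂ)).lTensor R (c x)) (w : Ω) :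
    TensorProduct.assoc ℂ Ω X.Env X.Env (δ.rTensor X.Env (δ w)) = Δ.lTensor Ω (δ w) := by
  -- `f₀`, `f₁` and `g₀`, `g₁` say that the two iterated coactions turn multiplication by a
  -- generator into the same operators on the triple tensor product, with parameters `(c ⊗ id) z`
  -- and `(id ⊗ Δ) z`. For `z = c x` these parameters agree by `hc`.
  have f₀ : ∀ z t, TensorProduct.assoc ℂ Ω X.Env X.Env (δ.rTensor X.Env (act₀ X ι z t)) =
      act₀₃ X ι (TensorProduct.assoc ℂ R H H (c.rTensor H z))
        (TensorProduct.assoc ℂ Ω X.Env X.Env (δ.rTensor X.Env t)) := fun z t => by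
    induction z with
    | zero => simp
    | add x y hx hy => simp only [map_add, LinearMap.add_apply, hx, hy]
    | tmul p h =>
      induction t with
      | zero => simp
      | add x y hx hy => simp only [map_add, hx, hy]
      | tmul a b =>
        simp only [act₀_tmul, LinearMap.rTensor_tmul, hδ.zero_mul]
        generalize c p = q
        generalize δ a = s
        induction q with
        | zero => simp
        | add x y hx hy =>
          simp only [map_add, LinearMap.add_apply, TensorProduct.add_tmul, hx, hy]
        | tmul p' h' =>
          induction s with
          | zero => simp
          | add x y hx hy => simp only [map_add, TensorProduct.add_tmul, hx, hy]
          | tmul a' b' => simp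
  have f₁ : ∀ z t, TensorProduct.assoc ℂ Ω X.Env X.Env (δ.rTensor X.Env (act₁ X 𝒜 ι dι z t)) =
      act₁₃ X 𝒜 ι dι (TensorProduct.assoc ℂ R H H (c.rTensor H z))
        (TensorProduct.assoc ℂ Ω X.Env X.Env (δ.rTensor X.Env t)) := fun z t => by
    induction z with
    | zero => simp
    | add x y hx hy => simp only [map_add, LinearMap.add_apply, hx, hy]
    | tmul p h =>
      induction t with
      | zero => simp
      | add x y hx hy => simp only [map_add, hx, hy]
      | tmul a b =>
        simp only [act₁_tmul, map_add, LinearMap.rTensor_tmul, hδ.zero_mul, hδ.one_mul, hδ.parity]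
        generalize c p = q
        generalize δ a = s
        induction q with
        | zero => simp
        | add x y hx hy =>
          simp only [map_add, LinearMap.add_apply, TensorProduct.add_tmul, ← hx, ← hy]
          abel
        | tmul p' h' =>
          induction s with
          | zero => simp
          | add x y hx hy =>
            simp only [map_add, TensorProduct.add_tmul, ← hx, ← hy]
            abel
          | tmul a' b' => simp [TensorProduct.add_tmul, TensorProduct.tmul_add, add_assoc]
  have g₀ : ∀ z t, Δ.lTensor Ω (act₀ X ι z t) =
      act₀₃ X ι ((Coalgebra.comul (R := ℂ)).lTensor R z) (Δ.lTensor Ω t) := fun z t => by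
    induction z with
    | zero => simp
    | add x y hx hy => simp only [map_add, LinearMap.add_apply, hx, hy]
    | tmul p h =>
      induction t with
      | zero => simp
      | add x y hx hy => simp only [map_add, hx, hy]
      | tmul a b => simpa using congrArg ((ι p * a) ⊗ₜ[ℂ] ·) (hΔ.zero_mul h b)
  have g₁ : ∀ z t, Δ.lTensor Ω (act₁ X 𝒜 ι dι z t) =
      act₁₃ X 𝒜 ι dι ((Coalgebra.comul (R := ℂ)).lTensor R z) (Δ.lTensor Ω t) := fun z t => by
    induction z with
    | zero => simp
    | add x y hx hy => simp only [map_add, LinearMap.add_apply, hx, hy]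
    | tmul p h =>
      induction t with
      | zero => simp
      | add x y hx hy => simp only [map_add, hx, hy]
      | tmul a b =>
        have h0 := hΔ.zero_mul h b
        simp only [AlgHom.toLinearMap_apply] at h0
        simp only [act₁_tmul, map_add, LinearMap.lTensor_tmul, h0, hΔ.one_mul h b, act₁₃_tmul]
  refine hδ.induction (fun w => TensorProduct.assoc ℂ Ω X.Env X.Env (δ.rTensor X.Env (δ w)) =
    Δ.lTensor Ω (δ w)) ?_ (fun v w hv hw => ?_) (fun x v hv => ?_)
    (fun x v hv => ?_) w
  · simp [hδ.one, hΔ.one]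
  · simp only [map_add, hv, hw]
  · rw [hδ.zero_mul, f₀, g₀, hc, hv]
  · rw [hδ.one_mul, f₁, g₁, hc, hv]

end Act

/-! ### The Hopf algebra axioms for `Γ^∧`. -/

section

variable {H Γ : Type*} [Ring H] [HopfAlgebra ℂ H] [AddCommGroup Γ] [Module ℂ Γ]
    [Module H Γ] [Module Hᵐᵒᵖ Γ] [SMulCommClass H Hᵐᵒᵖ Γ]
    [IsScalarTower ℂ H Γ] [IsScalarTower ℂ Hᵐᵒᵖ Γ] {X : FODC H Γ}

namespace FODC

lemma Env.left_induction (p : X.Env → Prop) (h1 : p 1) (hadd : ∀ v w, p v → p w → p (v + w))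
    (hH : ∀ g v, p v → p (X.ιH g * v)) (hd : ∀ g v, p v → p (X.dH g * v)) (v : X.Env) : p v := by
  suffices h : ∀ x v, p v → p (x * v) by simpa using h v 1 h1
  intro x
  induction x using Env.induction with
  | hH h => exact hH h
  | hd h => exact hd h
  | hadd x y hx hy => exact fun v hv => by rw [add_mul]; exact hadd _ _ (hx v hv) (hy v hv)
  | hmul x y hx hy => exact fun v hv => by rw [mul_assoc]; exact hx _ (hy v hv)

lemma counit_ιH (h : H) : X.counit (X.ιH h) = Coalgebra.counit (R := ℂ) h := Env.lift_ιH _ h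

lemma counit_dH (h : H) : X.counit (X.dH h) = 0 := Env.lift_dH _ h

lemma counit_parity (v : X.Env) : X.counit (parity X.grading v) = X.counit v := by
  induction v using Env.left_induction with
  | h1 => rw [parity_one]
  | hadd v w hv hw => simp only [map_add, hv, hw]
  | hH g v hv => rw [parity_mul, map_mul, map_mul, parity_ιH, hv]
  | hd g v hv => rw [parity_mul, map_mul, map_mul, parity_dH, map_neg, counit_dH]; simp

/-- The coproduct of `Γ^∧` with values in the underlying space of the tensor product. -/
def comulₗ (hX : X.IsBicovariant) : X.Env →ₗ[ℂ] X.Env ⊗[ℂ] X.Env :=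
  (GradedTensorProduct.of ℂ X.grading X.grading).symm.toLinearMap ∘ₗ (comul hX).toLinearMap

variable (hX : X.IsBicovariant)

lemma of_comulₗ (v : X.Env) :
    GradedTensorProduct.of ℂ X.grading X.grading (comulₗ hX v) = comul hX v := rfl

lemma comul_ιH (h : H) : comul hX (X.ιH h) = X.ιHH (Coalgebra.comul h) := Env.lift_ιH _ h

lemma comul_dH (h : H) : comul hX (X.dH h) = X.dEE (X.ιHH (Coalgebra.comul h)) := Env.lift_dH _ h

variable (X) in
lemma ιHH_mem (p : H ⊗[ℂ] H) : X.ιHH p ∈ totalDegree X.grading X.grading 0 := by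
  induction p with
  | zero => rw [map_zero]; exact zero_mem _
  | add x y hx hy => rw [map_add]; exact add_mem hx hy
  | tmul a b => exact tmul_mem_totalDegree X.grading X.grading (add_zero 0) (X.ιH_mem a) (X.ιH_mem b)

variable (X) in
lemma dEE_ιHH_mem (p : H ⊗[ℂ] H) : X.dEE (X.ιHH p) ∈ totalDegree X.grading X.grading 1 := by
  induction p with
  | zero => rw [map_zero, map_zero]; exact zero_mem _
  | add x y hx hy => rw [map_add, map_add]; exact add_mem hx hy
  | tmul a b =>
    rw [dEE_ιHH]
    exact add_mem
      (tmul_mem_totalDegree X.grading X.grading (add_zero 1) (X.dH_mem a) (X.ιH_mem b))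
      (tmul_mem_totalDegree X.grading X.grading (zero_add 1) (X.ιH_mem a) (X.dH_mem b))

lemma comul_ιΓ_mem (γ : Γ) : comul hX (X.ιΓ γ) ∈ totalDegree X.grading X.grading 1 := by
  obtain ⟨t, rfl⟩ := X.gdh_surjective γ
  rw [ιΓ_gdh]
  induction t with
  | zero => rw [map_zero, map_zero, map_zero]; exact zero_mem _
  | add x y hx hy => rw [map_add, map_add, map_add]; exact add_mem hx hy
  | tmul a b =>
    simp only [TensorProduct.map_tmul, LinearMap.mul'_apply, AlgHom.toLinearMap_apply, map_mul,
      comul_ιH, comul_dH]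
    have := mul_mem_totalDegree X.grading X.grading (X.ιHH_mem (Coalgebra.comul a))
      (X.dEE_ιHH_mem (Coalgebra.comul b))
    rwa [zero_add] at this

/-- The degree `n` part is spanned by products of one element of `H` and `n` of `Γ`, whose
coproducts have total degree `0` and `1`. This is what makes the coproduct commute with parity. -/
lemma comul_mem {n : ℕ} {v : X.Env} (hv : v ∈ X.grading n) :
    comul hX v ∈ totalDegree X.grading X.grading n := by
  have hpow : ∀ n, ∀ v ∈ LinearMap.range X.ιΓ ^ n,
      comul hX v ∈ totalDegree X.grading X.grading n := by
    intro n
    induction n with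
    | zero =>
      intro v hv
      obtain ⟨c, rfl⟩ := Submodule.mem_one.1 (pow_zero (LinearMap.range X.ιΓ) ▸ hv)
      rw [← AlgHom.commutes X.ιH, comul_ιH]
      exact X.ιHH_mem _
    | succ n ih =>
      intro v hv
      rw [pow_succ] at hv
      induction hv using Submodule.mul_induction_on' with
      | mem_mul_mem a ha b hb =>
        obtain ⟨γ, rfl⟩ := hb
        rw [map_mul]
        exact mul_mem_totalDegree X.grading X.grading (ih a ha) (comul_ιΓ_mem hX γ)
      | add a _ b _ ha hb => rw [map_add]; exact add_mem ha hb
  rw [grading] at hv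
  induction hv using Submodule.mul_induction_on' with
  | mem_mul_mem a ha b hb =>
    obtain ⟨h, rfl⟩ := ha
    rw [map_mul, AlgHom.toLinearMap_apply, comul_ιH, ← zero_add n]
    exact mul_mem_totalDegree X.grading X.grading (X.ιHH_mem _) (hpow n b hb)
  | add a _ b _ ha hb => rw [map_add]; exact add_mem ha hb

end FODC

/-- A degree preserving map into a graded tensor product commutes with the parity operators. -/
lemma map_parity_of_degree {Ω A B : Type*} [Ring Ω] [Algebra ℂ Ω] [Ring A] [Algebra ℂ A] [Ring B]
    [Algebra ℂ B] {𝒪 : ℕ → Submodule ℂ Ω} {𝒜 : ℕ → Submodule ℂ A} {ℬ : ℕ → Submodule ℂ B}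
    [GradedAlgebra 𝒪] [GradedAlgebra 𝒜] [GradedAlgebra ℬ] {f : Ω →ₗ[ℂ] 𝒜 ᵍ⊗[ℂ] ℬ}
    (hf : ∀ n, ∀ w ∈ 𝒪 n, f w ∈ totalDegree 𝒜 ℬ n) (v : Ω) :
    (GradedTensorProduct.of ℂ 𝒜 ℬ).symm (f (parity 𝒪 v)) =
      TensorProduct.map (parity 𝒜) (parity ℬ) ((GradedTensorProduct.of ℂ 𝒜 ℬ).symm (f v)) := by
  induction v using DirectSum.Decomposition.inductionOn 𝒪 with
  | zero => simp
  | add x y hx hy => simp only [map_add, hx, hy]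
  | homogeneous x =>
    rw [map_parity_of_mem_totalDegree _ _ (hf _ _ x.2), parity_of_mem 𝒪 x.2, map_smul, map_smul]

namespace FODC

variable (hX : X.IsBicovariant)

/-- Treating the coproduct as the coaction of `Γ^∧` on itself lets one argument prove both
coassociativity here and coassociativity of the coaction on `Ω`. -/
lemma isFormCoaction_comulₗ :
    IsFormCoaction X X.grading X.ιH.toLinearMap X.dH Coalgebra.comul (comulₗ hX) where
  one := by
    rw [comulₗ, LinearMap.comp_apply, AlgHom.toLinearMap_apply, map_one]; rfl
  zero_mul x v := by
    apply (GradedTensorProduct.of ℂ X.grading X.grading).injective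
    rw [← of_map_mul_of, of_comulₗ, of_comulₗ, AlgHom.toLinearMap_apply, map_mul, comul_ιH]
    rfl
  one_mul x v := by
    apply (GradedTensorProduct.of ℂ X.grading X.grading).injective
    have hd : X.dH = X.dEnv ∘ₗ X.ιH.toLinearMap := by ext h; exact (X.dEnv_ιH h).symm
    have := tensorD_of_map_mul_of X X.grading X.ιH.toLinearMap (d := X.dEnv) X.ιH_mem
      (Coalgebra.comul x) (comulₗ hX v)
    rw [← hd] at this
    rw [← this, of_comulₗ, of_comulₗ, map_mul, comul_dH]
    rfl
  parity v := map_parity_of_degree (fun _ _ => comul_mem hX) v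
  induction := Env.left_induction

lemma comulₗ_ιH (h : H) : comulₗ hX (X.ιH h) =
    TensorProduct.map X.ιH.toLinearMap X.ιH.toLinearMap (Coalgebra.comul h) := by
  rw [comulₗ, LinearMap.comp_apply, AlgHom.toLinearMap_apply, comul_ιH]; rfl

end FODC

section

variable {R Ω : Type*} [AddCommGroup R] [Module ℂ R] [Ring Ω] [Algebra ℂ Ω]
  {𝒜 : ℕ → Submodule ℂ Ω} [GradedAlgebra 𝒜] {ι dι : R →ₗ[ℂ] Ω} {c : R →ₗ[ℂ] R ⊗[ℂ] H}
  {δ : Ω →ₗ[ℂ] Ω ⊗[ℂ] X.Env}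

/-- Checked on generators: in `act₁` the counit kills the term with `dh` and leaves multiplication
by `dι(x)`. -/
lemma IsFormCoaction.counit (hδ : IsFormCoaction X 𝒜 ι dι c δ)
    (hc : ∀ x, TensorProduct.rid ℂ R ((Coalgebra.counit (R := ℂ)).lTensor R (c x)) = x) (w : Ω) :
    TensorProduct.rid ℂ Ω (X.counit.toLinearMap.lTensor Ω (δ w)) = w := by
  have h₀ : ∀ z t, TensorProduct.rid ℂ Ω (X.counit.toLinearMap.lTensor Ω (act₀ X ι z t)) =
      ι (TensorProduct.rid ℂ R ((Coalgebra.counit (R := ℂ)).lTensor R z)) *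
        TensorProduct.rid ℂ Ω (X.counit.toLinearMap.lTensor Ω t) := fun z t => by
    induction z with
    | zero => simp
    | add x y hx hy => simp only [map_add, LinearMap.add_apply, hx, hy, add_mul]
    | tmul p h =>
      induction t with
      | zero => simp
      | add x y hx hy => simp only [map_add, hx, hy, mul_add]
      | tmul a b => simp [FODC.counit_ιH, smul_smul, mul_comm]
  have h₁ : ∀ z t, TensorProduct.rid ℂ Ω (X.counit.toLinearMap.lTensor Ω (act₁ X 𝒜 ι dι z t)) =
      dι (TensorProduct.rid ℂ R ((Coalgebra.counit (R := ℂ)).lTensor R z)) *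
        TensorProduct.rid ℂ Ω (X.counit.toLinearMap.lTensor Ω t) := fun z t => by
    induction z with
    | zero => simp
    | add x y hx hy => simp only [map_add, LinearMap.add_apply, hx, hy, add_mul]
    | tmul p h =>
      induction t with
      | zero => simp
      | add x y hx hy => simp only [map_add, hx, hy, mul_add]
      | tmul a b => simp [FODC.counit_ιH, FODC.counit_dH, smul_smul, mul_comm]
  refine hδ.induction (fun w => TensorProduct.rid ℂ Ω (X.counit.toLinearMap.lTensor Ω (δ w)) = w)
    ?_ (fun v w hv hw => ?_) (fun x v hv => ?_) (fun x v hv => ?_) w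
  · simp [hδ.one]
  · simp only [map_add, hv, hw]
  · rw [hδ.zero_mul, h₀, hc, hv]
  · rw [hδ.one_mul, h₁, hc, hv]

end

namespace FODC

variable (hX : X.IsBicovariant)

/-- With the counit on the first leg it is the other term of `act₁` that survives; its parity
operator is harmless because the counit vanishes in positive degrees. -/
lemma lid_counit_comulₗ (w : X.Env) :
    TensorProduct.lid ℂ X.Env (X.counit.toLinearMap.rTensor X.Env (comulₗ hX w)) = w := by
  have h₀ : ∀ z t, TensorProduct.lid ℂ X.Env
      (X.counit.toLinearMap.rTensor X.Env (act₀ X X.ιH.toLinearMap z t)) =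
      X.ιH (TensorProduct.lid ℂ H ((Coalgebra.counit (R := ℂ)).rTensor H z)) *
        TensorProduct.lid ℂ X.Env (X.counit.toLinearMap.rTensor X.Env t) := fun z t => by
    induction z with
    | zero => simp
    | add x y hx hy => simp only [map_add, LinearMap.add_apply, hx, hy, add_mul]
    | tmul p h =>
      induction t with
      | zero => simp
      | add x y hx hy => simp only [map_add, hx, hy, mul_add]
      | tmul a b => simp [FODC.counit_ιH, smul_smul, mul_comm]
  have h₁ : ∀ z t, TensorProduct.lid ℂ X.Env
      (X.counit.toLinearMap.rTensor X.Env (act₁ X X.grading X.ιH.toLinearMap X.dH z t)) =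
      X.dH (TensorProduct.lid ℂ H ((Coalgebra.counit (R := ℂ)).rTensor H z)) *
        TensorProduct.lid ℂ X.Env (X.counit.toLinearMap.rTensor X.Env t) := fun z t => by
    induction z with
    | zero => simp
    | add x y hx hy => simp only [map_add, LinearMap.add_apply, hx, hy, add_mul]
    | tmul p h =>
      induction t with
      | zero => simp
      | add x y hx hy => simp only [map_add, hx, hy, mul_add]
      | tmul a b =>
        simp [FODC.counit_ιH, FODC.counit_dH, FODC.counit_parity, smul_smul, mul_comm]
  have hδ := isFormCoaction_comulₗ hX
  induction w using Env.left_induction with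
  | h1 => simp [hδ.one]
  | hadd v w hv hw => simp only [map_add, hv, hw]
  | hH x v hv =>
    have := hδ.zero_mul x v
    simp only [AlgHom.toLinearMap_apply] at this
    rw [this, h₀, hv, Coalgebra.rTensor_counit_comul]
    simp
  | hd x v hv =>
    rw [hδ.one_mul, h₁, hv, Coalgebra.rTensor_counit_comul]
    simp

/-- The coalgebra structure of `Γ^∧`. -/
abbrev coalgebraEnv : Coalgebra ℂ X.Env where
  comul := comulₗ hX
  counit := X.counit.toLinearMap
  coassoc := LinearMap.ext ((isFormCoaction_comulₗ hX).coassoc (isFormCoaction_comulₗ hX)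
    Coalgebra.coassoc_apply)
  rTensor_counit_comp_comul := by
    ext w
    apply (TensorProduct.lid ℂ X.Env).injective
    simpa using lid_counit_comulₗ hX w
  lTensor_counit_comp_comul := by
    ext w
    apply (TensorProduct.rid ℂ X.Env).injective
    simpa using (isFormCoaction_comulₗ hX).counit (fun x => by simp) w

/-! The antipode. -/

lemma antipode_one : antipode hX 1 = 1 := by
  simp [antipode]

lemma antipode_ιH_mul (g : H) (v : X.Env) :
    antipode hX (X.ιH g * v) = antipode hX v * X.ιH (HopfAlgebra.antipode ℂ g) := by
  simp only [antipode, LinearMap.comp_apply, AlgHom.toLinearMap_apply, map_mul,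
    LinearMap.applyₗ_apply_apply, Module.End.mul_apply, Env.lift_ιH, antiH_apply]

lemma antipode_dH_mul (g : H) (v : X.Env) : antipode hX (X.dH g * v) =
    parity X.grading (antipode hX v) * X.dH (HopfAlgebra.antipode ℂ g) := by
  simp only [antipode, LinearMap.comp_apply, AlgHom.toLinearMap_apply, map_mul,
    LinearMap.applyₗ_apply_apply, Module.End.mul_apply, Env.lift_dH, antiD_apply]

lemma antipode_parity (v : X.Env) :
    antipode hX (parity X.grading v) = parity X.grading (antipode hX v) := by
  induction v using Env.left_induction with
  | h1 => rw [parity_one, antipode_one, parity_one]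
  | hadd v w hv hw => simp only [map_add, hv, hw]
  | hH g v hv => rw [parity_mul, parity_ιH, antipode_ιH_mul, antipode_ιH_mul, parity_mul,
      parity_ιH, hv]
  | hd g v hv => rw [parity_mul, parity_dH, neg_mul, map_neg, antipode_dH_mul, antipode_dH_mul,
      parity_mul, parity_dH, hv, mul_neg]

/-- Since `S` reverses products, the contribution of a new left generator meets in the middle of
`S(v₁) v₂`. It is `S(x₁) x₂` for `x ∈ H` and `d(S(x₁) x₂)` for `dx`, hence `ε(x)` and `d(ε(x) 1) =
0`. -/
lemma mul_antipode_rTensor_comulₗ (v : X.Env) :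
    LinearMap.mul' ℂ X.Env ((antipode hX).rTensor X.Env (comulₗ hX v)) =
      algebraMap ℂ X.Env (X.counit v) := by
  have h₀ : ∀ z t, LinearMap.mul' ℂ X.Env ((antipode hX).rTensor X.Env
      (act₀ X X.ιH.toLinearMap z t)) = LinearMap.mul' ℂ X.Env (LinearMap.lTensor X.Env
        (LinearMap.mulLeft ℂ (X.ιH (LinearMap.mul' ℂ H ((HopfAlgebra.antipode ℂ).rTensor H z))))
        ((antipode hX).rTensor X.Env t)) := fun z t => by
    induction t with
    | zero => simp
    | add x y hx hy => simp only [map_add, hx, hy]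
    | tmul a b =>
      induction z with
      | zero => simp
      | add x y hx hy =>
        simp only [map_add, LinearMap.add_apply, hx, hy, LinearMap.rTensor_tmul,
          LinearMap.lTensor_tmul, LinearMap.mul'_apply, LinearMap.mulLeft_apply, add_mul, mul_add]
      | tmul p h => simp [antipode_ιH_mul, mul_assoc]
  have h₁ : ∀ z t, LinearMap.mul' ℂ X.Env ((antipode hX).rTensor X.Env
      (act₁ X X.grading X.ιH.toLinearMap X.dH z t)) = LinearMap.mul' ℂ X.Env (LinearMap.lTensor
        X.Env (LinearMap.mulLeft ℂ (X.dH (LinearMap.mul' ℂ H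
          ((HopfAlgebra.antipode ℂ).rTensor H z))))
        ((antipode hX).rTensor X.Env ((parity X.grading).rTensor X.Env t))) := fun z t => by
    induction t with
    | zero => simp
    | add x y hx hy => simp only [map_add, hx, hy]
    | tmul a b =>
      induction z with
      | zero => simp
      | add x y hx hy =>
        simp only [map_add, LinearMap.add_apply, hx, hy, LinearMap.rTensor_tmul,
          LinearMap.lTensor_tmul, LinearMap.mul'_apply, LinearMap.mulLeft_apply, add_mul, mul_add]
      | tmul p h =>
        simp [antipode_ιH_mul, antipode_dH_mul, antipode_parity, dH_mul, mul_assoc, mul_add,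
          add_mul, add_comm]
  have hδ := isFormCoaction_comulₗ hX
  induction v using Env.left_induction with
  | h1 => simp [hδ.one, antipode_one]
  | hadd v w hv hw => simp only [map_add, hv, hw]
  | hH x v hv =>
    have := hδ.zero_mul x v
    simp only [AlgHom.toLinearMap_apply] at this
    rw [this, h₀, HopfAlgebra.mul_antipode_rTensor_comul_apply, AlgHom.commutes, map_mul, counit_ιH,
      map_mul, ← hv]
    generalize (antipode hX).rTensor X.Env (comulₗ hX v) = t
    induction t with
    | zero => simp
    | add x y hx hy => simp only [map_add, hx, hy, mul_add]
    | tmul a b => simp [Algebra.algebraMap_eq_smul_one]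
  | hd x v hv =>
    rw [hδ.one_mul, h₁, HopfAlgebra.mul_antipode_rTensor_comul_apply, map_mul, counit_dH,
      Algebra.algebraMap_eq_smul_one, map_smul, dH_one]
    simp

/-- Here a new left generator surrounds `v₁ S(v₂)`, so the induction hypothesis is used first: the
inner part is a scalar, and what remains is `x₁ S(x₂)` or its differential. -/
lemma mul_antipode_lTensor_comulₗ (v : X.Env) :
    LinearMap.mul' ℂ X.Env ((antipode hX).lTensor X.Env (comulₗ hX v)) =
      algebraMap ℂ X.Env (X.counit v) := by
  have h₀ : ∀ z t, LinearMap.mul' ℂ X.Env ((antipode hX).lTensor X.Env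
      (act₀ X X.ιH.toLinearMap z t)) = LinearMap.mul' ℂ X.Env (TensorProduct.map X.ιH.toLinearMap
        (LinearMap.mulLeft ℂ (LinearMap.mul' ℂ X.Env ((antipode hX).lTensor X.Env t)) ∘ₗ
          X.ιH.toLinearMap ∘ₗ HopfAlgebra.antipode ℂ) z) := fun z t => by
    induction z with
    | zero => simp
    | add x y hx hy => simp only [map_add, LinearMap.add_apply, hx, hy]
    | tmul p h =>
      induction t with
      | zero => simp
      | add x y hx hy =>
        simp only [TensorProduct.map_tmul, LinearMap.mul'_apply, map_add, LinearMap.add_apply,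
          LinearMap.comp_apply, LinearMap.mulLeft_apply, add_mul, mul_add] at hx hy ⊢
        rw [hx, hy]
      | tmul a b => simp [antipode_ιH_mul, mul_assoc]
  have h₁ : ∀ z t, LinearMap.mul' ℂ X.Env ((antipode hX).lTensor X.Env
      (act₁ X X.grading X.ιH.toLinearMap X.dH z t)) = LinearMap.mul' ℂ X.Env (TensorProduct.map
        X.dH (LinearMap.mulLeft ℂ (LinearMap.mul' ℂ X.Env ((antipode hX).lTensor X.Env t)) ∘ₗ
          X.ιH.toLinearMap ∘ₗ HopfAlgebra.antipode ℂ) z) +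
        LinearMap.mul' ℂ X.Env (TensorProduct.map X.ιH.toLinearMap
        (LinearMap.mulLeft ℂ (parity X.grading
          (LinearMap.mul' ℂ X.Env ((antipode hX).lTensor X.Env t))) ∘ₗ
          X.dH ∘ₗ HopfAlgebra.antipode ℂ) z) := fun z t => by
    induction z with
    | zero => simp
    | add x y hx hy => simp only [map_add, LinearMap.add_apply, hx, hy]; abel
    | tmul p h =>
      induction t with
      | zero => simp
      | add x y hx hy =>
        simp only [TensorProduct.map_tmul, LinearMap.mul'_apply, map_add, LinearMap.add_apply,
          LinearMap.comp_apply, LinearMap.mulLeft_apply, add_mul, mul_add] at hx hy ⊢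
        rw [hx, hy]
        abel
      | tmul a b => simp [antipode_ιH_mul, antipode_dH_mul, mul_assoc, parity_mul]
  -- Once the inner product is a scalar `r`, it can be moved outside and the outer factors
  -- recombine; in `k₁` they do so by the Leibniz rule.
  have k₀ : ∀ (r : ℂ) z, LinearMap.mul' ℂ X.Env (TensorProduct.map X.ιH.toLinearMap
      (LinearMap.mulLeft ℂ (algebraMap ℂ X.Env r) ∘ₗ X.ιH.toLinearMap ∘ₗ HopfAlgebra.antipode ℂ)
        z) = r • X.ιH (LinearMap.mul' ℂ H ((HopfAlgebra.antipode ℂ).lTensor H z)) := fun r z => by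
    induction z with
    | zero => simp
    | add x y hx hy => simp only [map_add, hx, hy, smul_add]
    | tmul p h => simp [Algebra.algebraMap_eq_smul_one]
  have k₁ : ∀ (r : ℂ) z, LinearMap.mul' ℂ X.Env (TensorProduct.map X.dH
      (LinearMap.mulLeft ℂ (algebraMap ℂ X.Env r) ∘ₗ X.ιH.toLinearMap ∘ₗ HopfAlgebra.antipode ℂ)
        z) + LinearMap.mul' ℂ X.Env (TensorProduct.map X.ιH.toLinearMap
      (LinearMap.mulLeft ℂ (parity X.grading (algebraMap ℂ X.Env r)) ∘ₗ X.dH ∘ₗ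
        HopfAlgebra.antipode ℂ) z) =
      r • X.dH (LinearMap.mul' ℂ H ((HopfAlgebra.antipode ℂ).lTensor H z)) := fun r z => by
    induction z with
    | zero => simp
    | add x y hx hy => simp only [map_add, smul_add, ← hx, ← hy]; abel
    | tmul p h => simp [Algebra.algebraMap_eq_smul_one, parity_one, dH_mul, add_comm]
  have hδ := isFormCoaction_comulₗ hX
  induction v using Env.left_induction with
  | h1 => simp [hδ.one, antipode_one]
  | hadd v w hv hw => simp only [map_add, hv, hw]
  | hH x v hv =>
    have := hδ.zero_mul x v
    simp only [AlgHom.toLinearMap_apply] at this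
    rw [this, h₀, hv, map_mul, counit_ιH, k₀, HopfAlgebra.mul_antipode_lTensor_comul_apply,
      AlgHom.commutes, Algebra.smul_def, mul_comm, map_mul]
  | hd x v hv =>
    rw [hδ.one_mul, h₁, hv, k₁, HopfAlgebra.mul_antipode_lTensor_comul_apply, map_mul, counit_dH,
      Algebra.algebraMap_eq_smul_one, map_smul, dH_one]
    simp

end FODC

end

/-- The map `a ⊗ n ↦ a • L n`. -/
def smulLift {A M N : Type*} [Ring A] [Algebra ℂ A] [AddCommGroup M] [Module ℂ M] [Module A M]
    [IsScalarTower ℂ A M] [AddCommGroup N] [Module ℂ N] (L : N →ₗ[ℂ] M) : A ⊗[ℂ] N →ₗ[ℂ] M :=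
  TensorProduct.lift ((Algebra.lsmul ℂ ℂ M).toLinearMap.compl₂ L)

@[simp] lemma smulLift_tmul {A M N : Type*} [Ring A] [Algebra ℂ A] [AddCommGroup M] [Module ℂ M]
    [Module A M] [IsScalarTower ℂ A M] [AddCommGroup N] [Module ℂ N] (L : N →ₗ[ℂ] M) (a : A)
    (n : N) : smulLift L (a ⊗ₜ n) = a • L n := rfl

/-! ### Homogeneous components in the second tensor factor. -/

section Projection

variable {A B : Type*} [Ring A] [Algebra ℂ A] [Ring B] [Algebra ℂ B]
  (𝒜 : ℕ → Submodule ℂ A) (ℬ : ℕ → Submodule ℂ B) [GradedAlgebra 𝒜] [GradedAlgebra ℬ]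

lemma proj_of_mem {n : ℕ} {a : A} (ha : a ∈ 𝒜 n) : GradedAlgebra.proj 𝒜 n a = a := by
  rw [GradedAlgebra.proj_apply, DirectSum.decompose_of_mem_same 𝒜 ha]

lemma proj_of_mem_ne {m n : ℕ} {a : A} (ha : a ∈ 𝒜 m) (h : m ≠ n) :
    GradedAlgebra.proj 𝒜 n a = 0 := by
  rw [GradedAlgebra.proj_apply, DirectSum.decompose_of_mem_ne 𝒜 ha h]

lemma proj_mem (n : ℕ) (a : A) : GradedAlgebra.proj 𝒜 n a ∈ 𝒜 n := by
  rw [GradedAlgebra.proj_apply]; exact SetLike.coe_mem _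

lemma lTensor_proj_of_mem_totalDegree {m n : ℕ} (h : m < n) {x : 𝒜 ᵍ⊗[ℂ] ℬ}
    (hx : x ∈ totalDegree 𝒜 ℬ m) :
    (GradedAlgebra.proj ℬ n).lTensor A ((GradedTensorProduct.of ℂ 𝒜 ℬ).symm x) = 0 := by
  induction hx using Submodule.span_induction with
  | zero => simp
  | add x x' _ _ hx hx' => simp only [map_add, hx, hx', add_zero]
  | smul c x _ hx => simp only [map_smul, hx, smul_zero]
  | mem x hx =>
    obtain ⟨i, j, rfl, a, ha, b, hb, rfl⟩ := hx
    simp [GradedTensorProduct.tmul, proj_of_mem_ne ℬ hb (show j ≠ n by omega)]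

/-- The component with second degree `m` of an element of total degree `m` has first degree `0`.
Degrees are nonnegative, so the top component of a product can only come from the two top
components. -/
lemma lTensor_proj_mul {m n : ℕ} {x y : 𝒜 ᵍ⊗[ℂ] ℬ} (hx : x ∈ totalDegree 𝒜 ℬ m)
    (hy : y ∈ totalDegree 𝒜 ℬ n) :
    (GradedTensorProduct.of ℂ 𝒜 ℬ ((GradedAlgebra.proj ℬ m).lTensor A
      ((GradedTensorProduct.of ℂ 𝒜 ℬ).symm x))) * GradedTensorProduct.of ℂ 𝒜 ℬ
        ((GradedAlgebra.proj ℬ n).lTensor A ((GradedTensorProduct.of ℂ 𝒜 ℬ).symm y)) =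
    GradedTensorProduct.of ℂ 𝒜 ℬ ((GradedAlgebra.proj ℬ (m + n)).lTensor A
      ((GradedTensorProduct.of ℂ 𝒜 ℬ).symm (x * y))) := by
  induction hx using Submodule.span_induction with
  | zero => simp
  | add x x' _ _ hx hx' => simp only [map_add, add_mul, hx, hx']
  | smul c x _ hx => simp only [map_smul, smul_mul_assoc, hx]
  | mem x hx =>
    induction hy using Submodule.span_induction with
    | zero => simp
    | add x x' _ _ hx hx' => simp only [map_add, mul_add, hx, hx']
    | smul c x _ hx => simp only [map_smul, mul_smul_comm, hx]
    | mem y hy =>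
      obtain ⟨i, j, rfl, a, ha, b, hb, rfl⟩ := hx
      obtain ⟨k, l, rfl, a', ha', b', hb', rfl⟩ := hy
      have key : ∀ (n : ℕ) (u : A) (v : B), GradedTensorProduct.of ℂ 𝒜 ℬ
          ((GradedAlgebra.proj ℬ n).lTensor A ((GradedTensorProduct.of ℂ 𝒜 ℬ).symm
            (u ᵍ⊗ₜ[ℂ] v))) = (u ᵍ⊗ₜ[ℂ] GradedAlgebra.proj ℬ n v : 𝒜 ᵍ⊗[ℂ] ℬ) := fun _ _ _ => rfl
      rw [key, key, tmul_mul_tmul_of_mem 𝒜 ℬ hb ha', map_smul, map_smul, map_smul, key,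
        tmul_mul_tmul_of_mem 𝒜 ℬ (j := j) _ ha']
      · by_cases hj : j = i + j
        · by_cases hl : l = k + l
          · rw [← hj, ← hl, proj_of_mem ℬ hb, proj_of_mem ℬ hb',
              proj_of_mem ℬ (SetLike.mul_mem_graded hb hb')]
          · rw [proj_of_mem_ne ℬ hb' hl,
              proj_of_mem_ne ℬ (SetLike.mul_mem_graded hb hb') (by omega), mul_zero]
        · rw [proj_of_mem_ne ℬ hb hj,
            proj_of_mem_ne ℬ (SetLike.mul_mem_graded hb hb') (by omega), zero_mul]
      · by_cases hj : j = i + j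
        · rw [← hj, proj_of_mem ℬ hb]; exact hb
        · rw [proj_of_mem_ne ℬ hb hj]; exact zero_mem _

lemma tmul_mul_tmul_of_mem_zero {a' : A} (ha' : a' ∈ 𝒜 0) (a : A) (b b' : B) :
    (a ᵍ⊗ₜ[ℂ] b * a' ᵍ⊗ₜ[ℂ] b' : 𝒜 ᵍ⊗[ℂ] ℬ) = (a * a') ᵍ⊗ₜ[ℂ] (b * b') := by
  induction b using DirectSum.Decomposition.inductionOn ℬ with
  | zero => rw [gtmul_zero, zero_mul, zero_mul, gtmul_zero]
  | add x y hx hy => rw [gtmul_add, add_mul, hx, hy, add_mul, gtmul_add]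
  | homogeneous b =>
    rw [tmul_mul_tmul_of_mem 𝒜 ℬ b.2 ha']
    simp

end Projection

/-! ### The projection of `Γ^∧` onto its degree zero part. -/

namespace FODC

section

variable {H Γ : Type*} [Ring H] [Algebra ℂ H] [AddCommGroup Γ] [Module ℂ Γ]
    [Module H Γ] [Module Hᵐᵒᵖ Γ] [SMulCommClass H Hᵐᵒᵖ Γ]
    [IsScalarTower ℂ H Γ] [IsScalarTower ℂ Hᵐᵒᵖ Γ] (X : FODC H Γ)

/-- The projection `Γ^∧ → H` that vanishes in positive degrees. -/
def toH : X.Env →ₐ[ℂ] H :=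
  Env.lift (φ := AlgHom.id ℂ H) (δ := 0) (X := X)
    ⟨by simp, fun t _ => by simp, fun t _ => by simp⟩

lemma toH_ιH (h : H) : X.toH (X.ιH h) = h := Env.lift_ιH _ h

lemma toH_dH (h : H) : X.toH (X.dH h) = 0 := Env.lift_dH _ h

lemma toH_ιΓ (γ : Γ) : X.toH (X.ιΓ γ) = 0 := by
  obtain ⟨t, rfl⟩ := X.gdh_surjective γ
  rw [ιΓ_gdh]
  induction t with
  | zero => simp
  | add x y hx hy => simp only [map_add, hx, hy, add_zero]
  | tmul a b => simp [toH_dH]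

lemma toH_of_mem {n : ℕ} (hn : n ≠ 0) {v : X.Env} (hv : v ∈ X.grading n) : X.toH v = 0 := by
  obtain ⟨n, rfl⟩ := Nat.exists_eq_succ_of_ne_zero hn
  rw [grading, pow_succ, ← mul_assoc] at hv
  induction hv using Submodule.mul_induction_on' with
  | mem_mul_mem a ha b hb =>
    obtain ⟨γ, rfl⟩ := hb
    rw [map_mul, toH_ιΓ, mul_zero]
  | add a _ b _ ha hb => rw [map_add, ha, hb, add_zero]

lemma exists_ιH_eq {v : X.Env} (hv : v ∈ X.grading 0) : ∃ h, X.ιH h = v := by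
  simpa [grading] using hv

lemma ιH_toH (v : X.Env) : X.ιH (X.toH v) = GradedAlgebra.proj X.grading 0 v := by
  induction v using DirectSum.Decomposition.inductionOn X.grading with
  | zero => simp
  | add x y hx hy => simp only [map_add, hx, hy]
  | @homogeneous n v =>
    by_cases hn : n = 0
    · subst hn
      rw [proj_of_mem X.grading v.2]
      obtain ⟨h, hh⟩ := X.exists_ιH_eq v.2
      rw [← hh, toH_ιH]
    · rw [proj_of_mem_ne X.grading v.2 hn, X.toH_of_mem hn v.2, map_zero]

end

end FODC

/-! ### The coaction on `Ω` and the top components of its values. -/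

section Calculus

variable {H P Γ Ω : Type*} [Ring H] [HopfAlgebra ℂ H] [StarRing H] [StarModule ℂ H]
    [Ring P] [Algebra ℂ P] [StarRing P] [StarModule ℂ P]
    [AddCommGroup Γ] [Module ℂ Γ] [Module H Γ] [Module Hᵐᵒᵖ Γ] [SMulCommClass H Hᵐᵒᵖ Γ]
    [IsScalarTower ℂ H Γ] [IsScalarTower ℂ Hᵐᵒᵖ Γ] [Ring Ω] [Algebra ℂ Ω]
    {ζ : QPBundle H P} {X : FODC H Γ} {𝒜 : ℕ → Submodule ℂ Ω} [GradedAlgebra 𝒜]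
    (C : Calculus ζ X 𝒜)

namespace Calculus

lemma bicov (C : Calculus ζ X 𝒜) : X.IsBicovariant := C.isBicovariantStar.toIsBicovariant

lemma of_coactₗ (w : Ω) : GradedTensorProduct.of ℂ 𝒜 X.grading (C.coactₗ w) = C.coact w := rfl

lemma ι_mem (x : P) : C.ι x ∈ 𝒜 0 := C.range_ι ▸ ⟨x, rfl⟩

lemma isFormCoaction_coactₗ : IsFormCoaction X 𝒜 C.ι.toLinearMap (C.d ∘ₗ C.ι.toLinearMap)
    ζ.coact.toAlgHom.toLinearMap C.coactₗ where
  one := by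
    rw [coactₗ, LinearMap.comp_apply, AlgHom.toLinearMap_apply, map_one]; rfl
  zero_mul x v := by
    apply (GradedTensorProduct.of ℂ 𝒜 X.grading).injective
    rw [← of_map_mul_of, of_coactₗ, of_coactₗ, AlgHom.toLinearMap_apply, map_mul, C.coact_ι]
    rfl
  one_mul x v := by
    apply (GradedTensorProduct.of ℂ 𝒜 X.grading).injective
    have := tensorD_of_map_mul_of X 𝒜 C.ι.toLinearMap (d := C.d) C.ι_mem (ζ.coact x) (C.coactₗ v)
    rw [of_coactₗ, LinearMap.comp_apply, AlgHom.toLinearMap_apply, map_mul, C.coact_d, C.coact_ι]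
    exact this
  parity v := map_parity_of_degree (f := C.coact.toLinearMap) C.coact_degree v
  induction p h1 hadd hι hd v := by
    suffices h : ∀ x v, p v → p (x * v) by simpa using h v 1 h1
    intro x
    have hx : x ∈ Algebra.adjoin ℂ (Set.range C.ι ∪ Set.range (fun x => C.d (C.ι x))) :=
      C.generated ▸ Algebra.mem_top
    induction hx using Algebra.adjoin_induction with
    | mem x hx =>
      rcases hx with ⟨y, rfl⟩ | ⟨y, rfl⟩
      · exact hι y
      · exact hd y
    | algebraMap r => rw [← AlgHom.commutes C.ι]; exact hι _
    | add x y _ _ hx hy => exact fun v hv => by rw [add_mul]; exact hadd _ _ (hx v hv) (hy v hv)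
    | mul x y _ _ hx hy => exact fun v hv => by rw [mul_assoc]; exact hx _ (hy v hv)

lemma coassoc (w : Ω) : TensorProduct.assoc ℂ Ω X.Env X.Env (C.coactₗ.rTensor X.Env (C.coactₗ w)) =
    C.comulₗ.lTensor Ω (C.coactₗ w) :=
  C.isFormCoaction_coactₗ.coassoc (FODC.isFormCoaction_comulₗ C.bicov) ζ.coassoc w

lemma counit (w : Ω) :
    TensorProduct.rid ℂ Ω (X.counit.toLinearMap.lTensor Ω (C.coactₗ w)) = w :=
  C.isFormCoaction_coactₗ.counit ζ.counit w

lemma coactₗ_ι (x : P) : C.coactₗ (C.ι x) =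
    TensorProduct.map C.ι.toLinearMap X.ιH.toLinearMap (ζ.coact x) :=
  (GradedTensorProduct.of ℂ 𝒜 X.grading).injective (C.coact_ι x)

/-- The coaction of `Γ^∧` composed with the projection onto the `k`-th degree of `Γ^∧`. -/
def coactDeg (k : ℕ) : Ω →ₗ[ℂ] Ω ⊗[ℂ] X.Env :=
  (GradedAlgebra.proj X.grading k).lTensor Ω ∘ₗ C.coactₗ

lemma coactDeg_of_mem {m n : ℕ} (h : m < n) {w : Ω} (hw : w ∈ 𝒜 m) : C.coactDeg n w = 0 :=
  lTensor_proj_of_mem_totalDegree 𝒜 X.grading h (C.coact_degree m w hw)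

lemma coactDeg_mul {m n : ℕ} {v w : Ω} (hv : v ∈ 𝒜 m) (hw : w ∈ 𝒜 n) :
    GradedTensorProduct.of ℂ 𝒜 X.grading (C.coactDeg m v) *
      GradedTensorProduct.of ℂ 𝒜 X.grading (C.coactDeg n w) =
        GradedTensorProduct.of ℂ 𝒜 X.grading (C.coactDeg (m + n) (v * w)) := by
  have := lTensor_proj_mul 𝒜 X.grading (C.coact_degree m v hv) (C.coact_degree n w hw)
  rw [← map_mul C.coact] at this
  exact this

variable (𝒜) in
/-- The span of the tensors `p ⊗ b` with `p` of degree zero and `b` of degree `k`. -/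
def topSpace (k : ℕ) : Submodule ℂ (Ω ⊗[ℂ] Ω) :=
  Submodule.span ℂ {z | ∃ p ∈ 𝒜 0, ∃ b ∈ 𝒜 k, z = p ⊗ₜ b}

/-- The elements `ϑ` of `Γ^∧` such that `1 ⊗ ϑ` is the degree `k` part of some
`∑ (p ⊗ 1) Δ(b)` with `p` of degree zero and `b` of degree `k`. -/
def reached (k : ℕ) : Submodule ℂ X.Env :=
  ((topSpace 𝒜 k).map (smulLift (C.coactDeg k))).comap (TensorProduct.mk ℂ Ω X.Env 1)

/-- If `1 ⊗ η = ∑ p' Δ_k(b')` and `1 ⊗ ϑ = ∑ p Δ_l(b)`, their product is `∑ p p' Δ_{k+l}(b' b)`: `1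
⊗ η` commutes with `p ⊗ 1` because `p` has degree zero, and top components are multiplicative. -/
lemma reached_mul (k l : ℕ) : C.reached k * C.reached l ≤ C.reached (k + l) := by
  rw [Submodule.mul_le]
  rintro η ⟨s', hs', hη⟩ ϑ ⟨s, hs, hϑ⟩
  have key : ∀ p ∈ 𝒜 0, ∀ b ∈ 𝒜 l, ∀ s' ∈ topSpace 𝒜 k,
      ∃ r ∈ topSpace 𝒜 (k + l), GradedTensorProduct.of ℂ 𝒜 X.grading
        (smulLift (C.coactDeg (k + l)) r) = (p ᵍ⊗ₜ[ℂ] 1 : 𝒜 ᵍ⊗[ℂ] X.grading) *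
          (GradedTensorProduct.of ℂ 𝒜 X.grading (smulLift (C.coactDeg k) s') *
            GradedTensorProduct.of ℂ 𝒜 X.grading (C.coactDeg l b)) := by
    intro p hp b hb s' hs'
    induction hs' using Submodule.span_induction with
    | zero => exact ⟨0, zero_mem _, by simp⟩
    | add x y _ _ hx hy =>
      obtain ⟨r, hr, h⟩ := hx
      obtain ⟨r', hr', h'⟩ := hy
      exact ⟨r + r', add_mem hr hr', by simp only [map_add, mul_add, add_mul, h, h']⟩
    | smul c x _ hx =>
      obtain ⟨r, hr, h⟩ := hx
      exact ⟨c • r, Submodule.smul_mem _ _ hr, by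
        simp only [map_smul, mul_smul_comm, smul_mul_assoc, h]⟩
    | mem x hx =>
      obtain ⟨p', hp', b', hb', rfl⟩ := hx
      refine ⟨(p * p') ⊗ₜ (b' * b), Submodule.subset_span ⟨_, ?_, _,
        SetLike.mul_mem_graded hb' hb, rfl⟩, ?_⟩
      · simpa using SetLike.mul_mem_graded hp hp'
      · rw [smulLift_tmul, smulLift_tmul, ← tmul_one_mul_of 𝒜 X.grading p', mul_assoc,
          C.coactDeg_mul hb' hb, tmul_one_mul_of, tmul_one_mul_of, smul_smul]
  have main : ∀ s ∈ topSpace 𝒜 l, ∃ r ∈ topSpace 𝒜 (k + l), GradedTensorProduct.of ℂ 𝒜 X.grading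
        (smulLift (C.coactDeg (k + l)) r) = (1 ᵍ⊗ₜ[ℂ] η : 𝒜 ᵍ⊗[ℂ] X.grading) *
          GradedTensorProduct.of ℂ 𝒜 X.grading (smulLift (C.coactDeg l) s) := by
    intro s hs
    induction hs using Submodule.span_induction with
    | zero => exact ⟨0, zero_mem _, by simp⟩
    | add x y _ _ hx hy =>
      obtain ⟨r, hr, h⟩ := hx
      obtain ⟨r', hr', h'⟩ := hy
      exact ⟨r + r', add_mem hr hr', by simp only [map_add, mul_add, h, h']⟩
    | smul c x _ hx =>
      obtain ⟨r, hr, h⟩ := hx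
      exact ⟨c • r, Submodule.smul_mem _ _ hr, by simp only [map_smul, mul_smul_comm, h]⟩
    | mem x hx =>
      obtain ⟨p, hp, b, hb, rfl⟩ := hx
      obtain ⟨r, hr, h⟩ := key p hp b hb s' hs'
      refine ⟨r, hr, h.trans ?_⟩
      have hcomm : (1 ᵍ⊗ₜ[ℂ] η : 𝒜 ᵍ⊗[ℂ] X.grading) * p ᵍ⊗ₜ[ℂ] 1 =
          p ᵍ⊗ₜ[ℂ] 1 * 1 ᵍ⊗ₜ[ℂ] η := by
        rw [tmul_mul_tmul_zero 𝒜 X.grading (SetLike.GradedOne.one_mem (A := X.grading)),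
          tmul_mul_tmul_of_mem_zero 𝒜 X.grading hp, one_mul, mul_one, one_mul, mul_one]
      rw [smulLift_tmul, ← tmul_one_mul_of, ← mul_assoc _ (p ᵍ⊗ₜ[ℂ] 1), hcomm, hη]
      simp only [mul_assoc]
      rfl
  obtain ⟨r, hr, h⟩ := main s hs
  refine ⟨r, hr, (GradedTensorProduct.of ℂ 𝒜 X.grading).injective (h.trans ?_)⟩
  rw [hϑ]
  refine (tmul_mul_tmul_of_mem_zero 𝒜 X.grading (SetLike.GradedOne.one_mem (A := 𝒜)) 1 η ϑ).trans ?_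
  rw [mul_one]
  rfl

lemma smulLift_map_ι (k : ℕ) {f : P →ₗ[ℂ] Ω} {g : H →ₗ[ℂ] X.Env}
    (hf : ∀ y, C.coactDeg k (f y) = TensorProduct.map C.ι.toLinearMap g (ζ.coact y))
    (z : P ⊗[ℂ] P) : smulLift (C.coactDeg k) (TensorProduct.map C.ι.toLinearMap f z) =
      TensorProduct.map C.ι.toLinearMap g
        (TensorProduct.lift (LinearMap.mk₂ ℂ (fun x y : P => (x ⊗ₜ[ℂ] (1 : H)) * ζ.coact y)
      (fun _ _ _ => by rw [TensorProduct.add_tmul, add_mul])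
      (fun _ _ _ => by rw [← TensorProduct.smul_tmul', smul_mul_assoc])
      (fun _ _ _ => by rw [map_add, mul_add])
      (fun _ _ _ => by rw [map_smul, mul_smul_comm])) z) := by
  induction z with
  | zero => simp
  | add x y hx hy => simp only [map_add, hx, hy]
  | tmul x y =>
    simp only [TensorProduct.map_tmul, smulLift_tmul, hf, TensorProduct.lift.tmul,
      LinearMap.mk₂_apply]
    generalize ζ.coact y = q
    induction q with
    | zero => simp
    | add x y hx hy => simp only [map_add, smul_add, mul_add, hx, hy]
    | tmul p h => simp [TensorProduct.smul_tmul']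

/-- This is where freeness of the bundle enters: a preimage of `1 ⊗ h` under `x ⊗ y ↦ (x ⊗ 1)
Δ_P(y)` is transported to forms by `ι ⊗ f`. -/
lemma mem_reached {k : ℕ} {f : P →ₗ[ℂ] Ω} {g : H →ₗ[ℂ] X.Env}
    (hf : ∀ y, C.coactDeg k (f y) = TensorProduct.map C.ι.toLinearMap g (ζ.coact y))
    (hfk : ∀ y, f y ∈ 𝒜 k) (h : H) : g h ∈ C.reached k := by
  obtain ⟨z, hz⟩ := ζ.surjective (1 ⊗ₜ h)
  refine ⟨TensorProduct.map C.ι.toLinearMap f z, ?_, ?_⟩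
  · clear hz
    induction z with
    | zero => rw [map_zero]; exact zero_mem _
    | add x y hx hy => rw [map_add]; exact add_mem hx hy
    | tmul x y => exact Submodule.subset_span ⟨_, C.ι_mem x, _, hfk y, rfl⟩
  · rw [C.smulLift_map_ι k hf, hz]
    simp

lemma ιH_mem_reached (h : H) : X.ιH h ∈ C.reached 0 := by
  refine C.mem_reached (f := C.ι.toLinearMap) (g := X.ιH.toLinearMap) (fun y => ?_) C.ι_mem h
  rw [coactDeg, LinearMap.comp_apply, AlgHom.toLinearMap_apply, coactₗ_ι]
  generalize ζ.coact y = q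
  induction q with
  | zero => simp
  | add x y hx hy => simp only [map_add, hx, hy]
  | tmul p h => simp [← X.ιH_toH, X.toH_ιH]

lemma dH_mem_reached (h : H) : X.dH h ∈ C.reached 1 := by
  refine C.mem_reached (f := C.d ∘ₗ C.ι.toLinearMap) (fun y => ?_)
    (fun y => by simpa using C.isDifferential.degree 0 _ (C.ι_mem y)) h
  have h1 : C.coactₗ (C.d (C.ι y)) = (GradedTensorProduct.of ℂ 𝒜 X.grading).symm
      (tensorD 𝒜 X.grading C.d X.dEnv (GradedTensorProduct.of ℂ 𝒜 X.grading
        (TensorProduct.map C.ι.toLinearMap X.ιH.toLinearMap (ζ.coact y)))) := by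
    rw [← C.coact_ι, ← C.coact_d]; rfl
  rw [coactDeg, LinearMap.comp_apply, LinearMap.comp_apply, AlgHom.toLinearMap_apply, h1]
  generalize ζ.coact y = q
  induction q with
  | zero => simp
  | add x y hx hy => simp only [map_add, hx, hy]
  | tmul p h =>
    have hp : parity 𝒜 (C.ι p) = C.ι p := by simpa using parity_of_mem 𝒜 (C.ι_mem p)
    simp [tensorD, hp, X.dEnv_ιH, proj_of_mem X.grading (X.dH_mem h),
      proj_of_mem_ne X.grading (X.ιH_mem h) zero_ne_one]

/-- `H` is reached in degree zero and `dH` in degree one, and the reached elements are closed under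
products; together these generate all degrees. -/
lemma grading_le_reached (k : ℕ) : X.grading k ≤ C.reached k := by
  have hΓ : LinearMap.range X.ιΓ ≤ C.reached 1 := by
    rintro _ ⟨γ, rfl⟩
    obtain ⟨t, rfl⟩ := X.gdh_surjective γ
    rw [FODC.ιΓ_gdh]
    induction t with
    | zero => rw [map_zero, map_zero]; exact zero_mem _
    | add x y hx hy => rw [map_add, map_add]; exact add_mem hx hy
    | tmul a b =>
      have := C.reached_mul 0 1 (Submodule.mul_mem_mul (C.ιH_mem_reached a) (C.dH_mem_reached b))
      simpa using this
  have hpow : ∀ n, LinearMap.range X.ιΓ ^ n ≤ C.reached n := by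
    intro n
    induction n with
    | zero =>
      rw [pow_zero, Submodule.one_le, ← map_one X.ιH]
      exact C.ιH_mem_reached 1
    | succ n ih =>
      rw [pow_succ]
      exact (mul_le_mul' ih hΓ).trans (C.reached_mul n 1)
  rw [FODC.grading]
  refine (mul_le_mul' (?_ : _ ≤ C.reached 0) (hpow k)).trans
    ((C.reached_mul 0 k).trans (by rw [zero_add]))
  rintro _ ⟨h, rfl⟩
  exact C.ιH_mem_reached h

lemma exists_topSpace {k : ℕ} {ϑ : X.Env} (hϑ : ϑ ∈ X.grading k) :
    ∃ s ∈ topSpace 𝒜 k, smulLift (C.coactDeg k) s = 1 ⊗ₜ ϑ :=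
  C.grading_le_reached k hϑ

end Calculus

end Calculus

/-! ### Compatibilities of left linear extensions. -/

lemma smulLift_smul {A M N : Type*} [Ring A] [Algebra ℂ A] [AddCommGroup M] [Module ℂ M]
    [Module A M] [IsScalarTower ℂ A M] [AddCommGroup N] [Module ℂ N] (L : N →ₗ[ℂ] M) (a : A)
    (t : A ⊗[ℂ] N) : smulLift L (a • t) = a • smulLift L t := by
  induction t with
  | zero => simp
  | add x y hx hy => simp only [smul_add, map_add, hx, hy]
  | tmul b n => simp [TensorProduct.smul_tmul', mul_smul]

lemma rTensor_smul {A B N : Type*} [Ring A] [Algebra ℂ A] [Ring B] [Algebra ℂ B] [AddCommGroup N]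
    [Module ℂ N] (f : A →ₐ[ℂ] B) (a : A) (t : A ⊗[ℂ] N) :
    f.toLinearMap.rTensor N (a • t) = f a • f.toLinearMap.rTensor N t := by
  induction t with
  | zero => simp
  | add x y hx hy => simp only [smul_add, map_add, hx, hy]
  | tmul b n => simp [TensorProduct.smul_tmul']

lemma smulLift_lTensor {A N N' : Type*} [Ring A] [Algebra ℂ A] [AddCommGroup N] [Module ℂ N]
    [AddCommGroup N'] [Module ℂ N'] {M : Type*} [AddCommGroup M] [Module ℂ M]
    (L : M →ₗ[ℂ] A ⊗[ℂ] N) (p : N →ₗ[ℂ] N') (z : A ⊗[ℂ] M) :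
    smulLift (p.lTensor A ∘ₗ L) z = p.lTensor A (smulLift L z) := by
  induction z with
  | zero => simp
  | add x y hx hy => simp only [map_add, hx, hy]
  | tmul a m =>
    simp only [smulLift_tmul, LinearMap.comp_apply]
    generalize L m = t
    induction t with
    | zero => simp
    | add x y hx hy => simp only [smul_add, map_add, hx, hy]
    | tmul b n => simp [TensorProduct.smul_tmul']

lemma exists_sum_lTensor_proj {A B : Type*} [Ring A] [Algebra ℂ A] [Ring B] [Algebra ℂ B]
    (ℬ : ℕ → Submodule ℂ B) [GradedAlgebra ℬ] (t : A ⊗[ℂ] B) :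
    ∃ N, ∀ M ≥ N, t = ∑ n ∈ Finset.range M, (GradedAlgebra.proj ℬ n).lTensor A t := by
  induction t with
  | zero => exact ⟨0, by simp⟩
  | add x y hx hy =>
    obtain ⟨N, hN⟩ := hx
    obtain ⟨N', hN'⟩ := hy
    refine ⟨max N N', fun M hM => ?_⟩
    simp only [map_add, Finset.sum_add_distrib]
    rw [← hN M (le_trans (le_max_left _ _) hM), ← hN' M (le_trans (le_max_right _ _) hM)]
  | tmul a b =>
    induction b using DirectSum.Decomposition.inductionOn ℬ with
    | zero => exact ⟨0, by simp⟩
    | add x y hx hy =>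
      obtain ⟨N, hN⟩ := hx
      obtain ⟨N', hN'⟩ := hy
      refine ⟨max N N', fun M hM => ?_⟩
      simp only [TensorProduct.tmul_add, map_add, Finset.sum_add_distrib]
      rw [← hN M (le_trans (le_max_left _ _) hM), ← hN' M (le_trans (le_max_right _ _) hM)]
    | @homogeneous i b =>
      refine ⟨i + 1, fun M hM => ?_⟩
      rw [Finset.sum_eq_single i]
      · simp [proj_of_mem ℬ b.2]
      · intro n _ hn
        simp [proj_of_mem_ne ℬ b.2 hn.symm]
      · intro h
        exact absurd (Finset.mem_range.2 hM) h

/-! ### The left coaction of `H` on `Γ^∧`. -/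

section Hopf

namespace FODC

variable {H Γ : Type*} [Ring H] [HopfAlgebra ℂ H] [AddCommGroup Γ] [Module ℂ Γ]
    [Module H Γ] [Module Hᵐᵒᵖ Γ] [SMulCommClass H Hᵐᵒᵖ Γ]
    [IsScalarTower ℂ H Γ] [IsScalarTower ℂ Hᵐᵒᵖ Γ] {X : FODC H Γ} (hX : X.IsBicovariant)

lemma counit_toH (v : X.Env) : Coalgebra.counit (R := ℂ) (X.toH v) = X.counit v := by
  have : (Bialgebra.counitAlgHom ℂ H).comp X.toH = X.counit :=
    Env.algHom_ext X (fun h => by simp [toH_ιH, counit_ιH]) (fun h => by simp [toH_dH, counit_dH])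
  exact DFunLike.congr_fun this v

/-- In positive total degree some leg has positive degree, so both sides vanish; in degree zero the
coproduct is that of `H`. -/
lemma comul_toH (v : X.Env) : Coalgebra.comul (R := ℂ) (X.toH v) =
    TensorProduct.map X.toH.toLinearMap X.toH.toLinearMap (comulₗ hX v) := by
  have h0 : ∀ n ≠ 0, ∀ x ∈ totalDegree X.grading X.grading n, TensorProduct.map X.toH.toLinearMap
      X.toH.toLinearMap ((GradedTensorProduct.of ℂ X.grading X.grading).symm x) = 0 := by
    intro n hn x hx
    induction hx using Submodule.span_induction with
    | zero => simp
    | add x x' _ _ hx hx' => simp only [map_add, hx, hx', add_zero]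
    | smul c x _ hx => simp only [map_smul, hx, smul_zero]
    | mem x hx =>
      obtain ⟨i, j, rfl, a, ha, b, hb, rfl⟩ := hx
      by_cases hi : i = 0
      · simp [GradedTensorProduct.tmul, X.toH_of_mem (show j ≠ 0 by omega) hb]
      · simp [GradedTensorProduct.tmul, X.toH_of_mem hi ha]
  induction v using DirectSum.Decomposition.inductionOn X.grading with
  | zero => simp
  | add x y hx hy => simp only [map_add, hx, hy]
  | @homogeneous n v =>
    by_cases hn : n = 0
    · subst hn
      obtain ⟨h, hh⟩ := X.exists_ιH_eq v.2
      rw [← hh, toH_ιH, comulₗ_ιH]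
      generalize Coalgebra.comul (R := ℂ) h = q
      induction q with
      | zero => simp
      | add x y hx hy => simp only [map_add, ← hx, ← hy]
      | tmul a b => simp [toH_ιH]
    · rw [X.toH_of_mem hn v.2, map_zero]
      exact (h0 n hn _ (comul_mem hX v.2)).symm

/-- The left coaction of `H` on `Γ^∧`. -/
def leftCoact : X.Env →ₗ[ℂ] H ⊗[ℂ] X.Env := X.toH.toLinearMap.rTensor X.Env ∘ₗ comulₗ hX

lemma leftCoact_coassoc (v : X.Env) : TensorProduct.assoc ℂ H H X.Env
    ((Coalgebra.comul (R := ℂ)).rTensor X.Env (leftCoact hX v)) =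
      (leftCoact hX).lTensor H (leftCoact hX v) := by
  have h := congrArg (TensorProduct.map X.toH.toLinearMap (X.toH.toLinearMap.rTensor X.Env))
    ((isFormCoaction_comulₗ hX).coassoc (isFormCoaction_comulₗ hX) Coalgebra.coassoc_apply v)
  have h1 : ∀ t : X.Env ⊗[ℂ] X.Env, TensorProduct.map X.toH.toLinearMap
      (X.toH.toLinearMap.rTensor X.Env) ((comulₗ hX).lTensor X.Env t) =
        (leftCoact hX).lTensor H (X.toH.toLinearMap.rTensor X.Env t) := fun t => by
    induction t with
    | zero => simp
    | add x y hx hy => simp only [map_add, hx, hy]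
    | tmul a b => simp [leftCoact]
  have h2 : ∀ t : X.Env ⊗[ℂ] X.Env, TensorProduct.map X.toH.toLinearMap
      (X.toH.toLinearMap.rTensor X.Env) (TensorProduct.assoc ℂ X.Env X.Env X.Env
        ((comulₗ hX).rTensor X.Env t)) = TensorProduct.assoc ℂ H H X.Env
    ((Coalgebra.comul (R := ℂ)).rTensor X.Env (X.toH.toLinearMap.rTensor X.Env t)) := fun t => by
    induction t with
    | zero => simp
    | add x y hx hy => simp only [map_add, hx, hy]
    | tmul a b =>
      simp only [LinearMap.rTensor_tmul, AlgHom.toLinearMap_apply, comul_toH hX]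
      generalize comulₗ hX a = q
      induction q with
      | zero => simp
      | add x y hx hy => simp only [map_add, TensorProduct.add_tmul, hx, hy]
      | tmul c e => simp
  rw [h1, h2] at h
  exact h

lemma lid_counit_leftCoact (v : X.Env) : TensorProduct.lid ℂ X.Env
    ((Coalgebra.counit (R := ℂ)).rTensor X.Env (leftCoact hX v)) = v := by
  have h : (Coalgebra.counit (R := ℂ)) ∘ₗ X.toH.toLinearMap = X.counit.toLinearMap :=
    LinearMap.ext counit_toH
  rw [leftCoact, LinearMap.comp_apply, ← LinearMap.comp_apply, ← LinearMap.rTensor_comp, h,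
    lid_counit_comulₗ hX]

/-- Projecting the first leg of the coproduct to degree zero leaves the whole degree on the second
leg. -/
lemma leftCoact_proj (k : ℕ) (v : X.Env) : leftCoact hX (GradedAlgebra.proj X.grading k v) =
    (GradedAlgebra.proj X.grading k).lTensor H (leftCoact hX v) := by
  have h0 : ∀ n, ∀ x ∈ totalDegree X.grading X.grading n,
      (GradedAlgebra.proj X.grading k).lTensor H (X.toH.toLinearMap.rTensor X.Env
        ((GradedTensorProduct.of ℂ X.grading X.grading).symm x)) =
      if n = k then X.toH.toLinearMap.rTensor X.Env
        ((GradedTensorProduct.of ℂ X.grading X.grading).symm x) else 0 := by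
    intro n x hx
    induction hx using Submodule.span_induction with
    | zero => simp
    | add x x' _ _ hx hx' => simp only [map_add, hx, hx']; split_ifs <;> simp
    | smul c x _ hx => simp only [map_smul, hx]; split_ifs <;> simp
    | mem x hx =>
      obtain ⟨i, j, rfl, a, ha, b, hb, rfl⟩ := hx
      by_cases hi : i = 0
      · subst hi
        by_cases hj : j = k
        · subst hj
          simp [GradedTensorProduct.tmul, proj_of_mem X.grading hb]
        · simp [GradedTensorProduct.tmul, proj_of_mem_ne X.grading hb hj, hj]
      · simp [GradedTensorProduct.tmul, X.toH_of_mem hi ha]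
  induction v using DirectSum.Decomposition.inductionOn X.grading with
  | zero => simp
  | add x y hx hy => simp only [map_add, hx, hy]
  | @homogeneous n v =>
    refine Eq.trans ?_ (h0 n _ (comul_mem hX v.2)).symm
    split_ifs with h
    · subst h
      rw [proj_of_mem X.grading v.2]; rfl
    · rw [proj_of_mem_ne X.grading v.2 h, map_zero]

end FODC

end Hopf

section Calculus

variable {H P Γ Ω : Type*} [Ring H] [HopfAlgebra ℂ H] [StarRing H] [StarModule ℂ H]
    [Ring P] [Algebra ℂ P] [StarRing P] [StarModule ℂ P]
    [AddCommGroup Γ] [Module ℂ Γ] [Module H Γ] [Module Hᵐᵒᵖ Γ] [SMulCommClass H Hᵐᵒᵖ Γ]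
    [IsScalarTower ℂ H Γ] [IsScalarTower ℂ Hᵐᵒᵖ Γ] [Ring Ω] [Algebra ℂ Ω]
    {ζ : QPBundle H P} {X : FODC H Γ} {𝒜 : ℕ → Submodule ℂ Ω} [GradedAlgebra 𝒜]
    (C : Calculus ζ X 𝒜)

namespace Calculus

/-! ### Surjectivity of the canonical map -/

lemma smulLift_coactDeg (k : ℕ) (z : Ω ⊗[ℂ] Ω) : smulLift (C.coactDeg k) z =
    (GradedAlgebra.proj X.grading k).lTensor Ω (smulLift C.coactₗ z) :=
  smulLift_lTensor _ _ z

lemma smulLift_coactDeg_of_lt {k n : ℕ} (h : k < n) {s : Ω ⊗[ℂ] Ω} (hs : s ∈ topSpace 𝒜 k) :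
    smulLift (C.coactDeg n) s = 0 := by
  induction hs using Submodule.span_induction with
  | zero => simp
  | add x y _ _ hx hy => rw [map_add, hx, hy, add_zero]
  | smul c x _ hx => rw [map_smul, hx, smul_zero]
  | mem x hx =>
    obtain ⟨p, -, b, hb, rfl⟩ := hx
    rw [smulLift_tmul, C.coactDeg_of_mem h hb, smul_zero]

/-- Induction on the degree `k` of `ϑ`: some `s` has `1 ⊗ ϑ` as its component of degree `k`, no
components above, and components below that lie in the range by induction, the range being a left
`Ω`-submodule. -/
lemma one_tmul_mem_range (ϑ : X.Env) :
    (1 : Ω) ⊗ₜ[ℂ] ϑ ∈ LinearMap.range (smulLift (A := Ω) C.coactₗ) := by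
  set S := LinearMap.range (smulLift (A := Ω) C.coactₗ) with hS
  have smul_mem : ∀ (a : Ω), ∀ t ∈ S, a • t ∈ S := by
    rintro a _ ⟨z, rfl⟩
    exact ⟨a • z, smulLift_smul _ a z⟩
  suffices h : ∀ k, ∀ ϑ ∈ X.grading k, (1 : Ω) ⊗ₜ[ℂ] ϑ ∈ S by
    induction ϑ using DirectSum.Decomposition.inductionOn X.grading with
    | zero => simp
    | add x y hx hy => rw [TensorProduct.tmul_add]; exact add_mem hx hy
    | homogeneous x => exact h _ _ x.2
  intro k
  induction k using Nat.strong_induction_on with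
  | _ k ih =>
    intro ϑ hϑ
    obtain ⟨s, hs, hsϑ⟩ := C.exists_topSpace hϑ
    have hlow : ∀ n < k, smulLift (C.coactDeg n) s ∈ S := by
      intro n hn
      rw [smulLift_coactDeg]
      generalize smulLift C.coactₗ s = t
      induction t with
      | zero => simp
      | add x y hx hy => rw [map_add]; exact add_mem hx hy
      | tmul a v =>
        have := smul_mem a _ (ih n hn _ (proj_mem X.grading n v))
        rwa [TensorProduct.smul_tmul', smul_eq_mul, mul_one] at this
    obtain ⟨N, hN⟩ := exists_sum_lTensor_proj X.grading (smulLift C.coactₗ s)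
    have h1 := hN (max N (k + 1)) (le_max_left _ _)
    simp only [← smulLift_coactDeg] at h1
    rw [← Finset.add_sum_erase _ _ (Finset.mem_range.2
      (lt_of_lt_of_le (Nat.lt_succ_self k) (le_max_right N (k + 1)))), hsϑ] at h1
    rw [eq_sub_iff_add_eq.2 h1.symm]
    refine sub_mem ⟨s, rfl⟩ (sum_mem fun n hn => ?_)
    rcases lt_or_gt_of_ne (Finset.ne_of_mem_erase hn) with h | h
    · exact hlow n h
    · rw [C.smulLift_coactDeg_of_lt h hs]
      exact zero_mem _

lemma canonicalMap_mk (z : Ω ⊗[ℂ] Ω) : C.canonicalMap (Submodule.Quotient.mk z) =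
    GradedTensorProduct.of ℂ 𝒜 X.grading (smulLift C.coactₗ z) := by
  induction z with
  | zero => simp
  | add x y hx hy => rw [Submodule.Quotient.mk_add, map_add, hx, hy, map_add, map_add]
  | tmul a b =>
    rw [smulLift_tmul, ← tmul_one_mul_of]
    rfl

lemma canonicalMap_surjective : Function.Surjective C.canonicalMap := by
  intro y
  obtain ⟨t, rfl⟩ := (GradedTensorProduct.of ℂ 𝒜 X.grading).surjective y
  suffices h : ∃ z : Ω ⊗[ℂ] Ω, smulLift C.coactₗ z = t by
    obtain ⟨z, rfl⟩ := h
    exact ⟨_, C.canonicalMap_mk z⟩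
  induction t with
  | zero => exact ⟨0, map_zero _⟩
  | add x y hx hy =>
    obtain ⟨z, rfl⟩ := hx
    obtain ⟨z', rfl⟩ := hy
    exact ⟨z + z', map_add _ _ _⟩
  | tmul a v =>
    obtain ⟨z, hz⟩ := C.one_tmul_mem_range v
    refine ⟨a • z, ?_⟩
    rw [smulLift_smul, hz, TensorProduct.smul_tmul', smul_eq_mul, mul_one]

/-! ### The coaction of the structure group on forms -/

/-- The coaction of `H` on `Ω`. -/
def coactH : Ω →ₐ[ℂ] Ω ⊗[ℂ] H :=
  AlgHom.ofLinearMap (X.toH.toLinearMap.lTensor Ω ∘ₗ C.coactₗ)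
    (by
      rw [LinearMap.comp_apply, C.isFormCoaction_coactₗ.one]
      simp [Algebra.TensorProduct.one_def])
    (by
      have key : ∀ x y : 𝒜 ᵍ⊗[ℂ] X.grading, X.toH.toLinearMap.lTensor Ω
          ((GradedTensorProduct.of ℂ 𝒜 X.grading).symm (x * y)) =
          X.toH.toLinearMap.lTensor Ω ((GradedTensorProduct.of ℂ 𝒜 X.grading).symm x) *
            X.toH.toLinearMap.lTensor Ω ((GradedTensorProduct.of ℂ 𝒜 X.grading).symm y) := by
        intro x y
        obtain ⟨x, rfl⟩ := (GradedTensorProduct.of ℂ 𝒜 X.grading).surjective x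
        obtain ⟨y, rfl⟩ := (GradedTensorProduct.of ℂ 𝒜 X.grading).surjective y
        simp only [LinearEquiv.symm_apply_apply]
        induction x with
        | zero => simp
        | add x y hx hy => simp only [map_add, add_mul, hx, hy]
        | tmul a b =>
          induction y with
          | zero => simp
          | add x y hx hy => simp only [map_add, mul_add, hx, hy]
          | tmul a' b' =>
            induction a' using DirectSum.Decomposition.inductionOn 𝒜 with
            | zero => simp
            | add x y hx hy => simp only [TensorProduct.add_tmul, map_add, mul_add, hx, hy]
            | homogeneous a' =>
              induction b using DirectSum.Decomposition.inductionOn X.grading with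
              | zero => simp
              | add x y hx hy => simp only [TensorProduct.tmul_add, map_add, add_mul, hx, hy]
              | @homogeneous n b =>
                have := tmul_mul_tmul_of_mem 𝒜 X.grading b.2 a'.2 a b'
                simp only [GradedTensorProduct.tmul, TensorProduct.mk_apply,
                  LinearEquiv.coe_coe] at this
                rw [this]
                -- A Koszul sign can only occur when `b` has positive degree, and then both sides
                -- are killed by the projection to `H`.
                by_cases hn : n = 0
                · subst hn
                  simp
                · simp [X.toH_of_mem hn b.2]
      intro v w
      simp only [LinearMap.comp_apply, coactₗ, AlgHom.toLinearMap_apply, map_mul,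
        LinearEquiv.coe_coe]
      exact key _ _)

lemma coactH_apply (w : Ω) : C.coactH w = X.toH.toLinearMap.lTensor Ω (C.coactₗ w) := rfl

end Calculus

end Calculus

/-! ### Covariance of the canonical map under the structure group, and horizontal forms. -/

section Calculus

variable {H P Γ Ω : Type*} [Ring H] [HopfAlgebra ℂ H] [StarRing H] [StarModule ℂ H]
    [Ring P] [Algebra ℂ P] [StarRing P] [StarModule ℂ P]
    [AddCommGroup Γ] [Module ℂ Γ] [Module H Γ] [Module Hᵐᵒᵖ Γ] [SMulCommClass H Hᵐᵒᵖ Γ]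
    [IsScalarTower ℂ H Γ] [IsScalarTower ℂ Hᵐᵒᵖ Γ] [Ring Ω] [Algebra ℂ Ω]
    {ζ : QPBundle H P} {X : FODC H Γ} {𝒜 : ℕ → Submodule ℂ Ω} [GradedAlgebra 𝒜]
    (C : Calculus ζ X 𝒜)

namespace Calculus

/-- The map `x ⊗ v ↦ (x ⊗ v₋₁) ⊗ v₀` given by the left coaction of `H` on `Γ^∧`. -/
def extendCoact : Ω ⊗[ℂ] X.Env →ₗ[ℂ] (Ω ⊗[ℂ] H) ⊗[ℂ] X.Env :=
  (TensorProduct.assoc ℂ Ω H X.Env).symm.toLinearMap ∘ₗ (FODC.leftCoact C.bicov).lTensor Ω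

lemma extendCoact_smul (a : Ω) (t : Ω ⊗[ℂ] X.Env) :
    C.extendCoact (a • t) = (a ⊗ₜ[ℂ] (1 : H)) • C.extendCoact t := by
  induction t with
  | zero => simp
  | add x y hx hy => simp only [smul_add, map_add, hx, hy]
  | tmul b v =>
    simp only [TensorProduct.smul_tmul', extendCoact, LinearMap.comp_apply, LinearMap.lTensor_tmul]
    generalize FODC.leftCoact C.bicov v = q
    induction q with
    | zero => simp
    | add x y hx hy => simp only [TensorProduct.tmul_add, smul_add, map_add, hx, hy]
    | tmul g e => simp [TensorProduct.smul_tmul']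

/-- Coassociativity of the coaction on `Ω`, with the middle leg projected to `H`. -/
lemma coactH_rTensor_coactₗ (w : Ω) :
    C.coactH.toLinearMap.rTensor X.Env (C.coactₗ w) = C.extendCoact (C.coactₗ w) := by
  have h := congrArg (fun z => (TensorProduct.assoc ℂ Ω H X.Env).symm
    ((X.toH.toLinearMap.rTensor X.Env).lTensor Ω z)) (C.coassoc w)
  have h1 : ∀ t : Ω ⊗[ℂ] X.Env, (TensorProduct.assoc ℂ Ω H X.Env).symm
      ((X.toH.toLinearMap.rTensor X.Env).lTensor Ω (TensorProduct.assoc ℂ Ω X.Env X.Env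
        (C.coactₗ.rTensor X.Env t))) = C.coactH.toLinearMap.rTensor X.Env t := fun t => by
    induction t with
    | zero => simp
    | add x y hx hy => simp only [map_add, hx, hy]
    | tmul a v =>
      simp only [LinearMap.rTensor_tmul, AlgHom.toLinearMap_apply, coactH_apply]
      generalize C.coactₗ a = q
      induction q with
      | zero => simp
      | add x y hx hy => simp only [map_add, TensorProduct.add_tmul, hx, hy]
      | tmul c e => simp
  simp only [h1] at h
  rw [h, extendCoact, FODC.leftCoact, LinearMap.lTensor_comp]
  rfl

lemma rTensor_lTensor_comm {A B M N : Type*} [AddCommGroup A] [Module ℂ A] [AddCommGroup B]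
    [Module ℂ B] [AddCommGroup M] [Module ℂ M] [AddCommGroup N] [Module ℂ N] (f : A →ₗ[ℂ] B)
    (g : M →ₗ[ℂ] N) (t : A ⊗[ℂ] M) :
    f.rTensor N (g.lTensor A t) = g.lTensor B (f.rTensor M t) := by
  rw [← LinearMap.comp_apply, ← LinearMap.comp_apply, LinearMap.rTensor_comp_lTensor,
    LinearMap.lTensor_comp_rTensor]

lemma extendCoact_proj (k : ℕ) (t : Ω ⊗[ℂ] X.Env) :
    C.extendCoact ((GradedAlgebra.proj X.grading k).lTensor Ω t) =
      (GradedAlgebra.proj X.grading k).lTensor (Ω ⊗[ℂ] H) (C.extendCoact t) := by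
  induction t with
  | zero => simp
  | add x y hx hy => simp only [map_add, hx, hy]
  | tmul a v =>
    simp only [extendCoact, LinearMap.comp_apply, LinearMap.lTensor_tmul, FODC.leftCoact_proj]
    generalize FODC.leftCoact C.bicov v = q
    induction q with
    | zero => simp
    | add x y hx hy => simp only [map_add, TensorProduct.tmul_add, hx, hy]
    | tmul c e => simp

lemma coactH_rTensor_coactDeg (k : ℕ) (w : Ω) :
    C.coactH.toLinearMap.rTensor X.Env (C.coactDeg k w) = C.extendCoact (C.coactDeg k w) := by
  rw [coactDeg, LinearMap.comp_apply, rTensor_lTensor_comm, C.coactH_rTensor_coactₗ,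
    C.extendCoact_proj]

/-- The map `y ⊗ v ↦ y (1 ⊗ S(v₋₁)) ⊗ v₀`. -/
def untwist : (Ω ⊗[ℂ] H) ⊗[ℂ] X.Env →ₗ[ℂ] (Ω ⊗[ℂ] H) ⊗[ℂ] X.Env :=
  smulLift ((TensorProduct.mk ℂ Ω H 1 ∘ₗ HopfAlgebra.antipode ℂ).rTensor X.Env ∘ₗ
    FODC.leftCoact C.bicov)

lemma untwist_smul (y : Ω ⊗[ℂ] H) (t : (Ω ⊗[ℂ] H) ⊗[ℂ] X.Env) :
    C.untwist (y • t) = y • C.untwist t := smulLift_smul _ y t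

variable (H) in
/-- The inclusion `x ⊗ v ↦ (x ⊗ 1) ⊗ v`. -/
def inclOne (X : FODC H Γ) (Ω : Type*) [Ring Ω] [Algebra ℂ Ω] :
    Ω ⊗[ℂ] X.Env →ₗ[ℂ] (Ω ⊗[ℂ] H) ⊗[ℂ] X.Env :=
  ((TensorProduct.mk ℂ Ω H).flip 1).rTensor X.Env

/-- The middle leg becomes `v₋₂ S(v₋₁)`, which collapses to the counit. -/
lemma untwist_extendCoact (t : Ω ⊗[ℂ] X.Env) :
    C.untwist (C.extendCoact t) = inclOne H X Ω t := by
  induction t with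
  | zero => simp
  | add x y hx hy => simp only [map_add, hx, hy]
  | tmul a v =>
    set W : H ⊗[ℂ] (H ⊗[ℂ] X.Env) →ₗ[ℂ] (Ω ⊗[ℂ] H) ⊗[ℂ] X.Env :=
      (TensorProduct.mk ℂ Ω H a ∘ₗ LinearMap.mul' ℂ H ∘ₗ
        (HopfAlgebra.antipode ℂ).lTensor H).rTensor X.Env ∘ₗ
          (TensorProduct.assoc ℂ H H X.Env).symm.toLinearMap with hW
    have h1 : ∀ q : H ⊗[ℂ] X.Env, C.untwist ((TensorProduct.assoc ℂ Ω H X.Env).symm (a ⊗ₜ q)) =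
        W ((FODC.leftCoact C.bicov).lTensor H q) := fun q => by
      induction q with
      | zero => simp
      | add x y hx hy => simp only [map_add, TensorProduct.tmul_add, hx, hy]
      | tmul g e =>
        simp only [TensorProduct.assoc_symm_tmul, untwist, smulLift_tmul, LinearMap.comp_apply,
          LinearMap.lTensor_tmul]
        generalize FODC.leftCoact C.bicov e = r
        induction r with
        | zero => simp
        | add x y hx hy => simp only [map_add, TensorProduct.tmul_add, smul_add, hx, hy]
        | tmul c e => simp [hW, TensorProduct.smul_tmul']
    have h2 : ∀ q : H ⊗[ℂ] X.Env, W (TensorProduct.assoc ℂ H H X.Env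
        ((Coalgebra.comul (R := ℂ)).rTensor X.Env q)) = (a ⊗ₜ[ℂ] (1 : H)) ⊗ₜ[ℂ]
          TensorProduct.lid ℂ X.Env ((Coalgebra.counit (R := ℂ)).rTensor X.Env q) := fun q => by
      induction q with
      | zero => simp
      | add x y hx hy => simp only [map_add, TensorProduct.tmul_add, hx, hy]
      | tmul g e =>
        simp only [hW, LinearMap.comp_apply, LinearEquiv.coe_coe, LinearEquiv.symm_apply_apply,
          LinearMap.rTensor_tmul, HopfAlgebra.mul_antipode_lTensor_comul_apply]
        simp [Algebra.algebraMap_eq_smul_one, TensorProduct.smul_tmul']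
    rw [extendCoact, LinearMap.comp_apply, LinearMap.lTensor_tmul, LinearEquiv.coe_coe, h1,
      ← FODC.leftCoact_coassoc, h2, FODC.lid_counit_leftCoact]
    simp [inclOne]

/-- The map `l ⊗ r ↦ ρ(l) (r₀ ⊗ 1 ⊗ r₁)` with `r₁` of degree `k`. -/
def mixedCoact (k : ℕ) : Ω ⊗[ℂ] Ω →ₗ[ℂ] (Ω ⊗[ℂ] H) ⊗[ℂ] X.Env :=
  smulLift (inclOne H X Ω ∘ₗ C.coactDeg k) ∘ₗ C.coactH.toLinearMap.rTensor Ω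

/-- Isolates the `H`-coaction on the left factor of `s = ∑ l ⊗ r`: `ρ(l r₀) ⊗ r₁` also contains the
coaction of `r₀`, which equals the left coaction on `r₁`, and this is what `untwist` removes. -/
lemma mixedCoact_eq (k : ℕ) (s : Ω ⊗[ℂ] Ω) : C.mixedCoact k s =
    C.untwist (C.coactH.toLinearMap.rTensor X.Env (smulLift (C.coactDeg k) s)) := by
  induction s with
  | zero => simp
  | add x y hx hy => simp only [map_add, hx, hy]
  | tmul l r =>
    rw [smulLift_tmul, rTensor_smul, C.coactH_rTensor_coactDeg, untwist_smul, C.untwist_extendCoact]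
    rfl

/-! ### Horizontal forms -/

/-- The form `w` is horizontal: its coaction takes values in `Ω ⊗ H`. -/
def IsHorizontal (w : Ω) : Prop := C.coactₗ w = X.ιH.toLinearMap.lTensor Ω (C.coactH w)

lemma isHorizontal_iff (w : Ω) : C.IsHorizontal w ↔ C.coactₗ w = C.coactDeg 0 w := by
  rw [IsHorizontal, coactH_apply, ← LinearMap.comp_apply, ← LinearMap.lTensor_comp]
  have : X.ιH.toLinearMap ∘ₗ X.toH.toLinearMap = GradedAlgebra.proj X.grading 0 :=
    LinearMap.ext X.ιH_toH
  rw [this]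
  rfl

lemma IsHorizontal.mul {C : Calculus ζ X 𝒜} {v w : Ω} (hv : C.IsHorizontal v)
    (hw : C.IsHorizontal w) : C.IsHorizontal (v * w) := by
  apply (GradedTensorProduct.of ℂ 𝒜 X.grading).injective
  rw [of_coactₗ, map_mul, map_mul, ← of_coactₗ, ← of_coactₗ, hv, hw]
  generalize C.coactH v = p
  generalize C.coactH w = q
  induction p with
  | zero => simp
  | add x y hx hy => simp only [map_add, add_mul, hx, hy]
  | tmul a g =>
    induction q with
    | zero => simp
    | add x y hx hy => simp only [map_add, mul_add, hx, hy]
    | tmul b h =>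
      refine (tmul_mul_tmul_zero 𝒜 X.grading (X.ιH_mem g) a b (X.ιH h)).trans ?_
      rw [← map_mul, Algebra.TensorProduct.tmul_mul_tmul]
      rfl

lemma isHorizontal_of_mem {w : Ω} (hw : w ∈ 𝒜 0) : C.IsHorizontal w := by
  rw [← C.range_ι] at hw
  obtain ⟨x, rfl⟩ := hw
  rw [IsHorizontal, coactH_apply, AlgHom.toLinearMap_apply, C.coactₗ_ι]
  generalize ζ.coact x = q
  induction q with
  | zero => simp
  | add x y hx hy => simp only [map_add, ← hx, ← hy]
  | tmul b h => simp [X.toH_ιH]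

variable {h : H →ₗ[ℂ] ℂ}

/-- The map `id ⊗ h : Ω ⊗ H → Ω`. -/
def integrate (Ω : Type*) [Ring Ω] [Algebra ℂ Ω] (h : H →ₗ[ℂ] ℂ) : Ω ⊗[ℂ] H →ₗ[ℂ] Ω :=
  (TensorProduct.rid ℂ Ω).toLinearMap ∘ₗ h.lTensor Ω

@[simp] lemma integrate_tmul (a : Ω) (g : H) : integrate Ω h (a ⊗ₜ g) = h g • a := by
  simp [integrate]

/-- Averaging a horizontal form over the structure group gives a base form. -/
lemma integrate_mem_baseForms
    (hinv : ∀ x, TensorProduct.rid ℂ H (h.lTensor H (Coalgebra.comul x)) = h x • 1) {w : Ω}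
    (hw : C.IsHorizontal w) : integrate Ω h (C.coactH w) ∈ C.baseForms := by
  rw [mem_baseForms]
  apply (GradedTensorProduct.of ℂ 𝒜 X.grading).symm.injective
  change C.coactₗ _ = (integrate Ω h (C.coactH w)) ⊗ₜ[ℂ] (1 : X.Env)
  -- `T` evaluates the Haar functional on the third leg. By coassociativity the coaction of the
  -- average is `w₀ ⊗ w₁ h(w₂)`; since `w` is horizontal, `w₁ ⊗ w₂` is a coproduct in `H` and
  -- invariance applies.
  set T : Ω ⊗[ℂ] (X.Env ⊗[ℂ] X.Env) →ₗ[ℂ] Ω ⊗[ℂ] X.Env :=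
    ((TensorProduct.rid ℂ X.Env).toLinearMap ∘ₗ (h ∘ₗ X.toH.toLinearMap).lTensor X.Env).lTensor Ω
    with hT
  have h1 : ∀ t : Ω ⊗[ℂ] X.Env, C.coactₗ (integrate Ω h (X.toH.toLinearMap.lTensor Ω t)) =
      T (TensorProduct.assoc ℂ Ω X.Env X.Env (C.coactₗ.rTensor X.Env t)) := fun t => by
    induction t with
    | zero => simp
    | add x y hx hy => simp only [map_add, hx, hy]
    | tmul a v =>
      simp only [LinearMap.lTensor_tmul, integrate_tmul, map_smul, LinearMap.rTensor_tmul]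
      generalize C.coactₗ a = q
      induction q with
      | zero => simp
      | add x y hx hy => simp only [map_add, TensorProduct.add_tmul, smul_add, hx, hy]
      | tmul c e => simp [hT, TensorProduct.tmul_smul]
  have h2 : ∀ q : Ω ⊗[ℂ] H, T (C.comulₗ.lTensor Ω (X.ιH.toLinearMap.lTensor Ω q)) =
      integrate Ω h q ⊗ₜ[ℂ] (1 : X.Env) := fun q => by
    induction q with
    | zero => simp
    | add x y hx hy => simp only [map_add, TensorProduct.add_tmul, hx, hy]
    | tmul a g =>
      have h3 : ∀ p : H ⊗[ℂ] H, TensorProduct.rid ℂ X.Env ((h ∘ₗ X.toH.toLinearMap).lTensor X.Env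
          (TensorProduct.map X.ιH.toLinearMap X.ιH.toLinearMap p)) =
          X.ιH (TensorProduct.rid ℂ H (h.lTensor H p)) := fun p => by
        induction p with
        | zero => simp
        | add x y hx hy => simp only [map_add, hx, hy]
        | tmul c e => simp [X.toH_ιH]
      have h4 : C.comulₗ (X.ιH g) = TensorProduct.map X.ιH.toLinearMap X.ιH.toLinearMap
        (Coalgebra.comul g) := FODC.comulₗ_ιH C.bicov g
      simp only [hT, LinearMap.lTensor_tmul, AlgHom.toLinearMap_apply, LinearMap.comp_apply, h4,
        LinearEquiv.coe_coe, h3, hinv, map_smul, map_one, integrate_tmul]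
      rw [TensorProduct.tmul_smul, TensorProduct.smul_tmul']
  refine (h1 (C.coactₗ w)).trans ?_
  have hw' : C.coactₗ w = _ := hw
  rw [C.coassoc, hw', h2]

/-- The forms `w` such that the components of the coaction of degree at least `k` vanish. -/
def filt (k : ℕ) : Submodule ℂ Ω := ⨅ n ≥ k, LinearMap.ker (C.coactDeg n)

lemma mem_filt {k : ℕ} {w : Ω} : w ∈ C.filt k ↔ ∀ n ≥ k, C.coactDeg n w = 0 := by
  simp [filt, Submodule.mem_iInf]

/-- The counit recovers a form from its coaction, so a form all of whose components vanish is zero.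
-/
lemma filt_zero : C.filt 0 = ⊥ := by
  rw [eq_bot_iff]
  intro w hw
  rw [mem_filt] at hw
  obtain ⟨N, hN⟩ := exists_sum_lTensor_proj X.grading (C.coactₗ w)
  have h0 : C.coactₗ w = 0 :=
    (hN N le_rfl).trans (Finset.sum_eq_zero fun n _ => hw n (Nat.zero_le n))
  rw [Submodule.mem_bot, ← C.counit w, h0, map_zero, map_zero]

lemma mem_filt_of_mem {k : ℕ} {w : Ω} (hw : w ∈ 𝒜 k) : w ∈ C.filt (k + 1) :=
  C.mem_filt.2 fun _ hn => C.coactDeg_of_mem hn hw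

lemma filt_mono {k l : ℕ} (h : k ≤ l) : C.filt k ≤ C.filt l :=
  fun _ hw => C.mem_filt.2 fun _ hn => C.mem_filt.1 hw _ (h.trans hn)

lemma exists_mem_filt (w : Ω) : ∃ k, w ∈ C.filt k := by
  induction w using DirectSum.Decomposition.inductionOn 𝒜 with
  | zero => exact ⟨0, zero_mem _⟩
  | add x y hx hy =>
    obtain ⟨k, hk⟩ := hx
    obtain ⟨l, hl⟩ := hy
    exact ⟨max k l, add_mem (C.filt_mono (le_max_left _ _) hk) (C.filt_mono (le_max_right _ _) hl)⟩
  | homogeneous x => exact ⟨_, C.mem_filt_of_mem x.2⟩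

/-- The leading component of the coaction has horizontal coefficients. -/
lemma coactDeg_mem_span_horizontal {k : ℕ} {b : Ω} (hb : b ∈ C.filt (k + 1)) :
    C.coactDeg k b ∈ Submodule.span ℂ
      {t | ∃ x, C.IsHorizontal x ∧ ∃ v : X.Env, t = x ⊗ₜ[ℂ] v} := by
  -- The kernel of `L` is the space of horizontal forms, so the aim is `(L ⊗ id)(Δ_k b) = 0`. By
  -- coassociativity this is `(id ⊗ M)` applied to the coaction of `b`.
  set L : Ω →ₗ[ℂ] Ω ⊗[ℂ] X.Env := C.coactₗ - C.coactDeg 0 with hL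
  set M : X.Env →ₗ[ℂ] X.Env ⊗[ℂ] X.Env := TensorProduct.map
    (LinearMap.id - GradedAlgebra.proj X.grading 0) (GradedAlgebra.proj X.grading k) ∘ₗ C.comulₗ
    with hM
  -- A second leg of degree `k` inside total degree at most `k` forces the first leg into degree
  -- zero, which `id - proj 0` kills.
  have hM0 : ∀ n ≤ k, ∀ v ∈ X.grading n, M v = 0 := by
    intro n hn v hv
    have hx : ∀ x ∈ totalDegree X.grading X.grading n, TensorProduct.map
        (LinearMap.id - GradedAlgebra.proj X.grading 0) (GradedAlgebra.proj X.grading k)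
        ((GradedTensorProduct.of ℂ X.grading X.grading).symm x) = 0 := by
      intro x hx
      induction hx using Submodule.span_induction with
      | zero => simp
      | add x x' _ _ hx hx' => simp only [map_add, hx, hx', add_zero]
      | smul c x _ hx => simp only [map_smul, hx, smul_zero]
      | mem x hx =>
        obtain ⟨i, j, rfl, a, ha, b, hb, rfl⟩ := hx
        by_cases hj : j = k
        · obtain rfl : i = 0 := by omega
          simp [GradedTensorProduct.tmul, proj_of_mem X.grading ha]
        · simp [GradedTensorProduct.tmul, proj_of_mem_ne X.grading hb hj]
    exact hx _ (FODC.comul_mem C.bicov hv)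
  have h1 : ∀ t : Ω ⊗[ℂ] X.Env, TensorProduct.assoc ℂ Ω X.Env X.Env
      (L.rTensor X.Env ((GradedAlgebra.proj X.grading k).lTensor Ω t)) =
      (TensorProduct.map (LinearMap.id - GradedAlgebra.proj X.grading 0)
        (GradedAlgebra.proj X.grading k)).lTensor Ω (TensorProduct.assoc ℂ Ω X.Env X.Env
          (C.coactₗ.rTensor X.Env t)) := fun t => by
    induction t with
    | zero => simp
    | add x y hx hy => simp only [map_add, hx, hy]
    | tmul a v =>
      simp only [LinearMap.lTensor_tmul, LinearMap.rTensor_tmul, hL, LinearMap.sub_apply, coactDeg,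
        LinearMap.comp_apply]
      generalize C.coactₗ a = q
      induction q with
      | zero => simp
      | add x y hx hy =>
        simp only [map_add, TensorProduct.add_tmul, ← hx, ← hy]
        rw [add_sub_add_comm, TensorProduct.add_tmul, map_add]
      | tmul c e => simp [TensorProduct.sub_tmul, TensorProduct.tmul_sub]
  have h2 : L.rTensor X.Env (C.coactDeg k b) = 0 := by
    apply (TensorProduct.assoc ℂ Ω X.Env X.Env).injective
    rw [coactDeg, LinearMap.comp_apply, h1, C.coassoc, ← LinearMap.comp_apply,
      ← LinearMap.lTensor_comp, ← hM, map_zero]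
    obtain ⟨N, hN⟩ := exists_sum_lTensor_proj X.grading (C.coactₗ b)
    rw [hN N le_rfl, map_sum]
    refine Finset.sum_eq_zero fun n _ => ?_
    rcases Nat.lt_or_ge k n with hn | hn
    · have : (GradedAlgebra.proj X.grading n).lTensor Ω (C.coactₗ b) = 0 := C.mem_filt.1 hb n hn
      rw [this, map_zero]
    · rw [← LinearMap.comp_apply, ← LinearMap.lTensor_comp]
      have : M ∘ₗ GradedAlgebra.proj X.grading n = 0 :=
        LinearMap.ext fun v => hM0 n hn _ (proj_mem X.grading n v)
      rw [this, LinearMap.lTensor_zero, LinearMap.zero_apply]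
  -- Tensoring over a field is exact, so the kernel of `L ⊗ id` is `ker L ⊗ Γ^∧`.
  have hex : Function.Exact (LinearMap.ker L).subtype L := LinearMap.exact_subtype_ker_map L
  obtain ⟨t, ht⟩ := (Module.Flat.rTensor_exact X.Env hex _).1 h2
  rw [← ht]
  clear ht
  induction t with
  | zero => simp
  | add x y hx hy => rw [map_add]; exact add_mem hx hy
  | tmul x v =>
    refine Submodule.subset_span ⟨x.1, ?_, v, rfl⟩
    rw [isHorizontal_iff]
    exact sub_eq_zero.1 x.2

end Calculus

end Calculus

/-! ### Averaging over the structure group and injectivity of the canonical map. -/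

section Calculus

variable {H P Γ Ω : Type*} [Ring H] [HopfAlgebra ℂ H] [StarRing H] [StarModule ℂ H]
    [Ring P] [Algebra ℂ P] [StarRing P] [StarModule ℂ P]
    [AddCommGroup Γ] [Module ℂ Γ] [Module H Γ] [Module Hᵐᵒᵖ Γ] [SMulCommClass H Hᵐᵒᵖ Γ]
    [IsScalarTower ℂ H Γ] [IsScalarTower ℂ Hᵐᵒᵖ Γ] [Ring Ω] [Algebra ℂ Ω]
    {ζ : QPBundle H P} {X : FODC H Γ} {𝒜 : ℕ → Submodule ℂ Ω} [GradedAlgebra 𝒜]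
    (C : Calculus ζ X 𝒜)

namespace Calculus

/-- The choices of preimages are made on a basis to obtain a linear map. No covariance is required
of it: averaging will compensate. -/
lemma exists_linear_topSpace (k : ℕ) : ∃ l : X.Env →ₗ[ℂ] Ω ⊗[ℂ] Ω, (∀ v, l v ∈ topSpace 𝒜 k) ∧
    ∀ v, smulLift (C.coactDeg k) (l v) = 1 ⊗ₜ GradedAlgebra.proj X.grading k v := by
  have hex : ∀ v : X.Env, ∃ s : topSpace 𝒜 k, smulLift (C.coactDeg k) (s : Ω ⊗[ℂ] Ω) =
      1 ⊗ₜ GradedAlgebra.proj X.grading k v := fun v => by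
    obtain ⟨s, hs, h⟩ := C.exists_topSpace (proj_mem X.grading k v)
    exact ⟨⟨s, hs⟩, h⟩
  choose f hf using hex
  set B := Module.Basis.ofVectorSpace ℂ X.Env
  refine ⟨(topSpace 𝒜 k).subtype ∘ₗ B.constr ℂ (f ∘ B), fun v => Subtype.mem _, fun v => ?_⟩
  have : smulLift (C.coactDeg k) ∘ₗ (topSpace 𝒜 k).subtype ∘ₗ B.constr ℂ (f ∘ B) =
      TensorProduct.mk ℂ Ω X.Env 1 ∘ₗ GradedAlgebra.proj X.grading k := by
    refine B.ext fun i => ?_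
    simp only [LinearMap.comp_apply, Module.Basis.constr_basis, Submodule.subtype_apply,
      Function.comp_apply, hf, TensorProduct.mk_apply]
  exact LinearMap.congr_fun this v

/-- The span of the tensors `μ ⊗ r` with `μ` a base form and `r` of degree `k`. -/
def baseSpan (k : ℕ) : Submodule ℂ (Ω ⊗[ℂ] Ω) :=
  Submodule.span ℂ {z | ∃ μ ∈ C.baseForms, ∃ r ∈ 𝒜 k, z = μ ⊗ₜ[ℂ] r}

section Average

variable (h : H →ₗ[ℂ] ℂ) (l : X.Env →ₗ[ℂ] Ω ⊗[ℂ] Ω)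

/-- The map `y ⊗ v ↦ (id ⊗ h)(y ρ(a)) ⊗ b`, where `l(v) = a ⊗ b`. -/
def averageAux : (Ω ⊗[ℂ] H) ⊗[ℂ] X.Env →ₗ[ℂ] Ω ⊗[ℂ] Ω :=
  (integrate Ω h).rTensor Ω ∘ₗ smulLift (C.coactH.toLinearMap.rTensor Ω ∘ₗ l)

/-- The left `Ω`-linear map `Ω ⊗ Γ^∧ → Ω ⊗ Ω` obtained by averaging the linear map `l` over the
structure group. -/
def average : Ω ⊗[ℂ] X.Env →ₗ[ℂ] Ω ⊗[ℂ] Ω := C.averageAux h l ∘ₗ C.extendCoact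

lemma average_smul (a : Ω) (t : Ω ⊗[ℂ] X.Env) : C.average h l (a • t) = a • C.average h l t := by
  rw [average, LinearMap.comp_apply, extendCoact_smul, averageAux, LinearMap.comp_apply,
    smulLift_smul, LinearMap.comp_apply, LinearMap.comp_apply]
  generalize smulLift (C.coactH.toLinearMap.rTensor Ω ∘ₗ l) (C.extendCoact t) = z
  induction z with
  | zero => simp
  | add x y hx hy => simp only [smul_add, map_add, hx, hy]
  | tmul y r =>
    rw [TensorProduct.smul_tmul', LinearMap.rTensor_tmul, LinearMap.rTensor_tmul,
      TensorProduct.smul_tmul']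
    congr 1
    induction y with
    | zero => simp
    | add x y hx hy => simp only [smul_add, map_add, hx, hy]
    | tmul b g => simp

variable {h l} {k : ℕ}

/-- The coefficients `x` of the leading component of `b` are horizontal, and so are the degree zero
left factors `p` of `l`. The averaged left factor is therefore `(id ⊗ h) ρ(x p)` with `x p`
horizontal, a base form. -/
lemma average_mem (hl : ∀ v, l v ∈ topSpace 𝒜 k)
    (hinv : ∀ x, TensorProduct.rid ℂ H (h.lTensor H (Coalgebra.comul x)) = h x • 1) {b : Ω}
    (hb : b ∈ C.filt (k + 1)) : C.average h l (C.coactDeg k b) ∈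
      C.baseSpan k := by
  -- Trading the left coaction on the `Γ^∧` leg for `ρ` on the `Ω` leg is what makes the integrand
  -- the single coaction `ρ(x p)`.
  rw [average, LinearMap.comp_apply, ← coactH_rTensor_coactDeg]
  have ht := C.coactDeg_mem_span_horizontal hb
  generalize C.coactDeg k b = t at ht
  induction ht using Submodule.span_induction with
  | zero => simp
  | add x y _ _ hx hy => rw [map_add, map_add]; exact add_mem hx hy
  | smul c x _ hx => rw [map_smul, map_smul]; exact Submodule.smul_mem _ _ hx
  | mem t ht =>
    obtain ⟨x, hx, v, rfl⟩ := ht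
    simp only [averageAux, LinearMap.comp_apply, LinearMap.rTensor_tmul, smulLift_tmul]
    have hs := hl v
    generalize l v = s at hs
    induction hs using Submodule.span_induction with
    | zero => simp
    | add x y _ _ hx hy => rw [map_add, smul_add, map_add]; exact add_mem hx hy
    | smul c x _ hx =>
      rw [map_smul (C.coactH.toLinearMap.rTensor Ω), smul_comm,
        map_smul ((integrate Ω h).rTensor Ω)]
      exact Submodule.smul_mem _ _ hx
    | mem s hs =>
      obtain ⟨p, hp, r, hr, rfl⟩ := hs
      refine Submodule.subset_span ⟨_, C.integrate_mem_baseForms hinv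
        (hx.mul (C.isHorizontal_of_mem hp)), r, hr, ?_⟩
      simp [TensorProduct.smul_tmul']

/-- Averaging does not disturb the leading component: since `l` is a section to leading order, the
`H` leg of the integrand becomes `v₋₂ S(v₋₁)` and collapses, leaving `h(1) = 1`. -/
lemma smulLift_average (hl : ∀ v, smulLift (C.coactDeg k) (l v) =
    1 ⊗ₜ GradedAlgebra.proj X.grading k v) (h1 : h 1 = 1) (b : Ω) :
    smulLift (C.coactDeg k) (C.average h l (C.coactDeg k b)) = C.coactDeg k b := by
  have e1 : ∀ z : (Ω ⊗[ℂ] H) ⊗[ℂ] Ω, smulLift (C.coactDeg k) ((integrate Ω h).rTensor Ω z) =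
      (integrate Ω h).rTensor X.Env (smulLift (inclOne H X Ω ∘ₗ C.coactDeg k) z) := fun z => by
    induction z with
    | zero => simp
    | add x y hx hy => simp only [map_add, hx, hy]
    | tmul y r =>
      simp only [LinearMap.rTensor_tmul, smulLift_tmul, LinearMap.comp_apply]
      generalize C.coactDeg k r = t
      induction t with
      | zero => simp
      | add x y hx hy => simp only [smul_add, map_add, hx, hy]
      | tmul x v =>
        induction y with
        | zero => simp
        | add x y hx hy => simp only [add_smul, map_add, hx, hy]
        | tmul a g => simp [inclOne, TensorProduct.smul_tmul']
  have e2 : ∀ t : (Ω ⊗[ℂ] H) ⊗[ℂ] X.Env, smulLift (inclOne H X Ω ∘ₗ C.coactDeg k)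
      (smulLift (C.coactH.toLinearMap.rTensor Ω ∘ₗ l) t) =
      C.untwist ((GradedAlgebra.proj X.grading k).lTensor (Ω ⊗[ℂ] H) t) := fun t => by
    induction t with
    | zero => simp
    | add x y hx hy => simp only [map_add, hx, hy]
    | tmul y v =>
      -- For the section `l` this reads: the left factor of `l(v)` transforms by `S(v₋₁)`, up to
      -- replacing `l` by its leading image `1 ⊗ v`.
      have := C.mixedCoact_eq k (l v)
      rw [mixedCoact, LinearMap.comp_apply, hl] at this
      rw [smulLift_tmul, smulLift_smul, LinearMap.comp_apply, this, ← untwist_smul]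
      simp [TensorProduct.smul_tmul']
  have e3 : (GradedAlgebra.proj X.grading k).lTensor Ω (C.coactDeg k b) = C.coactDeg k b := by
    rw [coactDeg, LinearMap.comp_apply, ← LinearMap.comp_apply, ← LinearMap.lTensor_comp]
    congr 2
    ext v
    exact proj_of_mem X.grading (proj_mem X.grading k v)
  rw [average, LinearMap.comp_apply, averageAux, LinearMap.comp_apply, e1, e2,
    ← C.extendCoact_proj, e3, C.untwist_extendCoact, inclOne, ← LinearMap.comp_apply,
    ← LinearMap.rTensor_comp]
  have : integrate Ω h ∘ₗ (TensorProduct.mk ℂ Ω H).flip 1 = LinearMap.id := by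
    ext a; simp [h1]
  rw [this, LinearMap.rTensor_id, LinearMap.id_apply]

end Average

lemma coactₗ_base_mul {μ : Ω} (hμ : μ ∈ C.baseForms) (w : Ω) :
    C.coactₗ (μ * w) = μ • C.coactₗ w := by
  apply (GradedTensorProduct.of ℂ 𝒜 X.grading).injective
  rw [of_coactₗ, map_mul, ← tmul_one_mul_of, ← (C.mem_baseForms μ).1 hμ]
  rfl

lemma coactDeg_base_mul (k : ℕ) {μ : Ω} (hμ : μ ∈ C.baseForms) (w : Ω) :
    C.coactDeg k (μ * w) = μ • C.coactDeg k w := by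
  rw [coactDeg, LinearMap.comp_apply, C.coactₗ_base_mul hμ, LinearMap.comp_apply]
  generalize C.coactₗ w = t
  induction t with
  | zero => simp
  | add x y hx hy => simp only [smul_add, map_add, hx, hy]
  | tmul a v => simp [TensorProduct.smul_tmul']

lemma smulLift_eq_zero_of_mem_balancing {z : Ω ⊗[ℂ] Ω} (hz : z ∈ C.balancing) :
    smulLift C.coactₗ z = 0 := by
  apply (GradedTensorProduct.of ℂ 𝒜 X.grading).injective
  rw [← canonicalMap_mk, (Submodule.Quotient.mk_eq_zero _).2 hz, map_zero, map_zero]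

lemma coactDeg_mul'_of_mem_baseSpan {k : ℕ} (n : ℕ) {u : Ω ⊗[ℂ] Ω} (hu : u ∈ C.baseSpan k) :
    C.coactDeg n (LinearMap.mul' ℂ Ω u) = smulLift (C.coactDeg n) u := by
  induction hu using Submodule.span_induction with
  | zero => simp
  | add x y _ _ hx hy => simp only [map_add, hx, hy]
  | smul c x _ hx => simp only [map_smul, hx]
  | mem x hx =>
    obtain ⟨μ, hμ, r, -, rfl⟩ := hx
    rw [LinearMap.mul'_apply, C.coactDeg_base_mul n hμ, smulLift_tmul]

lemma smulLift_coactDeg_of_mem_baseSpan {k n : ℕ} (hn : k < n) {u : Ω ⊗[ℂ] Ω}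
    (hu : u ∈ C.baseSpan k) : smulLift (C.coactDeg n) u = 0 := by
  induction hu using Submodule.span_induction with
  | zero => simp
  | add x y _ _ hx hy => rw [map_add, hx, hy, add_zero]
  | smul c x _ hx => rw [map_smul, hx, smul_zero]
  | mem x hx =>
    obtain ⟨μ, hμ, r, hr, rfl⟩ := hx
    rw [smulLift_tmul, C.coactDeg_of_mem hn hr, smul_zero]

/-- For `u = ∑ μ ⊗ r` with `μ` in the base, this is `a ⊗ μ r ~ a μ ⊗ r`. -/
lemma tmul_mul'_sub_smul_mem_balancing {k : ℕ} {u : Ω ⊗[ℂ] Ω} (hu : u ∈ C.baseSpan k) (a : Ω) :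
    a ⊗ₜ LinearMap.mul' ℂ Ω u - a • u ∈ C.balancing := by
  induction hu using Submodule.span_induction with
  | zero => simp
  | add x y _ _ hx hy =>
    convert add_mem hx hy using 1
    rw [map_add, TensorProduct.tmul_add, smul_add]
    abel
  | smul c x _ hx =>
    convert Submodule.smul_mem _ c hx using 1
    rw [map_smul, TensorProduct.tmul_smul, smul_sub, smul_comm]
  | mem x hx =>
    obtain ⟨μ, hμ, r, -, rfl⟩ := hx
    rw [← neg_sub]
    exact neg_mem (Submodule.subset_span ⟨a, r, μ, hμ, rfl⟩)

/-- Descent along the filtration by the leading degree of the second factor: modulo balancing, an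
element of the kernel can be moved one step down while staying in the kernel, until it is zero. -/
lemma mem_balancing_of_smulLift_eq_zero (hH : IsQuantumGroup H) {z : Ω ⊗[ℂ] Ω}
    (hz : smulLift C.coactₗ z = 0) : z ∈ C.balancing := by
  obtain ⟨h, h1, hinv⟩ := hH.exists_haar
  set F : ℕ → Submodule ℂ (Ω ⊗[ℂ] Ω) :=
    fun k => Submodule.span ℂ {z | ∃ a, ∃ b ∈ C.filt k, z = a ⊗ₜ[ℂ] b} with hF
  have Fmono : ∀ {k l}, k ≤ l → F k ≤ F l := fun hkl => Submodule.span_mono (by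
    rintro _ ⟨a, b, hb, rfl⟩
    exact ⟨a, b, C.filt_mono hkl hb, rfl⟩)
  have hex : ∀ z, ∃ k, z ∈ F k := fun z => by
    induction z with
    | zero => exact ⟨0, zero_mem _⟩
    | add x y hx hy =>
      obtain ⟨k, hk⟩ := hx
      obtain ⟨l, hl⟩ := hy
      exact ⟨max k l, add_mem (Fmono (le_max_left _ _) hk) (Fmono (le_max_right _ _) hl)⟩
    | tmul a b =>
      obtain ⟨k, hk⟩ := C.exists_mem_filt b
      exact ⟨k, Submodule.subset_span ⟨a, b, hk, rfl⟩⟩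
  obtain ⟨k, hk⟩ := hex z
  induction k generalizing z with
  | zero =>
    suffices z = 0 by rw [this]; exact zero_mem _
    clear hz
    induction hk using Submodule.span_induction with
    | zero => rfl
    | add x y _ _ hx hy => rw [hx, hy, add_zero]
    | smul c x _ hx => rw [hx, smul_zero]
    | mem x hx =>
      obtain ⟨a, b, hb, rfl⟩ := hx
      rw [filt_zero, Submodule.mem_bot] at hb
      rw [hb, TensorProduct.tmul_zero]
  | succ k ih =>
    obtain ⟨l, hl, hl'⟩ := C.exists_linear_topSpace k
    have key : ∀ z ∈ F (k + 1), ∃ z' ∈ F k,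
        z - C.average h l (smulLift (C.coactDeg k) z) - z' ∈ C.balancing := by
      intro z hz
      induction hz using Submodule.span_induction with
      | zero => exact ⟨0, zero_mem _, by simp⟩
      | add x y _ _ hx hy =>
        obtain ⟨x', hx', hx⟩ := hx
        obtain ⟨y', hy', hy⟩ := hy
        refine ⟨x' + y', add_mem hx' hy', ?_⟩
        convert add_mem hx hy using 1
        simp only [map_add]
        abel
      | smul c x _ hx =>
        obtain ⟨x', hx', hx⟩ := hx
        refine ⟨c • x', Submodule.smul_mem _ _ hx', ?_⟩
        convert Submodule.smul_mem _ c hx using 1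
        simp only [map_smul, smul_sub]
      | mem x hx =>
        obtain ⟨a, b, hb, rfl⟩ := hx
        set u := C.average h l (C.coactDeg k b) with hu
        have hu1 := C.average_mem hl hinv hb
        have hu2 := C.smulLift_average hl' h1 b
        rw [← hu] at hu1 hu2
        -- `b` and the product of `u` have the same component of degree `k`, and neither has higher
        -- ones, so the difference drops one filtration step.
        refine ⟨a ⊗ₜ (b - LinearMap.mul' ℂ Ω u), Submodule.subset_span ⟨_, _, ?_, rfl⟩, ?_⟩
        · rw [mem_filt]
          intro n hn
          rw [map_sub, C.coactDeg_mul'_of_mem_baseSpan n hu1]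
          rcases hn.eq_or_lt with rfl | hn
          · rw [hu2, sub_self]
          · rw [C.mem_filt.1 hb n hn, C.smulLift_coactDeg_of_mem_baseSpan hn hu1, sub_zero]
        · have hbal := C.tmul_mul'_sub_smul_mem_balancing hu1 a
          convert hbal using 1
          rw [smulLift_tmul, average_smul, ← hu, TensorProduct.tmul_sub]
          abel
    obtain ⟨z', hz', hzz⟩ := key z hk
    -- The correction is the average of the degree `k` component of the image of `z`, hence zero for
    -- `z` in the kernel. The individual terms `a u` need not vanish; only their sum does.
    have hz0 : smulLift (C.coactDeg k) z = 0 := by rw [smulLift_coactDeg, hz, map_zero]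
    rw [hz0, map_zero, sub_zero] at hzz
    have hz'0 : smulLift C.coactₗ z' = 0 := by
      have := C.smulLift_eq_zero_of_mem_balancing hzz
      rwa [map_sub, hz, zero_sub, neg_eq_zero] at this
    have := add_mem hzz (ih hz'0 hz')
    rwa [sub_add_cancel] at this

theorem canonicalMap_bijective (hH : IsQuantumGroup H) : Function.Bijective C.canonicalMap := by
  refine ⟨(injective_iff_map_eq_zero _).2 fun z hz => ?_, C.canonicalMap_surjective⟩
  obtain ⟨z, rfl⟩ := Submodule.Quotient.mk_surjective _ z
  rw [canonicalMap_mk] at hz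
  exact (Submodule.Quotient.mk_eq_zero _).2 (C.mem_balancing_of_smulLift_eq_zero hH
    ((GradedTensorProduct.of ℂ 𝒜 X.grading).map_eq_zero_iff.1 hz))

end Calculus

end Calculus

/-! ### The antipode of `Γ^∧` preserves degrees. -/

namespace FODC

variable {H Γ : Type*} [Ring H] [HopfAlgebra ℂ H] [AddCommGroup Γ] [Module ℂ Γ]
    [Module H Γ] [Module Hᵐᵒᵖ Γ] [SMulCommClass H Hᵐᵒᵖ Γ]
    [IsScalarTower ℂ H Γ] [IsScalarTower ℂ Hᵐᵒᵖ Γ] {X : FODC H Γ} (hX : X.IsBicovariant)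

lemma parity_mem {n : ℕ} {v : X.Env} (hv : v ∈ X.grading n) :
    parity X.grading v ∈ X.grading n := by
  rw [parity_of_mem X.grading hv]
  exact Submodule.smul_mem _ _ hv

lemma antipode_mem {n : ℕ} {v : X.Env} (hv : v ∈ X.grading n) :
    antipode hX v ∈ X.grading n := by
  have hpow : ∀ n, ∀ v ∈ LinearMap.range X.ιΓ ^ n, antipode hX v ∈ X.grading n := by
    intro n
    induction n with
    | zero =>
      intro v hv
      obtain ⟨c, rfl⟩ := Submodule.mem_one.1 (pow_zero (LinearMap.range X.ιΓ) ▸ hv)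
      rw [Algebra.algebraMap_eq_smul_one, map_smul, antipode_one]
      exact Submodule.smul_mem _ _ (SetLike.GradedOne.one_mem (A := X.grading))
    | succ n ih =>
      intro v hv
      rw [pow_succ'] at hv
      induction hv using Submodule.mul_induction_on' with
      | mem_mul_mem a ha b hb =>
        obtain ⟨γ, rfl⟩ := ha
        obtain ⟨t, rfl⟩ := X.gdh_surjective γ
        rw [ιΓ_gdh]
        induction t with
        | zero => simp
        | add x y hx hy =>
          rw [map_add, map_add, add_mul, map_add]; exact add_mem hx hy
        | tmul g h =>
          simp only [TensorProduct.map_tmul, LinearMap.mul'_apply, AlgHom.toLinearMap_apply,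
            mul_assoc, antipode_ιH_mul, antipode_dH_mul]
          have := SetLike.mul_mem_graded (parity_mem (ih b hb))
            (SetLike.mul_mem_graded (X.dH_mem (HopfAlgebra.antipode ℂ h))
              (X.ιH_mem (HopfAlgebra.antipode ℂ g)))
          rwa [add_zero] at this
      | add a _ b _ ha hb => rw [map_add]; exact add_mem ha hb
  rw [grading] at hv
  induction hv using Submodule.mul_induction_on' with
  | mem_mul_mem a ha b hb =>
    obtain ⟨h, rfl⟩ := ha
    rw [AlgHom.toLinearMap_apply, antipode_ιH_mul, ← add_zero n]
    exact SetLike.mul_mem_graded (hpow n b hb) (X.ιH_mem _)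
  | add a _ b _ ha hb => rw [map_add]; exact add_mem ha hb

end FODC

/-! ### Convolution of linear maps on `Γ^∧`. -/

section Calculus

variable {H P Γ Ω : Type*} [Ring H] [HopfAlgebra ℂ H] [StarRing H] [StarModule ℂ H]
    [Ring P] [Algebra ℂ P] [StarRing P] [StarModule ℂ P]
    [AddCommGroup Γ] [Module ℂ Γ] [Module H Γ] [Module Hᵐᵒᵖ Γ] [SMulCommClass H Hᵐᵒᵖ Γ]
    [IsScalarTower ℂ H Γ] [IsScalarTower ℂ Hᵐᵒᵖ Γ] [Ring Ω] [Algebra ℂ Ω]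
    {ζ : QPBundle H P} {X : FODC H Γ} {𝒜 : ℕ → Submodule ℂ Ω} [GradedAlgebra 𝒜]
    (C : Calculus ζ X 𝒜)

namespace Calculus

section Convolution

variable {T : Type*} [Ring T] [Algebra ℂ T]

/-- The convolution product of linear maps from `Γ^∧` to an algebra. -/
def convTo (u v : X.Env →ₗ[ℂ] T) : X.Env →ₗ[ℂ] T :=
  LinearMap.mul' ℂ T ∘ₗ TensorProduct.map u v ∘ₗ C.comulₗ

variable (X T) in
/-- The unit of the convolution product. -/
def convToOne : X.Env →ₗ[ℂ] T := Algebra.linearMap ℂ T ∘ₗ X.counit.toLinearMap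

lemma convTo_assoc (u v w : X.Env →ₗ[ℂ] T) :
    C.convTo (C.convTo u v) w = C.convTo u (C.convTo v w) := by
  letI := FODC.coalgebraEnv C.bicov
  exact congrArg WithConv.ofConv
    (mul_assoc (WithConv.toConv u) (WithConv.toConv v) (WithConv.toConv w))

lemma one_convTo (u : X.Env →ₗ[ℂ] T) : C.convTo (convToOne X T) u = u := by
  letI := FODC.coalgebraEnv C.bicov
  exact congrArg WithConv.ofConv (one_mul (WithConv.toConv u))

lemma convTo_one (u : X.Env →ₗ[ℂ] T) : C.convTo u (convToOne X T) = u := by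
  letI := FODC.coalgebraEnv C.bicov
  exact congrArg WithConv.ofConv (mul_one (WithConv.toConv u))

lemma comp_convTo {T' : Type*} [Ring T'] [Algebra ℂ T'] (e : T →ₐ[ℂ] T') (u v : X.Env →ₗ[ℂ] T) :
    e.toLinearMap ∘ₗ C.convTo u v = C.convTo (e.toLinearMap ∘ₗ u) (e.toLinearMap ∘ₗ v) := by
  ext x
  simp only [convTo, LinearMap.comp_apply]
  generalize C.comulₗ x = t
  induction t with
  | zero => simp
  | add x y hx hy => simp only [map_add, hx, hy]
  | tmul a b => simp

lemma comp_convToOne {T' : Type*} [Ring T'] [Algebra ℂ T'] (e : T →ₐ[ℂ] T') :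
    e.toLinearMap ∘ₗ convToOne X T = convToOne X T' := by
  ext x
  simp [convToOne]

/-- The map `a ⊗ v ↦ e(a) u(v)`. -/
def pairing (e : Ω →ₐ[ℂ] T) (u : X.Env →ₗ[ℂ] T) : Ω ⊗[ℂ] X.Env →ₗ[ℂ] T :=
  LinearMap.mul' ℂ T ∘ₗ TensorProduct.map e.toLinearMap u

@[simp] lemma pairing_tmul (e : Ω →ₐ[ℂ] T) (u : X.Env →ₗ[ℂ] T) (a : Ω) (v : X.Env) :
    pairing e u (a ⊗ₜ v) = e a * u v := rfl

lemma pairing_smul (e : Ω →ₐ[ℂ] T) (u : X.Env →ₗ[ℂ] T) (a : Ω) (t : Ω ⊗[ℂ] X.Env) :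
    pairing e u (a • t) = e a * pairing e u t := by
  induction t with
  | zero => simp
  | add x y hx hy => simp only [smul_add, map_add, hx, hy, mul_add]
  | tmul b v => simp [TensorProduct.smul_tmul', mul_assoc]

/-- Coassociativity: `w₀ (u * v)(w₁) = (w₀ u(w₁)) v(w₂)`. -/
lemma pairing_convTo (e : Ω →ₐ[ℂ] T) (u v : X.Env →ₗ[ℂ] T) (w : Ω) :
    pairing e (C.convTo u v) (C.coactₗ w) =
      LinearMap.mul' ℂ T (TensorProduct.map (pairing e u ∘ₗ C.coactₗ) v (C.coactₗ w)) := by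
  set S : Ω ⊗[ℂ] (X.Env ⊗[ℂ] X.Env) →ₗ[ℂ] T := LinearMap.mul' ℂ T ∘ₗ
    TensorProduct.map e.toLinearMap (LinearMap.mul' ℂ T ∘ₗ TensorProduct.map u v) with hS
  have h2 : ∀ t : Ω ⊗[ℂ] X.Env, pairing e (C.convTo u v) t = S (C.comulₗ.lTensor Ω t) :=
    fun t => by
      induction t with
      | zero => simp
      | add x y hx hy => simp only [map_add, hx, hy]
      | tmul b v => rfl
  have h3 : ∀ t : Ω ⊗[ℂ] X.Env, S (TensorProduct.assoc ℂ Ω X.Env X.Env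
      (C.coactₗ.rTensor X.Env t)) =
      LinearMap.mul' ℂ T (TensorProduct.map (pairing e u ∘ₗ C.coactₗ) v t) := fun t => by
    induction t with
    | zero => simp
    | add x y hx hy => simp only [map_add, hx, hy]
    | tmul b z =>
      simp only [LinearMap.rTensor_tmul, TensorProduct.map_tmul, LinearMap.comp_apply,
        LinearMap.mul'_apply]
      generalize C.coactₗ b = q
      induction q with
      | zero => simp
      | add x y hx hy => simp only [map_add, TensorProduct.add_tmul, add_mul, hx, hy]
      | tmul c f => simp [hS, mul_assoc]
  rw [h2, ← C.coassoc, h3]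

lemma pairing_convToOne (e : Ω →ₐ[ℂ] T) (w : Ω) :
    pairing e (convToOne X T) (C.coactₗ w) = e w := by
  conv_rhs => rw [← C.counit w]
  generalize C.coactₗ w = t
  induction t with
  | zero => simp
  | add x y hx hy => simp only [map_add, hx, hy]
  | tmul b v =>
    simp [convToOne, Algebra.algebraMap_eq_smul_one]

/-- A linear map on `Γ^∧` is determined by its pairing with the coaction on `Ω`. -/
lemma eq_of_pairing_eq (e : Ω →ₐ[ℂ] T) {u v : X.Env →ₗ[ℂ] T}
    (h : ∀ w, pairing e u (C.coactₗ w) = pairing e v (C.coactₗ w)) : u = v := by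
  ext ϑ
  -- The pairing is left `Ω`-linear and every `1 ⊗ ϑ` is an `Ω`-combination of coactions, so only
  -- surjectivity of the canonical map is needed.
  obtain ⟨z, hz⟩ := C.one_tmul_mem_range ϑ
  have h1 : pairing e u (smulLift C.coactₗ z) = pairing e v (smulLift C.coactₗ z) := by
    clear hz
    induction z with
    | zero => simp
    | add x y hx hy => simp only [map_add, hx, hy]
    | tmul a b => rw [smulLift_tmul, pairing_smul, pairing_smul, h]
  rw [hz] at h1
  simpa using h1

end Convolution

/-! ### Covariance in terms of convolution -/

/-- The map `ϑ ↦ 1 ⊗ ϑ`. -/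
abbrev inR (X : FODC H Γ) (𝒜 : ℕ → Submodule ℂ Ω) [GradedAlgebra 𝒜] :
    X.Env →ₗ[ℂ] 𝒜 ᵍ⊗[ℂ] X.grading :=
  (GradedTensorProduct.includeRight 𝒜 X.grading).toLinearMap

/-- The map `ϑ ↦ f(ϑ) ⊗ 1`. -/
abbrev inL (𝒜 : ℕ → Submodule ℂ Ω) [GradedAlgebra 𝒜] (f : X.Env →ₗ[ℂ] Ω) :
    X.Env →ₗ[ℂ] 𝒜 ᵍ⊗[ℂ] X.grading :=
  (GradedTensorProduct.includeLeft 𝒜 X.grading).toLinearMap ∘ₗ f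

/-- The antipode is the convolution inverse of the identity of `Γ^∧`; composing with the algebra map
`ϑ ↦ 1 ⊗ ϑ` preserves convolution. -/
lemma inR_convTo_antipode : C.convTo (inR X 𝒜) (inR X 𝒜 ∘ₗ FODC.antipode C.bicov) =
    convToOne X _ := by
  have h : C.convTo LinearMap.id (FODC.antipode C.bicov) = convToOne X X.Env :=
    LinearMap.ext (FODC.mul_antipode_lTensor_comulₗ C.bicov)
  rw [← comp_convToOne (GradedTensorProduct.includeRight 𝒜 X.grading), ← h, comp_convTo]
  rfl

lemma antipode_convTo_inR : C.convTo (inR X 𝒜 ∘ₗ FODC.antipode C.bicov) (inR X 𝒜) =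
    convToOne X _ := by
  have h : C.convTo (FODC.antipode C.bicov) LinearMap.id = convToOne X X.Env :=
    LinearMap.ext (FODC.mul_antipode_rTensor_comulₗ C.bicov)
  rw [← comp_convToOne (GradedTensorProduct.includeRight 𝒜 X.grading), ← h, comp_convTo]
  rfl

/-- The adjoint coaction is a conjugation in the convolution algebra. -/
lemma rTensor_Ad {f : X.Env →ₗ[ℂ] Ω} (hf : IsGradedMap X 𝒜 f) :
    (GradedTensorProduct.of ℂ 𝒜 X.grading).toLinearMap ∘ₗ f.rTensor X.Env ∘ₗ C.Ad =
      C.convTo (C.convTo (inR X 𝒜 ∘ₗ FODC.antipode C.bicov) (inL 𝒜 f)) (inR X 𝒜) := by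
  set R : (X.Env ⊗[ℂ] X.Env) ⊗[ℂ] X.Env →ₗ[ℂ] 𝒜 ᵍ⊗[ℂ] X.grading := LinearMap.mul' ℂ _ ∘ₗ
    TensorProduct.map (LinearMap.mul' ℂ _ ∘ₗ TensorProduct.map
      (inR X 𝒜 ∘ₗ FODC.antipode C.bicov) (inL 𝒜 f)) (inR X 𝒜) with hR
  set L : (X.Env ⊗[ℂ] X.Env) ⊗[ℂ] X.Env →ₗ[ℂ] 𝒜 ᵍ⊗[ℂ] X.grading :=
    (GradedTensorProduct.of ℂ 𝒜 X.grading).toLinearMap ∘ₗ f.rTensor X.Env ∘ₗ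
      (LinearMap.mul' ℂ X.Env ∘ₗ (FODC.antipode C.bicov).rTensor X.Env).lTensor X.Env ∘ₗ
        (TensorProduct.assoc ℂ X.Env X.Env X.Env).toLinearMap ∘ₗ
          ((GradedTensorProduct.of ℂ X.grading X.grading).symm.toLinearMap ∘ₗ
            (GradedTensorProduct.comm X.grading X.grading).toLinearMap ∘ₗ
              (GradedTensorProduct.of ℂ X.grading X.grading).toLinearMap).rTensor X.Env with hL
  have hRL : L = R := by
    refine TensorProduct.ext_threefold fun a b c => ?_
    induction a using DirectSum.Decomposition.inductionOn X.grading with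
    | zero => simp
    | add x y hx hy => simp only [TensorProduct.add_tmul, map_add, hx, hy]
    | @homogeneous i a =>
      induction b using DirectSum.Decomposition.inductionOn X.grading with
      | zero => simp
      | add x y hx hy => simp only [TensorProduct.add_tmul, TensorProduct.tmul_add, map_add, hx, hy]
      | @homogeneous j b =>
        have hswap : GradedTensorProduct.comm X.grading X.grading
            (GradedTensorProduct.of ℂ X.grading X.grading ((a : X.Env) ⊗ₜ[ℂ] (b : X.Env))) =
            (-1 : ℂ) ^ (j * i) • GradedTensorProduct.of ℂ X.grading X.grading
              ((b : X.Env) ⊗ₜ[ℂ] (a : X.Env)) := by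
          refine (GradedTensorProduct.comm_coe_tmul_coe X.grading X.grading a b).trans ?_
          rcases Nat.even_or_odd (j * i) with h | h <;> simp [h.neg_one_pow]
        -- Because `f` and `S` preserve degrees, the Koszul sign of this product equals the sign of
        -- the graded swap in `Ad`.
        have h1 : (1 ᵍ⊗ₜ[ℂ] FODC.antipode C.bicov (a : X.Env) : 𝒜 ᵍ⊗[ℂ] X.grading) *
            f b ᵍ⊗ₜ[ℂ] 1 = (-1 : ℂ) ^ (j * i) •
              (f b ᵍ⊗ₜ[ℂ] FODC.antipode C.bicov (a : X.Env)) := by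
          rw [tmul_mul_tmul_of_mem 𝒜 X.grading (FODC.antipode_mem C.bicov a.2) (hf j b b.2),
            one_mul, mul_one, mul_comm i j]
        have h2 : (f b ᵍ⊗ₜ[ℂ] FODC.antipode C.bicov (a : X.Env) : 𝒜 ᵍ⊗[ℂ] X.grading) *
            1 ᵍ⊗ₜ[ℂ] c = f b ᵍ⊗ₜ[ℂ] (FODC.antipode C.bicov (a : X.Env) * c) := by
          rw [tmul_mul_tmul_of_mem_zero 𝒜 X.grading (SetLike.GradedOne.one_mem (A := 𝒜)), mul_one]
        have hRv : R (((a : X.Env) ⊗ₜ[ℂ] (b : X.Env)) ⊗ₜ[ℂ] c) =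
            ((1 ᵍ⊗ₜ[ℂ] FODC.antipode C.bicov (a : X.Env) : 𝒜 ᵍ⊗[ℂ] X.grading) *
              f b ᵍ⊗ₜ[ℂ] 1) * 1 ᵍ⊗ₜ[ℂ] c := rfl
        rw [hRv, h1, smul_mul_assoc, h2]
        simp only [hL, LinearMap.comp_apply, LinearMap.rTensor_tmul, LinearEquiv.coe_coe,
          AlgEquiv.toLinearMap_apply, hswap, map_smul, LinearEquiv.symm_apply_apply,
          ← TensorProduct.smul_tmul']
        rfl
  have h3 : (GradedTensorProduct.of ℂ 𝒜 X.grading).toLinearMap ∘ₗ f.rTensor X.Env ∘ₗ C.Ad =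
      L ∘ₗ C.comulₗ.rTensor X.Env ∘ₗ C.comulₗ := rfl
  have h4 : C.convTo (C.convTo (inR X 𝒜 ∘ₗ FODC.antipode C.bicov) (inL 𝒜 f)) (inR X 𝒜) =
      R ∘ₗ C.comulₗ.rTensor X.Env ∘ₗ C.comulₗ := by
    ext v
    simp only [convTo, LinearMap.comp_apply]
    generalize C.comulₗ v = t
    induction t with
    | zero => simp
    | add x y hx hy => simp only [map_add, hx, hy]
    | tmul a b => rfl
  rw [h3, h4, hRL]

/-- Covariance of `f` with respect to the adjoint coaction, in terms of convolution. -/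
def IsCovariant (f : X.Env →ₗ[ℂ] Ω) : Prop :=
  C.convTo (inR X 𝒜) (C.coact.toLinearMap ∘ₗ f) = C.convTo (inL 𝒜 f) (inR X 𝒜)

/-- `ϑ ↦ 1 ⊗ ϑ` is convolution invertible, so it can be moved to the other side. -/
lemma isCovariant_iff_eq_conj (f : X.Env →ₗ[ℂ] Ω) : C.IsCovariant f ↔
    C.coact.toLinearMap ∘ₗ f =
      C.convTo (C.convTo (inR X 𝒜 ∘ₗ FODC.antipode C.bicov) (inL 𝒜 f)) (inR X 𝒜) := by
  rw [IsCovariant]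
  constructor
  · intro h
    rw [convTo_assoc, ← h, ← convTo_assoc, antipode_convTo_inR, one_convTo]
  · intro h
    rw [h, ← convTo_assoc, ← convTo_assoc, inR_convTo_antipode, one_convTo]

lemma isCovariant_iff {f : X.Env →ₗ[ℂ] Ω} (hf : IsGradedMap X 𝒜 f) :
    f.rTensor X.Env ∘ₗ C.Ad = C.coactₗ ∘ₗ f ↔ C.IsCovariant f := by
  rw [isCovariant_iff_eq_conj, ← C.rTensor_Ad hf]
  constructor
  · intro h
    rw [h]
    rfl
  · intro h
    ext v
    exact (GradedTensorProduct.of ℂ 𝒜 X.grading).injective (LinearMap.congr_fun h v).symm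

/-- The convolution inverse of a covariant map is covariant. -/
lemma IsCovariant.inverse {C : Calculus ζ X 𝒜} {f f' : X.Env →ₗ[ℂ] Ω} (hf : C.IsCovariant f)
    (h : C.conv f f' = convOne X) (h' : C.conv f' f = convOne X) : C.IsCovariant f' := by
  rw [isCovariant_iff_eq_conj] at hf ⊢
  set A : (X.Env →ₗ[ℂ] Ω) → (X.Env →ₗ[ℂ] 𝒜 ᵍ⊗[ℂ] X.grading) :=
    fun f => C.coact.toLinearMap ∘ₗ f with hA
  have hi : C.convTo (inL 𝒜 f) (inL 𝒜 f') = convToOne X _ := by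
    rw [← comp_convToOne (GradedTensorProduct.includeLeft 𝒜 X.grading),
      ← show C.convTo f f' = convToOne X Ω from h, comp_convTo]
  have hA1 : C.convTo (A f') (A f) = convToOne X _ := by
    rw [← comp_convToOne C.coact, ← show C.convTo f' f = convToOne X Ω from h', comp_convTo]
  -- `Δ f'` is a left inverse of `Δ f`, and the conjugate of `f' ⊗ 1` is a right inverse; hence they
  -- agree.
  have key : C.convTo (A f) (C.convTo (C.convTo (inR X 𝒜 ∘ₗ FODC.antipode C.bicov) (inL 𝒜 f'))
      (inR X 𝒜)) = convToOne X _ := by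
    rw [hA]
    simp only [hf]
    simp only [convTo_assoc]
    rw [← C.convTo_assoc (inR X 𝒜) (inR X 𝒜 ∘ₗ FODC.antipode C.bicov), inR_convTo_antipode,
      one_convTo, ← C.convTo_assoc (inL 𝒜 f), hi, one_convTo, antipode_convTo_inR]
  calc A f' = C.convTo (A f') (convToOne X _) := (C.convTo_one _).symm
    _ = _ := by rw [← key, ← convTo_assoc, hA1, one_convTo]

/-- The map `w ↦ w₀ f(w₁)`. -/
def transform (f : X.Env →ₗ[ℂ] Ω) : Ω →ₗ[ℂ] Ω := LinearMap.mul' ℂ Ω ∘ₗ f.lTensor Ω ∘ₗ C.coactₗ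

lemma transform_apply (f : X.Env →ₗ[ℂ] Ω) (w : Ω) :
    C.transform f w = pairing (AlgHom.id ℂ Ω) f (C.coactₗ w) := rfl

lemma transform_injective : Function.Injective C.transform := fun _ _ h =>
  C.eq_of_pairing_eq (AlgHom.id ℂ Ω) (LinearMap.congr_fun h)

lemma coact_transform (f : X.Env →ₗ[ℂ] Ω) (w : Ω) : C.coact (C.transform f w) =
    pairing (GradedTensorProduct.includeLeft 𝒜 X.grading)
      (C.convTo (inR X 𝒜) (C.coact.toLinearMap ∘ₗ f)) (C.coactₗ w) := by
  have h1 : ∀ t : Ω ⊗[ℂ] X.Env, pairing (GradedTensorProduct.includeLeft 𝒜 X.grading) (inR X 𝒜) t =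
      GradedTensorProduct.of ℂ 𝒜 X.grading t := fun t => by
    induction t with
    | zero => simp
    | add x y hx hy => simp only [map_add, hx, hy]
    | tmul a v => exact GradedTensorProduct.tmul_one_mul_one_tmul 𝒜 X.grading a v
  rw [pairing_convTo, transform_apply]
  generalize C.coactₗ w = t
  induction t with
  | zero => simp
  | add x y hx hy => simp only [map_add, hx, hy]
  | tmul a v =>
    simp only [pairing_tmul, map_mul, TensorProduct.map_tmul, LinearMap.comp_apply, h1, of_coactₗ,
      LinearMap.mul'_apply]
    rfl

lemma of_rTensor_transform (f : X.Env →ₗ[ℂ] Ω) (w : Ω) :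
    GradedTensorProduct.of ℂ 𝒜 X.grading ((C.transform f).rTensor X.Env (C.coactₗ w)) =
    pairing (GradedTensorProduct.includeLeft 𝒜 X.grading)
      (C.convTo (inL 𝒜 f) (inR X 𝒜)) (C.coactₗ w) := by
  have h1 : ∀ t : Ω ⊗[ℂ] X.Env, pairing (GradedTensorProduct.includeLeft 𝒜 X.grading) (inL 𝒜 f) t =
      GradedTensorProduct.includeLeft 𝒜 X.grading (pairing (AlgHom.id ℂ Ω) f t) := fun t => by
    induction t with
    | zero => simp only [map_zero]
    | add x y hx hy => simp only [map_add, hx, hy]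
    | tmul a v => exact (map_mul (GradedTensorProduct.includeLeft 𝒜 X.grading) a (f v)).symm
  rw [pairing_convTo]
  generalize C.coactₗ w = t
  induction t with
  | zero => simp
  | add x y hx hy => simp only [map_add, hx, hy]
  | tmul a v =>
    simp only [TensorProduct.map_tmul, LinearMap.comp_apply, h1, LinearMap.mul'_apply,
      LinearMap.rTensor_tmul, ← transform_apply]
    exact (GradedTensorProduct.tmul_one_mul_one_tmul 𝒜 X.grading _ v).symm

/-- Both sides of colinearity of `w ↦ w₀ f(w₁)` are pairings of the coaction with the two sides of
the covariance identity, and such pairings determine the map. -/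
lemma isCovariant_iff_transform (f : X.Env →ₗ[ℂ] Ω) : C.IsCovariant f ↔
    (C.transform f).rTensor X.Env ∘ₗ C.coactₗ = C.coactₗ ∘ₗ C.transform f := by
  constructor
  · intro h
    ext w
    apply (GradedTensorProduct.of ℂ 𝒜 X.grading).injective
    rw [LinearMap.comp_apply, LinearMap.comp_apply, of_rTensor_transform, of_coactₗ,
      coact_transform, h]
  · intro h
    refine C.eq_of_pairing_eq (GradedTensorProduct.includeLeft 𝒜 X.grading) fun w => ?_
    rw [← coact_transform, ← of_rTensor_transform, ← of_coactₗ]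
    exact congrArg _ (LinearMap.congr_fun h w).symm

/-- `w₀ f(w₁) g(w₂)` is `(F_f ⊗ g)` applied to the coaction of `w`; colinearity of `F_f` turns it
into the coaction of `F_f(w)`. Thus `f` acts first, matching the reversed composition in the group
of automorphisms. -/
lemma transform_conv {f : X.Env →ₗ[ℂ] Ω} (hf : C.IsCovariant f) (g : X.Env →ₗ[ℂ] Ω) (w : Ω) :
    C.transform (C.conv f g) w = C.transform g (C.transform f w) := by
  have h := LinearMap.congr_fun ((C.isCovariant_iff_transform f).1 hf) w
  have h1 := C.pairing_convTo (AlgHom.id ℂ Ω) f g w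
  refine h1.trans ?_
  have h2 : C.transform g (C.transform f w) = LinearMap.mul' ℂ Ω (g.lTensor Ω
    (C.coactₗ (C.transform f w))) := rfl
  rw [h2, ← LinearMap.comp_apply C.coactₗ, ← h, LinearMap.comp_apply, ← LinearMap.comp_apply
    (g.lTensor Ω), LinearMap.lTensor_comp_rTensor]
  rfl

lemma transform_convOne : C.transform (convOne X) = LinearMap.id :=
  LinearMap.ext (C.pairing_convToOne (AlgHom.id ℂ Ω))

lemma transform_one (f : X.Env →ₗ[ℂ] Ω) : C.transform f 1 = f 1 := by
  rw [transform_apply, C.isFormCoaction_coactₗ.one]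
  simp

lemma transform_base_mul (f : X.Env →ₗ[ℂ] Ω) {μ : Ω} (hμ : μ ∈ C.baseForms) (w : Ω) :
    C.transform f (μ * w) = μ * C.transform f w := by
  rw [transform_apply, C.coactₗ_base_mul hμ, pairing_smul]
  rfl

lemma transform_mem {f : X.Env →ₗ[ℂ] Ω} (hf : IsGradedMap X 𝒜 f) {n : ℕ} {w : Ω} (hw : w ∈ 𝒜 n) :
    C.transform f w ∈ 𝒜 n := by
  have key : ∀ x ∈ totalDegree 𝒜 X.grading n, pairing (AlgHom.id ℂ Ω) f
      ((GradedTensorProduct.of ℂ 𝒜 X.grading).symm x) ∈ 𝒜 n := by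
    intro x hx
    induction hx using Submodule.span_induction with
    | zero => simp
    | add x x' _ _ hx hx' => rw [map_add, map_add]; exact add_mem hx hx'
    | smul c x _ hx => rw [map_smul, map_smul]; exact Submodule.smul_mem _ _ hx
    | mem x hx =>
      obtain ⟨i, j, rfl, a, ha, b, hb, rfl⟩ := hx
      exact SetLike.mul_mem_graded ha (hf j b hb)
  exact key _ (C.coact_degree n w hw)

/-- If `w ↦ w₀ f(w₁)` preserves degrees then so does `f`. -/
lemma isGradedMap_of_transform {f : X.Env →ₗ[ℂ] Ω}
    (hF : ∀ n, ∀ w ∈ 𝒜 n, C.transform f w ∈ 𝒜 n) : IsGradedMap X 𝒜 f := by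
  intro k
  induction k using Nat.strong_induction_on with
  | _ k ih =>
    intro ϑ hϑ
    obtain ⟨s, hs, hsϑ⟩ := C.exists_topSpace hϑ
    have h1 : f ϑ = pairing (AlgHom.id ℂ Ω) f (smulLift (C.coactDeg k) s) := by
      rw [hsϑ]; simp
    rw [h1]
    clear h1 hsϑ
    induction hs using Submodule.span_induction with
    | zero => simp
    | add x y _ _ hx hy => rw [map_add, map_add]; exact add_mem hx hy
    | smul c x _ hx => rw [map_smul, map_smul]; exact Submodule.smul_mem _ _ hx
    | mem x hx =>
      obtain ⟨p, hp, b, hb, rfl⟩ := hx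
      rw [smulLift_tmul, pairing_smul]
      -- The part of `b₀ f(b₁)` with `b₁` of degree below `k` has the right degree by induction, and
      -- the whole has it by `hF`; the top part, which computes `f ϑ`, is the difference.
      have hlow : ∀ x ∈ totalDegree 𝒜 X.grading k, pairing (AlgHom.id ℂ Ω) f
          ((GradedTensorProduct.of ℂ 𝒜 X.grading).symm x) - pairing (AlgHom.id ℂ Ω) f
          ((GradedAlgebra.proj X.grading k).lTensor Ω
            ((GradedTensorProduct.of ℂ 𝒜 X.grading).symm x)) ∈ 𝒜 k := by
        intro x hx
        induction hx using Submodule.span_induction with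
        | zero => simp
        | add x x' _ _ hx hx' =>
          convert add_mem hx hx' using 1
          simp only [map_add]
          abel
        | smul c x _ hx =>
          convert Submodule.smul_mem _ c hx using 1
          simp only [map_smul, smul_sub]
        | mem x hx =>
          obtain ⟨i, j, hij, a, ha, v, hv, rfl⟩ := hx
          by_cases hi : i = 0
          · obtain rfl : j = k := by omega
            simp [GradedTensorProduct.tmul, proj_of_mem X.grading hv]
          · have := SetLike.mul_mem_graded ha (ih j (by omega) v hv)
            rw [hij] at this
            simpa [GradedTensorProduct.tmul,
              proj_of_mem_ne X.grading hv (show j ≠ k by omega)] using this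
      have h2 : pairing (AlgHom.id ℂ Ω) f (C.coactDeg k b) ∈ 𝒜 k := by
        have h3 := sub_mem (hF k b hb) (hlow _ (C.coact_degree k b hb))
        convert h3 using 1
        rw [transform_apply]
        exact (sub_sub_cancel _ _).symm
      have := SetLike.mul_mem_graded hp h2
      rwa [zero_add] at this

/-! ### The two groups -/

section Groups

variable (hβ : Function.Bijective C.canonicalMap)

/-- By left `Ω`-linearity of the inverse canonical map, `w₀ (m (id ⊗ F) qtrs)(w₁)` is `m (id ⊗ F)`
applied to the preimage of the coaction of `w`, and that preimage is `1 ⊗ w`. -/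
lemma transform_mulId_qtrs (F : Ω →ₗ[ℂ] Ω) (hF : ∀ μ ∈ C.baseForms, ∀ w, F (μ * w) = μ * F w) :
    C.transform (C.mulId F hF ∘ₗ C.qtrs hβ) = F := by
  have hmk : ∀ z : Ω ⊗[ℂ] Ω, C.mulId F hF (Submodule.Quotient.mk z) =
      LinearMap.mul' ℂ Ω (F.lTensor Ω z) := fun _ => rfl
  have hq : ∀ v, ∃ z : Ω ⊗[ℂ] Ω, smulLift C.coactₗ z = (1 : Ω) ⊗ₜ[ℂ] v ∧
      C.qtrs hβ v = Submodule.Quotient.mk z := fun v => by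
    obtain ⟨z, hz⟩ := C.one_tmul_mem_range v
    refine ⟨z, hz, ?_⟩
    rw [qtrs, LinearMap.comp_apply, LinearEquiv.coe_coe, LinearEquiv.symm_apply_eq,
      LinearEquiv.ofBijective_apply, canonicalMap_mk, hz]
    rfl
  have key : ∀ t : Ω ⊗[ℂ] X.Env, pairing (AlgHom.id ℂ Ω) (C.mulId F hF ∘ₗ C.qtrs hβ) t =
      C.mulId F hF ((LinearEquiv.ofBijective C.canonicalMap hβ).symm
        (GradedTensorProduct.of ℂ 𝒜 X.grading t)) := fun t => by
    induction t with
    | zero => simp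
    | add x y hx hy => simp only [map_add, hx, hy]
    | tmul a v =>
      obtain ⟨z, hz, hzq⟩ := hq v
      have h1 : (LinearEquiv.ofBijective C.canonicalMap hβ).symm
          (GradedTensorProduct.of ℂ 𝒜 X.grading (a ⊗ₜ[ℂ] v)) =
          Submodule.Quotient.mk (a • z) := by
        rw [LinearEquiv.symm_apply_eq, LinearEquiv.ofBijective_apply, canonicalMap_mk,
          smulLift_smul, hz, TensorProduct.smul_tmul', smul_eq_mul, mul_one]
      rw [h1, pairing_tmul, LinearMap.comp_apply, hzq, hmk, hmk]
      clear hz hzq h1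
      induction z with
      | zero => simp
      | add x y hx hy => simp only [map_add, mul_add, smul_add, hx, hy]
      | tmul b c => simp [TensorProduct.smul_tmul', mul_assoc]
  ext w
  rw [transform_apply, key, of_coactₗ]
  have : (LinearEquiv.ofBijective C.canonicalMap hβ).symm (C.coact w) =
      Submodule.Quotient.mk (1 ⊗ₜ[ℂ] w) := by
    rw [LinearEquiv.symm_apply_eq, LinearEquiv.ofBijective_apply, canonicalMap_mk, smulLift_tmul,
      one_smul, of_coactₗ]
  rw [this, hmk]
  simp

/-- The product of vertical automorphisms. -/
def VertAut.mul (F G : C.VertAut) : C.VertAut :=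
  ⟨F.1.trans G.1, fun n w hw => G.2.1 n _ (F.2.1 n w hw),
    fun μ hμ w => by
      rw [LinearEquiv.trans_apply, LinearEquiv.trans_apply, F.2.2.1 μ hμ, G.2.2.1 μ hμ],
    by rw [LinearEquiv.trans_apply, F.2.2.2.1, G.2.2.2.1], by
      rw [show (F.1.trans G.1).toLinearMap = G.1.toLinearMap ∘ₗ F.1.toLinearMap from rfl,
        LinearMap.rTensor_comp, LinearMap.comp_assoc, F.2.2.2.2, ← LinearMap.comp_assoc,
        G.2.2.2.2, LinearMap.comp_assoc]⟩

/-- The identity as a vertical automorphism. -/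
def VertAut.one : C.VertAut :=
  ⟨LinearEquiv.refl ℂ Ω, fun _ _ hw => hw, fun _ _ _ => rfl, rfl, by
    ext w; simp⟩

/-- A degree preserving linear automorphism has a degree preserving inverse. -/
lemma symm_mem_of_degree {F : Ω ≃ₗ[ℂ] Ω} (hF : ∀ n, ∀ w ∈ 𝒜 n, F w ∈ 𝒜 n) {n : ℕ} {w : Ω}
    (hw : w ∈ 𝒜 n) : F.symm w ∈ 𝒜 n := by
  have key : ∀ v, F (GradedAlgebra.proj 𝒜 n v) = GradedAlgebra.proj 𝒜 n (F v) := fun v => by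
    induction v using DirectSum.Decomposition.inductionOn 𝒜 with
    | zero => simp
    | add x y hx hy => simp only [map_add, hx, hy]
    | @homogeneous i v =>
      by_cases h : i = n
      · subst h
        rw [proj_of_mem 𝒜 v.2, proj_of_mem 𝒜 (hF _ _ v.2)]
      · rw [proj_of_mem_ne 𝒜 v.2 h, proj_of_mem_ne 𝒜 (hF _ _ v.2) h, map_zero]
  have h := key (F.symm w)
  rw [LinearEquiv.apply_symm_apply, proj_of_mem 𝒜 hw] at h
  rw [← h, LinearEquiv.symm_apply_apply]
  exact proj_mem 𝒜 n _

/-- The inverse of a vertical automorphism. -/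
def VertAut.inv (F : C.VertAut) : C.VertAut :=
  ⟨F.1.symm, fun _ _ hw => symm_mem_of_degree F.2.1 hw,
    fun μ hμ w => by
      rw [LinearEquiv.symm_apply_eq, F.2.2.1 μ hμ, LinearEquiv.apply_symm_apply],
    by rw [LinearEquiv.symm_apply_eq, F.2.2.2.1], by
      have h := congrArg (fun L => F.1.symm.toLinearMap.rTensor X.Env ∘ₗ L ∘ₗ F.1.symm.toLinearMap)
        F.2.2.2.2
      simp only [← LinearMap.comp_assoc, ← LinearMap.rTensor_comp] at h
      rw [LinearEquiv.symm_comp, LinearMap.rTensor_id, LinearMap.id_comp, LinearMap.comp_assoc,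
        LinearMap.comp_assoc, LinearEquiv.comp_symm, LinearMap.comp_id] at h
      exact h.symm⟩

/-- The group of vertical automorphisms. -/
abbrev VertAut.group : Group C.VertAut where
  mul := VertAut.mul C
  one := VertAut.one C
  inv := VertAut.inv C
  mul_assoc _ _ _ := rfl
  one_mul _ := rfl
  mul_one _ := rfl
  inv_mul_cancel F := Subtype.ext (LinearEquiv.ext fun w => F.1.apply_symm_apply w)

lemma GaugeMap.isCovariant (f : C.GaugeMap) : C.IsCovariant f.1 :=
  (C.isCovariant_iff f.2.1).1 f.2.2.2.1

/-- The vertical automorphism `w ↦ w₀ f(w₁)`. -/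
def GaugeMap.toVertAut (f : C.GaugeMap) : C.VertAut :=
  have hinv : ∃ f', C.transform f' ∘ₗ C.transform f.1 = LinearMap.id ∧
      C.transform f.1 ∘ₗ C.transform f' = LinearMap.id := by
    obtain ⟨f', -, h, h'⟩ := f.2.2.2.2
    have hf := GaugeMap.isCovariant C f
    -- `transform_conv` needs covariance of the map acting first, so one composite uses that of `f`
    -- and the other that of its convolution inverse.
    refine ⟨f', LinearMap.ext fun w => ?_, LinearMap.ext fun w => ?_⟩
    · rw [LinearMap.comp_apply, ← C.transform_conv hf, h, transform_convOne]
    · rw [LinearMap.comp_apply, ← C.transform_conv (hf.inverse h h'), h', transform_convOne]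
  ⟨LinearEquiv.ofLinearMap (C.transform f.1) (C.transform hinv.choose) hinv.choose_spec.2
      hinv.choose_spec.1,
    fun _ _ hw => C.transform_mem f.2.1 hw, fun _ hμ w => C.transform_base_mul f.1 hμ w,
    (C.transform_one f.1).trans f.2.2.1,
    (C.isCovariant_iff_transform f.1).1 (GaugeMap.isCovariant C f)⟩

lemma VertAut.isCovariant (F : C.VertAut) :
    C.IsCovariant (C.mulId F.1.toLinearMap F.2.2.1 ∘ₗ C.qtrs hβ) := by
  rw [isCovariant_iff_transform, transform_mulId_qtrs]
  exact F.2.2.2.2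

lemma VertAut.isGradedMap (F : C.VertAut) :
    IsGradedMap X 𝒜 (C.mulId F.1.toLinearMap F.2.2.1 ∘ₗ C.qtrs hβ) :=
  C.isGradedMap_of_transform (by rw [transform_mulId_qtrs]; exact F.2.1)

lemma VertAut.conv_eq_convOne {F G : C.VertAut} (h : ∀ w, G.1 (F.1 w) = w) :
    C.conv (C.mulId F.1.toLinearMap F.2.2.1 ∘ₗ C.qtrs hβ)
      (C.mulId G.1.toLinearMap G.2.2.1 ∘ₗ C.qtrs hβ) = convOne X := by
  apply C.transform_injective
  ext w
  rw [C.transform_conv (VertAut.isCovariant C hβ F), transform_mulId_qtrs, transform_mulId_qtrs,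
    transform_convOne]
  exact h w

/-- The gauge map `m (id ⊗ F) qtrs`. -/
def VertAut.toGaugeMap (F : C.VertAut) : C.GaugeMap :=
  ⟨C.mulId F.1.toLinearMap F.2.2.1 ∘ₗ C.qtrs hβ, VertAut.isGradedMap C hβ F, by
      rw [← C.transform_one, C.transform_mulId_qtrs hβ]
      exact F.2.2.2.1,
    (C.isCovariant_iff (VertAut.isGradedMap C hβ F)).2 (VertAut.isCovariant C hβ F),
    C.mulId (VertAut.inv C F).1.toLinearMap (VertAut.inv C F).2.2.1 ∘ₗ C.qtrs hβ,
    VertAut.isGradedMap C hβ _,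
    VertAut.conv_eq_convOne C hβ fun w => F.1.symm_apply_apply w,
    VertAut.conv_eq_convOne C hβ fun w => F.1.apply_symm_apply w⟩

/-- Vertical automorphisms correspond to gauge maps. -/
def vertAutEquiv : C.VertAut ≃ C.GaugeMap where
  toFun := VertAut.toGaugeMap C hβ
  invFun := GaugeMap.toVertAut C
  left_inv F := Subtype.ext (LinearEquiv.toLinearMap_injective
    (C.transform_mulId_qtrs hβ F.1.toLinearMap F.2.2.1))
  right_inv f := Subtype.ext (C.transform_injective
    (C.transform_mulId_qtrs hβ _ (GaugeMap.toVertAut C f).2.2.1))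

end Groups

end Calculus

end Calculus

end QuantumBundle

end

/-! ### The two groups and their isomorphism. -/

theorem proposition3p3
    {H P Γ Ω : Type*} [Ring H] [HopfAlgebra ℂ H] [StarRing H] [StarModule ℂ H]
    [Ring P] [Algebra ℂ P] [StarRing P] [StarModule ℂ P]
    [AddCommGroup Γ] [Module ℂ Γ] [Module H Γ] [Module Hᵐᵒᵖ Γ] [SMulCommClass H Hᵐᵒᵖ Γ]
    [IsScalarTower ℂ H Γ] [IsScalarTower ℂ Hᵐᵒᵖ Γ] [Ring Ω] [Algebra ℂ Ω]
    (hH : QuantumBundle.IsQuantumGroup H) (ζ : QuantumBundle.QPBundle H P)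
    (X : QuantumBundle.FODC H Γ) (𝒜 : ℕ → Submodule ℂ Ω) [GradedAlgebra 𝒜]
    (C : QuantumBundle.Calculus ζ X 𝒜) :
    ∃ (hβ : Function.Bijective C.canonicalMap) (_ : Group C.GaugeMap) (_ : Group C.VertAut),
      (∀ f g : C.GaugeMap, (f * g).1 = C.conv f.1 g.1) ∧
      (1 : C.GaugeMap).1 = QuantumBundle.Calculus.convOne X ∧
      (∀ (F G : C.VertAut) (w : Ω), (F * G).1 w = G.1 (F.1 w)) ∧
      ∃ Λ : C.VertAut ≃* C.GaugeMap,
        (∀ F : C.VertAut, (Λ F).1 = C.mulId F.1.toLinearMap F.2.2.1 ∘ₗ C.qtrs hβ) ∧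
        (∀ f : C.GaugeMap, (Λ.symm f).1.toLinearMap =
          LinearMap.mul' ℂ Ω ∘ₗ f.1.lTensor Ω ∘ₗ C.coactₗ) := by
  have hβ := C.canonicalMap_bijective hH
  let gV : Group C.VertAut := QuantumBundle.Calculus.VertAut.group C
  -- The group law on gauge maps is transported along the bijection, so closure under convolution
  -- needs no separate proof; the law is identified with convolution afterwards by comparing the
  -- maps `w ↦ w₀ f(w₁)`.
  let gG : Group C.GaugeMap := (C.vertAutEquiv hβ).symm.group
  have hval : ∀ F : C.VertAut, C.transform (C.vertAutEquiv hβ F).1 = F.1.toLinearMap :=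
    fun F => C.transform_mulId_qtrs hβ F.1.toLinearMap F.2.2.1
  refine ⟨hβ, gG, gV, fun f g => ?_, ?_, fun F G w => rfl,
    { C.vertAutEquiv hβ with map_mul' := fun F G => ?_ }, fun F => rfl, fun f => rfl⟩
  · apply C.transform_injective
    refine (hval (QuantumBundle.Calculus.GaugeMap.toVertAut C f *
      QuantumBundle.Calculus.GaugeMap.toVertAut C g)).trans (LinearMap.ext fun w => ?_)
    exact (C.transform_conv (QuantumBundle.Calculus.GaugeMap.isCovariant C f) g.1 w).symm
  · apply C.transform_injective
    exact (hval 1).trans C.transform_convOne.symm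
  · exact (C.vertAutEquiv hβ).symm.injective (by
      refine ((C.vertAutEquiv hβ).symm_apply_apply _).trans ?_
      refine Eq.trans ?_ ((C.vertAutEquiv hβ).symm.mulEquiv.map_mul _ _).symm
      exact congrArg₂ (· * ·) ((C.vertAutEquiv hβ).symm_apply_apply F).symm
        ((C.vertAutEquiv hβ).symm_apply_apply G).symm)
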